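/- **Setting.** Let $K$ be a $p$-field (a nonarchimedean local field) with ring of integers $R$ and residue field of cardinality $q$, let $\mu$ be the additive Haar measure with $\mu(R)=1$, let $|x|=\mu(xR)$ be the canonical absolute value, and for $N\ge 2$ put $\|x\|=\max_i|x_i|$ and $|dx|=\mu^N$ on $K^N$. Let $a,b\in\mathbb C$. Let $\rho:\{0\}\cup\bigcup_{n\ge1}\{n,\tfrac1n\}\to\mathbb C$ satisfy $$\limsup_{n\to\infty}\frac{\log|\rho(1/n)|}{\log n}\le 1,\qquad \limsup_{n\to\infty}\frac{\log|\rho(n)|}{\log n}=-\infty\qquad(\log 0:=-\infty).$$ For $\boldsymbol s=(s_{ij})_{i<j}\in\mathbb C^{\binom N2}$ put $$Z_N^\rho(K,a,b,\boldsymbol s)=\int_{K^N}\rho(\|x\|)\big(\max_{i<j}|x_i-x_j|\big)^a\big(\min_{i<j}|x_i-x_j|\big)^b\prod_{i<j}|x_i-x_j|^{s_{ij}}\,|dx| .$$ **Combinatorial data.** A splitting filtration of order $N$ is a chain $\sigma=(\pi_0>\pi_1>\dots>\pi_L)$ of partitions of $[N]=\{1,\dots,N\}$, each a proper refinement of the one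 before, with $\pi_0=\{[N]\}$ and $\pi_L$ the partition into singletons; $L=L(\sigma)$ is its length, and $\pi_0,\dots,\pi_{L-1}$ are its levels. The set of these is $\mathcal S_N$. The branches $\mathcal B(\sigma)$ are the parts with more than one element of the levels. $\sigma$ is reduced, $\sigma\in\mathcal R_N$, if each branch lies in exactly one level. Write $\sigma\simeq\sigma'$ if $\mathcal B(\sigma)=\mathcal B(\sigma')$. For $\lambda\in\mathcal B(\sigma)$ let $\ell_\sigma(\lambda)$ be the largest $\ell<L$ with $\lambda\in\pi_\ell$ and $\deg_\sigma(\lambda)=\#\{\lambda'\in\pi_{\ell_\sigma(\lambda)+1}:\lambda'\subset\lambda\}$. With falling factorials $(n)_k$, put $$M_{\sigma,q}=\prod_{\lambda\in\mathcal B(\sigma)}(q-1)_{\deg_\sigma(\lambda)-1},\qquad e_\lambda(\boldsymbol s)=\#\lambda-1+\sum_{i<j,\ i,j\in\lambda}s_{ij},\qquad E_{\sigma,\ell}(\boldsymbol s)=\sum_{\lambda\in\mathcal B(\sigma)\cap\pi_\ell}e_\lambda(\boldsymbol s),$$ $$\mathcal{RP}_N(a,b)=\Big\{\boldsymbol s:\operatorname{Re}\Big(N-1+a+b+\sum_{i<j}s_{ij}\Big)>0\Big\},$$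 $$\mathcal{LP}_\sigma(b)=\bigcap_{\ell=1}^{L-1}\{\boldsymbol s:\operatorname{Re}(b+E_{\sigma,\ell}(\boldsymbol s))>0\},\qquad \mathcal{BP}_\sigma=\bigcap_{\lambda\in\mathcal B(\sigma)\setminus\{[N]\}}\{\boldsymbol s:\operatorname{Re}(e_\lambda(\boldsymbol s))>0\},$$ $$J_{\sigma,q}(b,\boldsymbol s)=\frac{M_{\sigma,q}}{q^{N-1}}\prod_{\ell=1}^{L-1}\frac1{q^{b+E_{\sigma,\ell}(\boldsymbol s)}-1},\qquad I_{\sigma,q}(\boldsymbol s)=\frac{M_{\sigma,q}}{q^{N-1}}\prod_{\lambda\in\mathcal B(\sigma)\setminus\{[N]\}}\frac1{q^{e_\lambda(\boldsymbol s)}-1},$$ $$H_q^\rho(z)=\frac{1-q^{-z}}{1-q^{-(z-1)}}\sum_{m\in\mathbb Z}\rho(q^m)q^{mz}.$$ **Theorem.** (a) The set $$\Omega_{N,q}(a,b)=\mathcal{RP}_N(a,b)\cap\bigcap_{\sigma\in\mathcal S_N,\ M_{\sigma,q}>0}\mathcal{LP}_\sigma(b)$$ is open and convex, and the integral $Z_N^\rho(K,a,b,\boldsymbol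 s)$ converges absolutely for every $\boldsymbol s\in\Omega_{N,q}(a,b)$. If $\rho(q^m)\ne0$ for some $m\in\mathbb Z$, then $\Omega_{N,q}(a,b)$ is the largest open set of $\boldsymbol s$ on which the integral converges absolutely. (b) On each compact subset $C$ of $\Omega_{N,q}(a,b)$, $$Z_N^\rho(K,a,b,\boldsymbol s)=H_q^\rho\Big(N+a+b+\sum_{i<j}s_{ij}\Big)\cdot\sum_{\sigma\in\mathcal S_N,\ M_{\sigma,q}>0}J_{\sigma,q}(b,\boldsymbol s).$$ The series over $m$ in $H_q^\rho$ converges absolutely and uniformly on $C$ (the series of absolute values converges uniformly), and the expansion of the right-hand side as a series over $m$ converges uniformly on $C$ to the integral. (c) Let $\sigma^*\in\mathcal R_N$. Then $\mathcal{BP}_{\sigma^*}\subset\mathcal{LP}_\sigma(0)$ for all $\sigma\simeq\sigma^*$, and for every $\boldsymbol s\in\mathcal{BP}_{\sigma^*}$ $$\sum_{\sigma\in\mathcal S_N,\ \sigma\simeq\sigma^*}J_{\sigma,q}(0,\boldsymbol s)=I_{\sigma^*,q}(\boldsymbol s).$$ If $b=0$, then the set $$\mathcal{RP}_N(a,0)\cap\bigcap_{\sigma^*\in\mathcal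 R_N,\ M_{\sigma^*,q}>0}\mathcal{BP}_{\sigma^*}$$ is open and convex, the integral converges absolutely on it, and on each of its compact subsets $$Z_N^\rho(K,a,0,\boldsymbol s)=H_q^\rho\Big(N+a+\sum_{i<j}s_{ij}\Big)\cdot\sum_{\sigma^*\in\mathcal R_N,\ M_{\sigma^*,q}>0}I_{\sigma^*,q}(\boldsymbol s),$$ with absolute and uniform convergence of the series over $m$ in the same sense as in (b). -/

import Mathlib

open MeasureTheory Filter Topology
open scoped ValuativeRel

noncomputable section

/-! ### The canonical data of a `p`-field -/

namespace PField

variable (K : Type*) [Field K] [ValuativeRel K] [TopologicalSpace K] [IsNonarchimedeanLocalField K]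

/-- The closed unit ball `R = 𝒪[K]` as a compact set with nonempty interior. -/
def integers : TopologicalSpace.PositiveCompacts K where
  carrier := (𝒪[K] : Set K)
  isCompact' := IsNonarchimedeanLocalField.isCompact_closedBall K 1
  interior_nonempty' := by
    have hmem : (𝒪[K] : Set K) ∈ 𝓝 (0 : K) := by
      refine (IsValuativeTopology.hasBasis_nhds_zero' K).mem_iff.mpr ⟨1, one_ne_zero, ?_⟩
      intro x hx
      exact (show ValuativeRel.valuation K x < 1 from hx).le
    exact ⟨0, mem_interior_iff_mem_nhds.mpr hmem⟩

variable [MeasurableSpace K] [BorelSpace K]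

/-- The additive Haar measure `μ` of `K`, normalised by `μ(R) = 1`. -/
def haar : Measure K := Measure.addHaarMeasure (integers K)

theorem haar_integers : haar K (𝒪[K] : Set K) = 1 :=
  Measure.addHaarMeasure_self (K₀ := integers K)

/-- The residue cardinality `q = #(R / P)`. -/
def residueCard : ℕ := Nat.card 𝓀[K]

variable {K}

/-- The canonical absolute value `|x| = μ(xR) / μ(R) = μ(xR)`. -/
def abs (x : K) : ℝ := (haar K ((fun y => x * y) '' (𝒪[K] : Set K))).toReal

/-- The norm `‖x‖ = max_i |x_i|` on `K^N`. -/
def norm {N : ℕ} (x : Fin N → K) : ℝ := ⨆ i, abs (x i)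

end PField

/-- Index pairs `i < j` in `[N]`; the parameter space `ℂ^(N choose 2)` is `Pairs N → ℂ`. -/
abbrev Pairs (N : ℕ) : Type := {p : Fin N × Fin N // p.1 < p.2}

namespace PField

variable {K : Type*} [Field K] [ValuativeRel K] [TopologicalSpace K]
  [IsNonarchimedeanLocalField K] [MeasurableSpace K] [BorelSpace K] {N : ℕ}

/-- The distance `|x_i - x_j|` of the pair `p = (i, j)`. -/
def dist (x : Fin N → K) (p : Pairs N) : ℝ := abs (x p.1.1 - x p.1.2)

/-- `max_{i<j} |x_i - x_j|` -/
def maxDist (x : Fin N → K) : ℝ := ⨆ p : Pairs N, dist x p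

/-- `min_{i<j} |x_i - x_j|` -/
def minDist (x : Fin N → K) : ℝ := ⨅ p : Pairs N, dist x p

/-- The integrand of `Z_N^ρ(K, a, b, s)`. -/
def integrand (ρ : ℝ → ℂ) (a b : ℂ) (s : Pairs N → ℂ) (x : Fin N → K) : ℂ :=
  ρ (norm x) * (maxDist x : ℂ) ^ a * (minDist x : ℂ) ^ b * ∏ p : Pairs N, (dist x p : ℂ) ^ s p

variable (K) in
/-- The integral `Z_N^ρ(K, a, b, s)` converges absolutely. -/
def ZConverges (ρ : ℝ → ℂ) (a b : ℂ) (s : Pairs N → ℂ) : Prop :=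
  Integrable (fun x : Fin N → K => integrand ρ a b s x) (Measure.pi fun _ => haar K)

variable (K) in
/-- `Z_N^ρ(K, a, b, s)` -/
def Z (ρ : ℝ → ℂ) (a b : ℂ) (s : Pairs N → ℂ) : ℂ :=
  ∫ x : Fin N → K, integrand ρ a b s x ∂(Measure.pi fun _ => haar K)

end PField

/-- The growth conditions on `ρ`, with values in the extended reals and `log 0 = -∞`. Only values
of `ρ` at `0`, at positive integers and at their inverses are ever used. -/
def GrowthCondition (ρ : ℝ → ℂ) : Prop :=
  limsup (fun n : ℕ => ENNReal.log ‖ρ (1 / (n : ℝ))‖ₑ / ((Real.log n : ℝ) : EReal)) atTop ≤ 1 ∧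
  limsup (fun n : ℕ => ENNReal.log ‖ρ (n : ℝ)‖ₑ / ((Real.log n : ℝ) : EReal)) atTop = ⊥

/-- The root polytope. -/
def rootPolytope (N : ℕ) (a b : ℂ) : Set (Pairs N → ℂ) :=
  {s | 0 < ((N : ℂ) - 1 + a + b + ∑ p, s p).re}

/-- The factor `(1 - q^{-z}) / (1 - q^{-(z-1)})` of the root function. -/
def rootFactor (q : ℕ) (z : ℂ) : ℂ := (1 - (q : ℂ) ^ (-z)) / (1 - (q : ℂ) ^ (-(z - 1)))

/-- The term `ρ(q^m) q^{mz}` of the series in the root function. -/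
def rootTerm (q : ℕ) (ρ : ℝ → ℂ) (z : ℂ) (m : ℤ) : ℂ := ρ ((q : ℝ) ^ m) * (q : ℂ) ^ ((m : ℂ) * z)

/-- `H_q^ρ(z)` -/
def rootFunction (q : ℕ) (ρ : ℝ → ℂ) (z : ℂ) : ℂ := rootFactor q z * ∑' m : ℤ, rootTerm q ρ z m

/-! ### Splitting filtrations -/

/-- A splitting filtration `⊤ = ⋔₀ > ⋔₁ > ⋯ > ⋔_L = ⊥` of `[N]`. The order of `Finpartition` is
refinement, with `⊤ = {[N]}` and `⊥` the partition into singletons. -/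
@[ext]
structure SplittingFiltration (N : ℕ) where
  length : ℕ
  ptn : Fin (length + 1) → Finpartition (Finset.univ : Finset (Fin N))
  strictAnti : StrictAnti ptn
  first : ptn 0 = ⊤
  last : ptn (Fin.last length) = ⊥

namespace SplittingFiltration

variable {N : ℕ}

instance : Finite (SplittingFiltration N) := by
  let T := Finpartition (Finset.univ : Finset (Fin N))
  have hL : ∀ σ : SplittingFiltration N, σ.length < Fintype.card T := fun σ => by
    have h := Fintype.card_le_of_injective σ.ptn σ.strictAnti.injective
    rw [Fintype.card_fin] at h
    exact h
  refine Finite.of_injective (β := Σ L : Fin (Fintype.card T), (Fin ((L : ℕ) + 1) → T))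
    (fun σ => ⟨⟨σ.length, hL σ⟩, σ.ptn⟩) ?_
  rintro ⟨L, p, h1, h2, h3⟩ ⟨L', p', h1', h2', h3'⟩ h
  simp only [Sigma.mk.injEq, Fin.mk.injEq] at h
  obtain ⟨rfl, h⟩ := h
  simp only [heq_eq_eq] at h
  subst h
  rfl

instance : Fintype (SplittingFiltration N) := Fintype.ofFinite _

variable (σ : SplittingFiltration N)

/-- The `ℓ`-th partition `⋔_ℓ`, for `0 ≤ ℓ ≤ L`. -/
def part (ℓ : ℕ) : Finset (Finset (Fin N)) :=
  (σ.ptn ⟨min ℓ σ.length, Nat.lt_succ_of_le (min_le_right _ _)⟩).parts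

/-- The branches: parts with more than one element that occur in a level `⋔_0, …, ⋔_{L-1}`. -/
def branches : Finset (Finset (Fin N)) :=
  ((Finset.range σ.length).biUnion σ.part).filter fun t => 1 < t.card

/-- The branches other than `[N]`. -/
def properBranches : Finset (Finset (Fin N)) := σ.branches.erase Finset.univ

/-- Every branch lies in exactly one level. -/
def IsReduced : Prop := ∀ t ∈ σ.branches, ∃! ℓ : ℕ, ℓ < σ.length ∧ t ∈ σ.part ℓ

instance : DecidablePred (IsReduced (N := N)) := Classical.decPred _

/-- The equivalence relation: equal branch sets. -/
def Equivalent (σ τ : SplittingFiltration N) : Prop := σ.branches = τ.branches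

instance (τ : SplittingFiltration N) : DecidablePred fun σ => Equivalent σ τ :=
  Classical.decPred _

/-- Branch depth: the largest `ℓ < L` with `t ∈ ⋔_ℓ`. -/
def depth (t : Finset (Fin N)) : ℕ :=
  ((Finset.range σ.length).filter fun ℓ => t ∈ σ.part ℓ).sup id

/-- Branch degree: the number of parts of `⋔_{depth + 1}` inside `t`. -/
def degree (t : Finset (Fin N)) : ℕ := ((σ.part (σ.depth t + 1)).filter fun u => u ⊆ t).card

/-- The multiplicity `M_{σ,q}`, a product of falling factorials `(q - 1)_{deg - 1}`. -/
def multiplicity (q : ℕ) : ℕ := ∏ t ∈ σ.branches, (q - 1).descFactorial (σ.degree t - 1)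

/-- The branch exponent `e_t(s) = (#t - 1) + ∑_{i<j, i,j ∈ t} s_{ij}`. -/
def branchExponent (t : Finset (Fin N)) (s : Pairs N → ℂ) : ℂ :=
  ((t.card : ℂ) - 1) + ∑ p : Pairs N with p.1.1 ∈ t ∧ p.1.2 ∈ t, s p

/-- The branch polytope. -/
def branchPolytope : Set (Pairs N → ℂ) :=
  ⋂ t ∈ σ.properBranches, {s | 0 < (branchExponent t s).re}

/-- The branch function `I_{σ,q}`. -/
def branchFunction (q : ℕ) (s : Pairs N → ℂ) : ℂ :=
  (σ.multiplicity q : ℂ) / (q : ℂ) ^ (N - 1) *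
    ∏ t ∈ σ.properBranches, 1 / ((q : ℂ) ^ branchExponent t s - 1)

/-- The level exponent `E_{σ,ℓ}`. -/
def levelExponent (ℓ : ℕ) (s : Pairs N → ℂ) : ℂ :=
  ∑ t ∈ σ.branches ∩ σ.part ℓ, branchExponent t s

/-- The level polytope. -/
def levelPolytope (b : ℂ) : Set (Pairs N → ℂ) :=
  ⋂ ℓ ∈ Finset.Ico 1 σ.length, {s | 0 < (b + σ.levelExponent ℓ s).re}

/-- The level function `J_{σ,q}(b, ·)`. -/
def levelFunction (q : ℕ) (b : ℂ) (s : Pairs N → ℂ) : ℂ :=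
  (σ.multiplicity q : ℂ) / (q : ℂ) ^ (N - 1) *
    ∏ ℓ ∈ Finset.Ico 1 σ.length, 1 / ((q : ℂ) ^ (b + σ.levelExponent ℓ s) - 1)

end SplittingFiltration

/-- The polytope `Ω_{N,q}(a, b)`. -/
def omegaPolytope (N q : ℕ) (a b : ℂ) : Set (Pairs N → ℂ) :=
  rootPolytope N a b ∩
    ⋂ σ : SplittingFiltration N, ⋂ _ : 0 < σ.multiplicity q, σ.levelPolytope b

/-- The intersection of the root polytope for `b = 0` with the branch polytopes of all reduced
splitting filtrations of positive multiplicity. -/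
def reducedPolytope (N q : ℕ) (a : ℂ) : Set (Pairs N → ℂ) :=
  rootPolytope N a 0 ∩
    ⋂ σ : SplittingFiltration N, ⋂ _ : σ.IsReduced ∧ 0 < σ.multiplicity q, σ.branchPolytope

/-- The sum of the level functions of all splitting filtrations of positive multiplicity. -/
def levelSum (N q : ℕ) (b : ℂ) (s : Pairs N → ℂ) : ℂ :=
  ∑ σ : SplittingFiltration N with 0 < σ.multiplicity q, σ.levelFunction q b s

/-- The sum of the branch functions of all reduced splitting filtrations of positive
multiplicity. -/
def branchSum (N q : ℕ) (s : Pairs N → ℂ) : ℂ :=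
  ∑ σ : SplittingFiltration N with σ.IsReduced ∧ 0 < σ.multiplicity q, σ.branchFunction q s

end

/-! Almost every x in K^N has distinct coordinates, and then all |x_i - x_j| are powers of q. Let
‖x‖ = q^m, let the largest distance be q^{m-k}, where k ≥ 0 by the ultrametric inequality, and let
P_l be the partition of [N] given by |x_i - x_j| ≤ q^{m-k-l}. Then P_0 = {[N]}, P_1 is a proper
refinement and P_l is eventually discrete: P is a `SplitSequence`. The triples (m, k, P) cut K^N, up
to a null set, into countably many disjoint cells on which the integrand is constant. Absolute
convergence is therefore summability of measure times value over the triples, and the integral is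
that sum (`zConverges_iff`, `hasSum_Z`).

Measures of cells are found by peeling off residues. A vector in R^N is a vector of residue
representatives plus π times another vector of R^N, and the residue vectors that split P_0 into P_1
are counted by falling factorials (`piHaar_filtrationSet_succ`). With z = N + a + b + Σ s_ij,
measure times value factors into ρ(q^m) q^{mz}, a term δ_k q^{-k(z-1)} with δ_0 = 1 and δ_k = 1 -
1/q for k ≥ 1, and a weight of P (`piHaar_real_cell_mul_cellValue`). The sum over m is the series in
H, and the sum over k is its prefactor (`hasSum_rootDensity`).

Without its repetitions P becomes a splitting filtration σ; the repetitions are recorded by the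
number ν_ℓ + 1 of occurrences of each level 1 ≤ ℓ < L (`sequenceEquiv`). The weight is M_σ / q^{N-1}
times the product of the q^{-(b + E_ℓ)(ν_ℓ + 1)}, so geometric series give J_σ
(`SplitSequence.hasSum_weight`). Conversely, restricting a summable family to the line of varying k
and to the axes of ν yields exactly the inequalities that define Ω
(`mem_omegaPolytope_of_zConverges`).

For b = 0 the weight regroups by branches into M / q^{N-1} times the product of q^{-e_t n_t}, where
n_t is the number of steps at which the proper branch t occurs. Given the branch set, the n_t ≥ 1
are arbitrary and determine P (`branchEquiv`). The sum over all sequences with one branch set is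
thus both I and the sum of the J over the class; taking all n_t = 1 yields the unique reduced
representative. -/

noncomputable section

/-! ### Valuation and topology of K -/

namespace PField

open IsNonarchimedeanLocalField ValuativeRel WithZero
open scoped NNReal ENNReal Pointwise

section

variable (K : Type*) [Field K] [ValuativeRel K] [TopologicalSpace K] [IsNonarchimedeanLocalField K]

/-- The valuation of `K` with values in `ℤᵐ⁰`. -/
def intVal (x : K) : ℤᵐ⁰ := valueGroupWithZeroIsoInt K (valuation K x)

variable {K}

theorem strictMono_isoInt : StrictMono (valueGroupWithZeroIsoInt K) :=
  (valueGroupWithZeroIsoInt K).strictMono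

theorem intVal_mul (x y : K) : intVal K (x * y) = intVal K x * intVal K y := by
  simp [intVal]

theorem intVal_eq_zero {x : K} : intVal K x = 0 ↔ x = 0 := by
  simp [intVal]

theorem intVal_add_le (x y : K) : intVal K (x + y) ≤ max (intVal K x) (intVal K y) := by
  unfold intVal
  rw [← strictMono_isoInt.monotone.map_max]
  exact strictMono_isoInt.monotone ((valuation K).map_add x y)

theorem intVal_neg (x : K) : intVal K (-x) = intVal K x := by
  simp [intVal]

theorem intVal_surjective : Function.Surjective (intVal K) :=
  (valueGroupWithZeroIsoInt K).surjective.comp valuation_surjective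

theorem mem_integers_iff_intVal {x : K} : x ∈ 𝒪[K] ↔ intVal K x ≤ 1 := by
  rw [Valuation.mem_integer_iff, intVal, ← map_one (valueGroupWithZeroIsoInt K)]
  exact strictMono_isoInt.le_iff_le.symm

variable (K) in
/-- A uniformizer. -/
def unif : K := (intVal_surjective (K := K) (exp (-1))).choose

theorem intVal_unif : intVal K (unif K) = exp (-1) :=
  (intVal_surjective (K := K) (exp (-1))).choose_spec

theorem unif_ne_zero : unif K ≠ 0 := by
  intro h
  have := intVal_unif (K := K)
  rw [intVal_eq_zero.2 h] at this
  exact exp_ne_zero this.symm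

theorem intVal_inv (x : K) : intVal K x⁻¹ = (intVal K x)⁻¹ := by simp [intVal]

theorem intVal_unif_zpow (n : ℤ) : intVal K (unif K ^ n) = exp (-n) := by
  have : intVal K (unif K ^ n) = intVal K (unif K) ^ n := by simp [intVal]
  rw [this, intVal_unif, ← exp_zsmul]
  simp

/-- A residue vanishes exactly when the element is a nonunit, that is, has valuation below 1; by
discreteness of the value group this means at most `exp (-1)`. -/
theorem residue_eq_iff {x y : 𝒪[K]} : IsLocalRing.residue 𝒪[K] x = IsLocalRing.residue 𝒪[K] y ↔
    intVal K ((x : K) - y) ≤ exp (-1) := by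
  rw [← sub_eq_zero, ← map_sub, IsLocalRing.residue_eq_zero_iff, IsLocalRing.mem_maximalIdeal,
    mem_nonunits_iff, (Valuation.integer.integers (valuation K)).isUnit_iff_valuation_eq_one]
  have h1 : intVal K ((x - y : 𝒪[K]) : K) ≤ 1 := mem_integers_iff_intVal.1 (x - y).2
  have h2 : valuation K (algebraMap 𝒪[K] K (x - y)) = 1 ↔ intVal K ((x - y : 𝒪[K]) : K) = 1 := by
    unfold intVal
    rw [map_eq_one_iff _ strictMono_isoInt.injective]
    rfl
  rw [h2]
  change ¬ (intVal K ((x : K) - y) = 1) ↔ _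
  change intVal K ((x : K) - y) ≤ 1 at h1
  generalize intVal K ((x : K) - y) = v at *
  induction v using WithZero.expRecOn with
  | zero => simp
  | exp a =>
    rw [← exp_zero, exp_le_exp] at h1
    rw [← exp_zero, exp_inj, exp_le_exp]
    omega

/-- Compact balls of radius growing with the powers of the uniformizer exhaust K. Product measures
need the resulting σ-finiteness of Haar measure. -/
instance : SigmaCompactSpace K := by
  refine ⟨⟨fun n => {x | valuation K x ≤ valuation K (unif K ^ (-(n : ℤ)))},
    fun n => isCompact_closedBall K _, ?_⟩⟩
  refine Set.eq_univ_of_forall fun x => Set.mem_iUnion.2 ?_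
  have key : ∀ n : ℕ, intVal K x ≤ intVal K (unif K ^ (-(n : ℤ))) →
      valuation K x ≤ valuation K (unif K ^ (-(n : ℤ))) := fun n h =>
    strictMono_isoInt.le_iff_le.1 h
  by_cases hx : x = 0
  · exact ⟨0, by simp [hx]⟩
  obtain ⟨a, ha⟩ : ∃ a, intVal K x = exp a := by
    have := intVal_eq_zero.not.2 hx
    exact ⟨_, (exp_log this).symm⟩
  refine ⟨a.toNat, key _ ?_⟩
  rw [intVal_unif_zpow, ha, exp_le_exp]
  omega

theorem hasBasis_nhds_zero_intVal :
    (𝓝 (0 : K)).HasBasis (fun _ : ℕ => True) fun n => {x | intVal K x ≤ exp (-(n : ℤ))} := by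
  refine (IsValuativeTopology.hasBasis_nhds_zero' K).to_hasBasis ?_ ?_
  · intro γ hγ
    obtain ⟨a, ha⟩ : ∃ a, valueGroupWithZeroIsoInt K γ = exp a := by
      have : valueGroupWithZeroIsoInt K γ ≠ 0 := by simpa using hγ
      exact ⟨_, (exp_log this).symm⟩
    refine ⟨(-a + 1).toNat, trivial, fun x hx => ?_⟩
    refine strictMono_isoInt.lt_iff_lt.1 (lt_of_le_of_lt hx ?_)
    rw [ha, exp_lt_exp]
    omega
  · intro n _
    refine ⟨(valueGroupWithZeroIsoInt K).symm (exp (-(n : ℤ))), by simp, fun x hx => ?_⟩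
    have := strictMono_isoInt.monotone (le_of_lt hx)
    rwa [OrderMonoidIso.apply_symm_apply] at this

instance : FirstCountableTopology K := by
  have : (𝓝 (0 : K)).IsCountablyGenerated := hasBasis_nhds_zero_intVal.isCountablyGenerated
  exact ⟨fun x => by
    rw [← map_add_left_nhds_zero x]
    infer_instance⟩

/-- Ensures that the Borel sets of K^N are generated by products. A countable basis at 0 makes the
additive uniformity pseudometrizable, and σ-compactness does the rest. -/
instance : SecondCountableTopology K := by
  let := IsTopologicalAddGroup.rightUniformSpace K
  have := isUniformAddGroup_of_addCommGroup (G := K)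
  have : (uniformity K).IsCountablyGenerated := by
    rw [uniformity_eq_comap_nhds_zero]
    infer_instance
  let := UniformSpace.pseudoMetricSpace K
  infer_instance

theorem isOpen_closedBall_intVal (n : ℤ) : IsOpen {x : K | intVal K x ≤ exp n} := by
  refine isOpen_iff_mem_nhds.2 fun x hx => ?_
  rw [← map_add_left_nhds_zero x]
  refine Filter.mem_map.2 ((hasBasis_nhds_zero_intVal.mem_iff).2 ⟨(-n).toNat, trivial, fun y hy => ?_⟩)
  refine (intVal_add_le x y).trans (max_le hx (le_trans hy ?_))
  rw [exp_le_exp]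
  omega

/-- Powers of the uniformizer are nonzero and tend to 0. Non-discreteness makes points null for Haar
measure. -/
instance : (𝓝[≠] (0 : K)).NeBot := by
  rw [neBot_iff]
  intro h
  have : {0} ∈ 𝓝 (0 : K) := by
    have := mem_nhdsWithin_iff_exists_mem_nhds_inter.1 (h ▸ Filter.mem_bot : (∅ : Set K) ∈ 𝓝[≠] 0)
    obtain ⟨u, hu, hu'⟩ := this
    filter_upwards [hu] with x hx
    by_contra h0
    exact hu' ⟨hx, h0⟩
  obtain ⟨n, -, hn⟩ := hasBasis_nhds_zero_intVal.mem_iff.1 this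
  have : unif K ^ (n : ℤ) ∈ ({0} : Set K) := hn (by
    change intVal K _ ≤ _
    rw [intVal_unif_zpow])
  exact (zpow_ne_zero n unif_ne_zero) this

instance : T2Space K := by
  let := IsTopologicalAddGroup.rightUniformSpace K
  have := isUniformAddGroup_of_addCommGroup (G := K)
  infer_instance

theorem two_le_residueCard : 2 ≤ residueCard K := by
  unfold residueCard
  have := Finite.one_lt_card (α := 𝓀[K])
  omega

end

/-! ### Scaling of Haar measure and the canonical absolute value -/

variable {K : Type*} [Field K] [ValuativeRel K] [TopologicalSpace K] [IsNonarchimedeanLocalField K]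
  [MeasurableSpace K] [BorelSpace K]

instance : (haar K).IsAddHaarMeasure := by unfold haar; infer_instance
instance : (haar K).Regular := by unfold haar; infer_instance


omit [MeasurableSpace K] [BorelSpace K] in
theorem one_lt_residueCard : (1 : ℝ≥0) < residueCard K := by
  exact_mod_cast two_le_residueCard (K := K)

variable (K) in
/-- The uniformizer as a unit. -/
def unifUnit : Kˣ := Units.mk0 (unif K) unif_ne_zero

omit [MeasurableSpace K] [BorelSpace K] in
theorem mem_unifUnit_zpow_smul_integers {n : ℤ} {x : K} :
    x ∈ unifUnit K ^ n • (𝒪[K] : Set K) ↔ intVal K x ≤ exp (-n) := by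
  rw [Set.mem_smul_set_iff_inv_smul_mem, SetLike.mem_coe, mem_integers_iff_intVal,
    Units.smul_def, smul_eq_mul, intVal_mul, ← zpow_neg, Units.val_zpow_eq_zpow_val]
  change intVal K (unif K ^ (-n)) * _ ≤ _ ↔ _
  rw [intVal_unif_zpow, neg_neg]
  generalize intVal K x = v
  induction v using WithZero.expRecOn with
  | zero => simp
  | exp a =>
    rw [← exp_add, ← exp_zero, exp_le_exp, exp_le_exp]
    constructor <;> intro <;> linarith

/-- R is a disjoint union of q translates of its maximal ideal, one for each residue class, and
these have equal measure. -/
theorem haar_unifUnit_smul_integers :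
    haar K (unifUnit K • (𝒪[K] : Set K)) = (residueCard K : ℝ≥0∞)⁻¹ := by
  obtain ⟨s, hs⟩ := (IsLocalRing.residue_surjective (R := 𝒪[K])).hasRightInverse
  have hmem : ∀ x : K, x ∈ unifUnit K • (𝒪[K] : Set K) ↔ intVal K x ≤ exp (-1) := fun x => by
    simpa using mem_unifUnit_zpow_smul_integers (n := 1) (x := x)
  have hball : (𝒪[K] : Set K) = ⋃ c : 𝓀[K], (s c : K) +ᵥ (unifUnit K • (𝒪[K] : Set K)) := by
    ext x
    simp only [Set.mem_iUnion, Set.mem_vadd_set_iff_neg_vadd_mem, vadd_eq_add, hmem]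
    constructor
    · intro hx
      refine ⟨IsLocalRing.residue 𝒪[K] ⟨x, hx⟩, ?_⟩
      rw [neg_add_eq_sub, ← neg_sub, intVal_neg]
      exact residue_eq_iff.1 (hs (IsLocalRing.residue 𝒪[K] ⟨x, hx⟩))
    · rintro ⟨c, hc⟩
      have : x = s c + (-s c + x) := by ring
      rw [SetLike.mem_coe, mem_integers_iff_intVal, this]
      refine (intVal_add_le _ _).trans (max_le (mem_integers_iff_intVal.1 (s c).2) (hc.trans ?_))
      rw [← exp_zero, exp_le_exp]; norm_num
  have hdisj : Pairwise (Function.onFun Disjoint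
      fun c : 𝓀[K] => (s c : K) +ᵥ (unifUnit K • (𝒪[K] : Set K))) := by
    intro c d hcd
    refine Set.disjoint_left.2 fun x hc hd => hcd ?_
    simp only [Set.mem_vadd_set_iff_neg_vadd_mem, vadd_eq_add, hmem] at hc hd
    rw [← hs c, ← hs d, residue_eq_iff]
    have : (s c : K) - s d = (-s d + x) + -(-s c + x) := by ring
    rw [this]
    refine (intVal_add_le _ _).trans (max_le hd ?_)
    rw [intVal_neg]; exact hc
  have hmeas : MeasurableSet (unifUnit K • (𝒪[K] : Set K)) := by
    have : unifUnit K • (𝒪[K] : Set K) = {x | intVal K x ≤ exp (-1)} := Set.ext hmem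
    rw [this]
    exact (isOpen_closedBall_intVal (-1)).measurableSet
  have h := haar_integers K
  have := Fintype.ofFinite 𝓀[K]
  rw [hball, measure_iUnion hdisj (fun c => hmeas.const_vadd _)] at h
  simp only [measure_vadd, tsum_fintype, Finset.sum_const, Finset.card_univ, nsmul_eq_mul] at h
  rw [residueCard, Nat.card_eq_fintype_card]
  exact ENNReal.eq_inv_of_mul_eq_one_left (by rwa [mul_comm] at h)

theorem distribHaarChar_unifUnit :
    distribHaarChar K (unifUnit K) = (residueCard K : ℝ≥0)⁻¹ := by
  have hq : (residueCard K : ℝ≥0) ≠ 0 := (one_pos.trans one_lt_residueCard).ne'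
  refine distribHaarChar_eq_of_measure_smul_eq_mul (μ := haar K) (s := (𝒪[K] : Set K))
    (by simp [haar_integers]) (by simp [haar_integers]) ?_
  rw [haar_unifUnit_smul_integers, haar_integers, mul_one, ENNReal.coe_inv hq]
  simp

theorem haar_unifUnit_zpow_smul (n : ℤ) (s : Set K) :
    haar K (unifUnit K ^ n • s) = (((residueCard K : ℝ≥0) ^ (-n) : ℝ≥0) : ℝ≥0∞) * haar K s := by
  rw [← distribHaarChar_mul, map_zpow, distribHaarChar_unifUnit, inv_zpow, zpow_neg]

/-- For x ≠ 0 the set xR depends only on the valuation of x, so it is R scaled by a power of the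
uniformizer. -/
theorem abs_eq (x : K) :
    abs x = (WithZeroMulInt.toNNReal (one_lt_residueCard (K := K)).ne_bot (intVal K x) : ℝ≥0) := by
  by_cases hx : x = 0
  · subst hx
    have : (fun y : K => 0 * y) '' (𝒪[K] : Set K) = {0} := by
      ext y
      simp only [zero_mul, Set.mem_image, Set.mem_singleton_iff]
      exact ⟨fun ⟨_, _, h⟩ => h.symm, fun h => ⟨0, 𝒪[K].zero_mem, h.symm⟩⟩
    rw [abs, this, measure_singleton, intVal_eq_zero.2 rfl]
    simp
  have hx' := intVal_eq_zero.not.2 hx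
  obtain ⟨a, ha⟩ : ∃ a, intVal K x = exp a := ⟨_, (exp_log hx').symm⟩
  have : (fun y : K => x * y) '' (𝒪[K] : Set K) = unifUnit K ^ (-a) • (𝒪[K] : Set K) := by
    ext y
    rw [mem_unifUnit_zpow_smul_integers, neg_neg, ← ha]
    constructor
    · rintro ⟨z, hz, rfl⟩
      rw [intVal_mul]
      exact mul_le_of_le_one_right' (mem_integers_iff_intVal.1 hz)
    · intro h
      refine ⟨x⁻¹ * y, ?_, by field_simp⟩
      rw [SetLike.mem_coe, mem_integers_iff_intVal, intVal_mul, intVal_inv]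
      exact inv_mul_le_one_of_le₀ h zero_le
  rw [abs, this, haar_unifUnit_zpow_smul, haar_integers, mul_one, neg_neg,
    WithZeroMulInt.toNNReal_neg_apply _ hx']
  rw [ENNReal.coe_toReal]
  congr 2
  rw [toAdd_unzero_eq_log, ha, log_exp]

theorem abs_le_zpow_iff {x : K} {n : ℤ} :
    abs x ≤ (residueCard K : ℝ) ^ n ↔ intVal K x ≤ exp n := by
  rw [← (WithZeroMulInt.toNNReal_strictMono (one_lt_residueCard (K := K))).le_iff_le, abs_eq,
    ← NNReal.coe_le_coe]
  rw [WithZeroMulInt.toNNReal_neg_apply _ (exp_ne_zero (a := n)), toAdd_unzero_eq_log, log_exp]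
  simp

theorem abs_eq_zpow_iff {x : K} {n : ℤ} :
    abs x = (residueCard K : ℝ) ^ n ↔ intVal K x = exp n := by
  rw [← (WithZeroMulInt.toNNReal_strictMono (one_lt_residueCard (K := K))).injective.eq_iff, abs_eq,
    ← NNReal.coe_inj]
  rw [WithZeroMulInt.toNNReal_neg_apply _ (exp_ne_zero (a := n)), toAdd_unzero_eq_log, log_exp]
  simp

theorem abs_eq_zero_iff {x : K} : abs x = 0 ↔ x = 0 := by
  rw [abs_eq, NNReal.coe_eq_zero, map_eq_zero, intVal_eq_zero]

theorem abs_nonneg (x : K) : 0 ≤ abs x := ENNReal.toReal_nonneg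

theorem exists_abs_eq_zpow {x : K} (hx : x ≠ 0) : ∃ n : ℤ, abs x = (residueCard K : ℝ) ^ n := by
  refine ⟨log (intVal K x), abs_eq_zpow_iff.2 ?_⟩
  rw [exp_log (intVal_eq_zero.not.2 hx)]

theorem measurableSet_abs_le_zpow (n : ℤ) : MeasurableSet {x : K | abs x ≤ (residueCard K : ℝ) ^ n} := by
  simp only [abs_le_zpow_iff]
  exact (isOpen_closedBall_intVal n).measurableSet

theorem abs_add_le_zpow {x y : K} {n : ℤ} (hx : abs x ≤ (residueCard K : ℝ) ^ n)
    (hy : abs y ≤ (residueCard K : ℝ) ^ n) : abs (x + y) ≤ (residueCard K : ℝ) ^ n := by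
  rw [abs_le_zpow_iff] at *
  exact (intVal_add_le x y).trans (max_le hx hy)

theorem abs_neg (x : K) : abs (-x) = abs x := by
  rw [abs_eq, abs_eq, intVal_neg]

theorem abs_sub_comm (x y : K) : abs (x - y) = abs (y - x) := by
  rw [← abs_neg, neg_sub]

theorem mem_integers_iff_abs {x : K} : x ∈ 𝒪[K] ↔ abs x ≤ (residueCard K : ℝ) ^ (0 : ℤ) := by
  rw [abs_le_zpow_iff, exp_zero, mem_integers_iff_intVal]

theorem abs_unif_zpow_mul_le {x : K} {n m : ℤ} :
    abs (unif K ^ n * x) ≤ (residueCard K : ℝ) ^ m ↔ abs x ≤ (residueCard K : ℝ) ^ (m + n) := by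
  rw [abs_le_zpow_iff, abs_le_zpow_iff, intVal_mul, intVal_unif_zpow]
  generalize intVal K x = v
  induction v using WithZero.expRecOn with
  | zero => simp
  | exp a =>
    rw [← WithZero.exp_add, exp_le_exp, exp_le_exp]
    constructor <;> intro <;> linarith

/-! ### The product measure on K^N -/

section pi

variable (K)

/-- The product measure on `K^N`. -/
abbrev piHaar (N : ℕ) : Measure (Fin N → K) := Measure.pi fun _ => haar K

variable (N : ℕ)

theorem distribHaarChar_pi_unifUnit :
    distribHaarChar (Fin N → K) (unifUnit K) = (residueCard K : ℝ≥0)⁻¹ ^ N := by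
  have hset : unifUnit K • Set.pi Set.univ (fun _ : Fin N => (𝒪[K] : Set K)) =
      Set.pi Set.univ fun _ : Fin N => unifUnit K • (𝒪[K] : Set K) := by
    ext x
    simp only [Set.mem_smul_set_iff_inv_smul_mem, Set.mem_pi, Pi.smul_apply]
  have hpi : piHaar K N (Set.pi Set.univ fun _ => (𝒪[K] : Set K)) = 1 := by
    rw [Measure.pi_pi]
    simp [haar_integers]
  have hq : (residueCard K : ℝ≥0) ≠ 0 := (one_pos.trans one_lt_residueCard).ne'
  refine distribHaarChar_eq_of_measure_smul_eq_mul (μ := piHaar K N)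
    (s := Set.pi Set.univ fun _ => (𝒪[K] : Set K)) (by simp [hpi]) (by simp [hpi]) ?_
  rw [hset, hpi, Measure.pi_pi, haar_unifUnit_smul_integers]
  rw [Finset.prod_const, Finset.card_univ, Fintype.card_fin, ENNReal.coe_pow, ENNReal.coe_inv hq]
  simp

theorem piHaar_unifUnit_zpow_smul (n : ℤ) (s : Set (Fin N → K)) :
    piHaar K N (unifUnit K ^ n • s) =
      (((residueCard K : ℝ≥0) ^ (-n * N) : ℝ≥0) : ℝ≥0∞) * piHaar K N s := by
  rw [← distribHaarChar_mul, map_zpow, distribHaarChar_pi_unifUnit, inv_pow, inv_zpow,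
    zpow_mul, zpow_neg]
  congr 2
  rw [← zpow_natCast, ← zpow_mul, inv_zpow, ← zpow_mul, mul_comm]

/-- The shear x_i ↦ x_i - x_j is a topological automorphism, so it scales the measure by a constant;
it carries the diagonal to a coordinate hyperplane, which is null. -/
theorem piHaar_diagonal_eq_zero {i j : Fin N} (hij : i ≠ j) :
    piHaar K N {x | x i = x j} = 0 := by
  let f : (Fin N → K) →+ (Fin N → K) :=
    { toFun := fun x => Function.update x i (x i - x j)
      map_zero' := by simp
      map_add' := fun x y => by
        ext l
        by_cases h : l = i
        · subst h; simp; ring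
        · simp [h] }
  let g : (Fin N → K) →+ (Fin N → K) :=
    { toFun := fun x => Function.update x i (x i + x j)
      map_zero' := by simp
      map_add' := fun x y => by
        ext l
        by_cases h : l = i
        · subst h; simp; ring
        · simp [h] }
  have hgf : ∀ x, g (f x) = x := fun x => by
    ext l
    by_cases h : l = i
    · subst h; simp [f, g, hij.symm]
    · simp [f, g, h]
  have hfg : ∀ x, f (g x) = x := fun x => by
    ext l
    by_cases h : l = i
    · subst h; simp [f, g, hij.symm]
    · simp [f, g, h]
  let e : (Fin N → K) ≃ₜ+ (Fin N → K) :=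
    { toFun := f, invFun := g, left_inv := hgf, right_inv := hfg, map_add' := f.map_add
      continuous_toFun := by
        change Continuous fun x : Fin N → K => Function.update x i (x i - x j)
        fun_prop
      continuous_invFun := by
        change Continuous fun x : Fin N → K => Function.update x i (x i + x j)
        fun_prop }
  have hset : {x : Fin N → K | x i = x j} = e ⁻¹' {x | x i = 0} := by
    ext x
    change _ ↔ Function.update x i (x i - x j) i = 0
    simp [sub_eq_zero]
  have h1 := addEquivAddHaarChar_smul_map (piHaar K N) e
  have h2 : (addEquivAddHaarChar e • (piHaar K N).map e) {x : Fin N → K | x i = 0} = 0 := by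
    rw [h1]
    exact Measure.pi_hyperplane (μ := fun _ => haar K) i 0
  rw [Measure.smul_apply, ENNReal.smul_def, smul_eq_mul, mul_eq_zero] at h2
  rcases h2 with h2 | h2
  · simp [(addEquivAddHaarChar_pos e).ne'] at h2
  · rw [hset, ← Measure.map_apply (f := e) e.continuous_toFun.measurable]
    · exact h2
    · exact measurable_pi_apply i (measurableSet_singleton 0)

end pi

end PField

/-! ### Partitions as equivalence relations, and a count of maps -/

namespace Finpartition

variable {N : ℕ}

/-- The equivalence relation of a partition. -/
def Rel (P : Finpartition (Finset.univ : Finset (Fin N))) (i j : Fin N) : Prop :=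
  P.part i = P.part j

variable {P Q : Finpartition (Finset.univ : Finset (Fin N))} {i j l : Fin N}

theorem Rel.refl (P : Finpartition (Finset.univ : Finset (Fin N))) (i : Fin N) : P.Rel i i := rfl

theorem Rel.symm (h : P.Rel i j) : P.Rel j i := Eq.symm h

theorem rel_iff_mem_part : P.Rel i j ↔ j ∈ P.part i := by
  rw [P.mem_part_iff_part_eq_part (Finset.mem_univ j) (Finset.mem_univ i), eq_comm]
  rfl

theorem part_mem_parts (P : Finpartition (Finset.univ : Finset (Fin N))) (i : Fin N) :
    P.part i ∈ P.parts := P.part_mem.2 (Finset.mem_univ i)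

theorem self_mem_part (P : Finpartition (Finset.univ : Finset (Fin N))) (i : Fin N) :
    i ∈ P.part i := P.mem_part_self.2 (Finset.mem_univ i)

theorem rel_iff_exists : P.Rel i j ↔ ∃ t ∈ P.parts, i ∈ t ∧ j ∈ t := by
  rw [rel_iff_mem_part, mem_part_iff_exists]
  simp only [and_comm]

theorem Rel.mem_iff {t : Finset (Fin N)} (h : P.Rel i j) (ht : t ∈ P.parts) : i ∈ t ↔ j ∈ t := by
  rw [← P.part_eq_iff_mem ht, ← P.part_eq_iff_mem ht, h]

theorem rel_of_mem {t : Finset (Fin N)} (ht : t ∈ P.parts) (hi : i ∈ t) (hj : j ∈ t) : P.Rel i j :=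
  rel_iff_exists.2 ⟨t, ht, hi, hj⟩

theorem le_iff_rel : P ≤ Q ↔ ∀ i j, P.Rel i j → Q.Rel i j := by
  constructor
  · intro h i j hij
    obtain ⟨t, ht, hi, hj⟩ := rel_iff_exists.1 hij
    obtain ⟨u, hu, htu⟩ := h ht
    exact rel_of_mem hu (htu hi) (htu hj)
  · intro h t ht
    obtain ⟨i, hi⟩ := P.nonempty_of_mem_parts ht
    refine ⟨Q.part i, Q.part_mem_parts i, fun j hj => ?_⟩
    exact rel_iff_mem_part.1 (h _ _ (rel_of_mem ht hi hj))

theorem ext_rel (h : ∀ i j, P.Rel i j ↔ Q.Rel i j) : P = Q :=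
  le_antisymm (le_iff_rel.2 fun i j => (h i j).1) (le_iff_rel.2 fun i j => (h i j).2)

theorem rel_bot : (⊥ : Finpartition (Finset.univ : Finset (Fin N))).Rel i j ↔ i = j := by
  rw [rel_iff_exists]
  simp only [mem_bot_iff]
  constructor
  · rintro ⟨_, ⟨a, -, rfl⟩, hi, hj⟩
    rw [Finset.mem_singleton.1 hi, Finset.mem_singleton.1 hj]
  · rintro rfl
    exact ⟨_, ⟨i, Finset.mem_univ i, rfl⟩, by simp⟩

theorem rel_top : (⊤ : Finpartition (Finset.univ : Finset (Fin N))).Rel i j := by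
  have h : ∀ l, (⊤ : Finpartition (Finset.univ : Finset (Fin N))).part l = Finset.univ := fun l =>
    Finset.mem_singleton.1 (parts_top_subset _ (part_mem_parts _ l))
  rw [Rel, h, h]

theorem part_ext {t : Finset (Fin N)} (h : ∀ j, j ∈ t ↔ P.Rel i j) :
    t ∈ P.parts := by
  have : t = P.part i := by
    ext j
    rw [h, rel_iff_mem_part]
  rw [this]
  exact P.part_mem_parts i

/-- The number of parts of `Q` inside a set `t`. -/
def childCount (Q : Finpartition (Finset.univ : Finset (Fin N))) (t : Finset (Fin N)) : ℕ :=
  (Q.parts.filter fun u => u ⊆ t).card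

/-- On each part t of P such a map is an injection into κ of the parts of Q inside t, and the
choices for different t are independent. With κ the residue field this counts the residue vectors
that realise one splitting step. -/
theorem card_maps_with_fibers (h : Q ≤ P) (κ : Type*) [Finite κ] :
    Nat.card {c : Fin N → κ // ∀ i j, P.Rel i j → (c i = c j ↔ Q.Rel i j)} =
      ∏ t ∈ P.parts, (Nat.card κ).descFactorial (Q.childCount t) := by
  classical
  have := Fintype.ofFinite κ
  have hsub : ∀ i, Q.part i ∈ Q.parts.filter fun u => u ⊆ P.part i := fun i =>
    Finset.mem_filter.2 ⟨Q.part_mem_parts i, fun j hj =>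
      rel_iff_mem_part.1 (le_iff_rel.1 h _ _ (rel_iff_mem_part.2 hj))⟩
  have key : ∀ (t : P.parts) (u : {u // u ∈ Q.parts.filter fun u => u ⊆ t.1}),
      ∃ i, i ∈ u.1 ∧ Q.part i = u.1 ∧ P.part i = t.1 := fun t u => by
    obtain ⟨hu, hut⟩ := Finset.mem_filter.1 u.2
    obtain ⟨i, hi⟩ := Q.nonempty_of_mem_parts hu
    exact ⟨i, hi, Q.part_eq_of_mem hu hi, P.part_eq_of_mem t.2 (hut hi)⟩
  choose r hr1 hr2 hr3 using key
  let e : {c : Fin N → κ // ∀ i j, P.Rel i j → (c i = c j ↔ Q.Rel i j)} ≃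
      (∀ t : P.parts, {u // u ∈ Q.parts.filter fun u => u ⊆ t.1} ↪ κ) :=
    { toFun := fun c t => ⟨fun u => c.1 (r t u), fun u v huv => by
        have h1 : P.Rel (r t u) (r t v) := by rw [Rel, hr3, hr3]
        have h2 : Q.Rel (r t u) (r t v) := (c.2 _ _ h1).1 huv
        rw [Rel, hr2, hr2] at h2
        exact Subtype.ext h2⟩
      invFun := fun f => ⟨fun i => f ⟨P.part i, P.part_mem_parts i⟩ ⟨Q.part i, hsub i⟩, by
        intro i j hij
        have : ∀ (t : P.parts) (ht : P.part i = t.1) (ht' : P.part j = t.1),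
            f t ⟨Q.part i, ht ▸ hsub i⟩ = f t ⟨Q.part j, ht' ▸ hsub j⟩ ↔ Q.Rel i j := by
          intro t ht ht'
          rw [(f t).injective.eq_iff, Subtype.mk.injEq]
          rfl
        have h2 := this ⟨P.part i, P.part_mem_parts i⟩ rfl hij.symm
        refine Iff.trans ?_ h2
        -- The domain of `f t` depends on t, so the equality of the parts of i and j is carried over
        -- to values by this auxiliary statement.
        have h3 : ∀ (t t' : P.parts) (htt : t' = t) (hj : P.part j = t.1) (hj' : P.part j = t'.1),
            f t' ⟨Q.part j, hj' ▸ hsub j⟩ = f t ⟨Q.part j, hj ▸ hsub j⟩ := by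
          rintro t _ rfl _ _
          rfl
        exact Eq.congr_right (h3 ⟨P.part i, P.part_mem_parts i⟩ ⟨P.part j, P.part_mem_parts j⟩
          (Subtype.ext hij.symm) hij.symm rfl)⟩
      left_inv := fun c => by
        ext i
        dsimp only [Function.Embedding.coeFn_mk]
        refine (c.2 _ _ ?_).2 ?_
        · rw [Rel, hr3]
        · rw [Rel, hr2]
      right_inv := fun f => by
        ext t u
        have h3 : ∀ (t' : P.parts) (u' : {u // u ∈ Q.parts.filter fun u => u ⊆ t'.1})
            (_ : t' = t) (_ : u'.1 = u.1), f t' u' = f t u := by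
          rintro _ u' rfl hu
          rw [Subtype.ext hu]
        exact h3 _ _ (Subtype.ext (hr3 t u)) (hr2 t u) }
  rw [Nat.card_congr e, Nat.card_eq_fintype_card, Fintype.card_pi]
  simp only [Fintype.card_embedding_eq, Fintype.card_coe, Nat.card_eq_fintype_card]
  exact Finset.prod_coe_sort P.parts fun t => (Fintype.card κ).descFactorial (Q.childCount t)

end Finpartition

/-! ### Measure of the vectors with a prescribed sequence of partitions -/

namespace PField

open scoped NNReal ENNReal Pointwise

variable {K : Type*} [Field K] [ValuativeRel K] [TopologicalSpace K] [IsNonarchimedeanLocalField K]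
  [MeasurableSpace K] [BorelSpace K] {N : ℕ}

variable (K) in
/-- The vectors `y ∈ R^N` with `|y_i - y_j| ≤ q^{-k} ↔ i ∼ j` in `P_k`, for `i ∼ j` in `P_0`. -/
def filtrationSet (P : ℕ → Finpartition (Finset.univ : Finset (Fin N))) : Set (Fin N → K) :=
  {y | (∀ i, abs (y i) ≤ (residueCard K : ℝ) ^ (0 : ℤ)) ∧ ∀ i j, (P 0).Rel i j → ∀ k : ℕ,
    abs (y i - y j) ≤ (residueCard K : ℝ) ^ (-(k : ℤ)) ↔ (P k).Rel i j}

theorem measurableSet_filtrationSet (P : ℕ → Finpartition (Finset.univ : Finset (Fin N))) :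
    MeasurableSet (filtrationSet K P) := by
  have h1 : ∀ i, Measurable fun y : Fin N → K => abs (y i) ≤ (residueCard K : ℝ) ^ (0 : ℤ) :=
    fun i => measurableSet_setOfPred.1 ((measurable_pi_apply i) (measurableSet_abs_le_zpow 0))
  have h2 : ∀ i j (k : ℕ), Measurable fun y : Fin N → K =>
      abs (y i - y j) ≤ (residueCard K : ℝ) ^ (-(k : ℤ)) := fun i j k => measurableSet_setOfPred.1
    (((measurable_pi_apply i).sub (measurable_pi_apply j)) (measurableSet_abs_le_zpow (-(k : ℤ))))
  exact measurableSet_setOfPred.2 ((Measurable.forall h1).and (Measurable.forall fun i =>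
    Measurable.forall fun j => Measurable.forall fun _ => Measurable.forall fun k =>
      (h2 i j k).iff measurable_const))

theorem residue_eq_iff_abs {x y : 𝒪[K]} :
    IsLocalRing.residue 𝒪[K] x = IsLocalRing.residue 𝒪[K] y ↔
      abs ((x : K) - y) ≤ (residueCard K : ℝ) ^ (-1 : ℤ) := by
  rw [residue_eq_iff, abs_le_zpow_iff]

-- Write y = c + π z with c a vector of residue representatives. At radius q^{-1} residues decide,
-- so c must separate exactly the P_1-parts inside each P_0-part. For pairs together in P_1 the
-- representatives agree, y_i - y_j = π (z_i - z_j), and the later conditions pass to z; other pairs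
-- put no condition on z, which is why `filtrationSet` tests only pairs related in P_0. Scaling by π
-- gives q^{-N}.
set_option maxHeartbeats 1000000 in
theorem piHaar_filtrationSet_succ {P : ℕ → Finpartition (Finset.univ : Finset (Fin N))}
    (hP : Antitone P) :
    piHaar K N (filtrationSet K P) =
      (((residueCard K : ℝ≥0) ^ (-(N : ℤ)) *
        ∏ t ∈ (P 0).parts, (residueCard K).descFactorial ((P 1).childCount t) : ℝ≥0) : ℝ≥0∞) *
        piHaar K N (filtrationSet K fun k => P (k + 1)) := by
  obtain ⟨s, hs⟩ := (IsLocalRing.residue_surjective (R := 𝒪[K])).hasRightInverse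
  let C := {c : Fin N → 𝓀[K] // ∀ i j, (P 0).Rel i j → (c i = c j ↔ (P 1).Rel i j)}
  let W' := unifUnit K • filtrationSet K fun k => P (k + 1)
  let rep : (Fin N → 𝓀[K]) → Fin N → K := fun c i => (s (c i) : K)
  have hq : (1 : ℝ) < residueCard K := by exact_mod_cast one_lt_residueCard (K := K)
  have hmono : ∀ {a b : ℤ}, a ≤ b → (residueCard K : ℝ) ^ a ≤ (residueCard K : ℝ) ^ b :=
    fun h => zpow_le_zpow_right₀ hq.le h
  have hW' : ∀ y : Fin N → K, y ∈ W' ↔ ∃ z ∈ filtrationSet K fun k => P (k + 1),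
      ∀ i, y i = unif K * z i := fun y => by
    constructor
    · rintro ⟨z, hz, rfl⟩
      exact ⟨z, hz, fun i => rfl⟩
    · rintro ⟨z, hz, h⟩
      exact ⟨z, hz, (funext h).symm⟩
  have hunif : ∀ (x : K) (m : ℤ), abs (unif K * x) ≤ (residueCard K : ℝ) ^ m ↔
      abs x ≤ (residueCard K : ℝ) ^ (m + 1) := fun x m => by
    have := abs_unif_zpow_mul_le (x := x) (n := 1) (m := m)
    rwa [zpow_one] at this
  have hW'1 : ∀ y ∈ W', ∀ i, abs (y i) ≤ (residueCard K : ℝ) ^ (-1 : ℤ) := fun y hy i => by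
    obtain ⟨z, hz, h⟩ := (hW' y).1 hy
    rw [h, hunif]
    exact hz.1 i
  -- Adding a vector with coordinates in the maximal ideal does not change residues.
  have hres : ∀ (c : Fin N → 𝓀[K]), ∀ y ∈ W', ∀ i j,
      abs ((rep c i + y i) - (rep c j + y j)) ≤ (residueCard K : ℝ) ^ (-1 : ℤ) ↔ c i = c j := by
    intro c y hy i j
    have h1 : abs (rep c i - rep c j) ≤ (residueCard K : ℝ) ^ (-1 : ℤ) ↔ c i = c j := by
      rw [← residue_eq_iff_abs, hs, hs]
    have hd : abs (y i - y j) ≤ (residueCard K : ℝ) ^ (-1 : ℤ) := by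
      rw [sub_eq_add_neg]
      refine abs_add_le_zpow (hW'1 y hy i) ?_
      rw [abs_neg]
      exact hW'1 y hy j
    rw [← h1]
    constructor
    · intro h
      have e : rep c i - rep c j = ((rep c i + y i) - (rep c j + y j)) + -(y i - y j) := by ring
      rw [e]
      exact abs_add_le_zpow h (by rwa [abs_neg])
    · intro h
      have e : (rep c i + y i) - (rep c j + y j) = (rep c i - rep c j) + (y i - y j) := by ring
      rw [e]
      exact abs_add_le_zpow h hd
  have hunion : filtrationSet K P = ⋃ c : C, rep c.1 +ᵥ W' := by
    ext x
    simp only [Set.mem_iUnion]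
    constructor
    · intro hx
      have hx0 : ∀ i, x i ∈ 𝒪[K] := fun i => mem_integers_iff_abs.2 (hx.1 i)
      obtain ⟨c, hcdef⟩ : ∃ c : Fin N → 𝓀[K], ∀ i, IsLocalRing.residue 𝒪[K] ⟨x i, hx0 i⟩ = c i :=
        ⟨_, fun i => rfl⟩
      have hc : ∀ i j, c i = c j ↔ abs (x i - x j) ≤ (residueCard K : ℝ) ^ (-1 : ℤ) := fun i j => by
        have h := residue_eq_iff_abs (x := ⟨x i, hx0 i⟩) (y := ⟨x j, hx0 j⟩)
        rw [hcdef, hcdef] at h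
        exact h
      have hc' : ∀ i j, (P 0).Rel i j → (c i = c j ↔ (P 1).Rel i j) := fun i j hij => by
        rw [hc, ← hx.2 i j hij 1]
        rfl
      refine ⟨⟨c, hc'⟩, Set.mem_vadd_set_iff_neg_vadd_mem.2 ((hW' _).2 ?_)⟩
      let z : Fin N → K := fun i => (unif K)⁻¹ * (x i - rep c i)
      have hz : ∀ i, unif K * z i = x i - rep c i := fun i => by
        simp only [z]
        rw [mul_inv_cancel_left₀ unif_ne_zero]
      refine ⟨z, ⟨fun i => ?_, fun i j hij k => ?_⟩, fun i => ?_⟩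
      · have := (hunif (z i) (-1)).1 (by
          have h := residue_eq_iff_abs.1 ((hcdef i).trans (hs (c i)).symm)
          rw [hz]
          exact h)
        simpa using this
      · have hcij : c i = c j := (hc' i j (Finpartition.le_iff_rel.1 (hP (Nat.zero_le 1)) i j hij)).2 hij
        have e : unif K * (z i - z j) = x i - x j := by
          rw [mul_sub, hz, hz]
          simp only [rep, hcij]
          ring
        have := hunif (z i - z j) (-((k + 1 : ℕ) : ℤ))
        rw [e] at this
        rw [← hx.2 i j (Finpartition.le_iff_rel.1 (hP (Nat.zero_le 1)) i j hij) (k + 1), this]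
        have : (-((k + 1 : ℕ) : ℤ)) + 1 = -(k : ℤ) := by push_cast; ring
        rw [this]
      · rw [hz]
        simp only [vadd_eq_add, Pi.add_apply, Pi.neg_apply]
        ring
    · rintro ⟨c, hc⟩
      obtain ⟨y, hy, rfl⟩ := hc
      have hres' := hres c.1 y hy
      simp only [vadd_eq_add]
      have hx0 : ∀ i, abs (rep c.1 i + y i) ≤ (residueCard K : ℝ) ^ (0 : ℤ) := fun i =>
        abs_add_le_zpow (mem_integers_iff_abs.1 (s (c.1 i)).2)
          ((hW'1 y hy i).trans (hmono (by norm_num)))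
      refine ⟨hx0, fun i j hij k => ?_⟩
      simp only [Pi.add_apply]
      rcases k with _ | k
      · refine iff_of_true ?_ hij
        rw [sub_eq_add_neg]
        exact abs_add_le_zpow (hx0 i) (by rw [abs_neg]; exact hx0 j)
      · by_cases h1 : (P 1).Rel i j
        · have hcij := (c.2 i j hij).2 h1
          obtain ⟨z, hz, hyz⟩ := (hW' y).1 hy
          have e : rep c.1 i + y i - (rep c.1 j + y j) = unif K * (z i - z j) := by
            rw [hyz, hyz]
            simp only [rep, hcij]
            ring
          rw [e, hunif, ← hz.2 i j h1 k]
          have : (-((k + 1 : ℕ) : ℤ)) + 1 = -(k : ℤ) := by push_cast; ring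
          rw [this]
        -- Different residues exclude every radius q^{-(k+1)}, and partitions finer than P_1 cannot
        -- join i and j again.
        · refine iff_of_false (fun h => h1 ?_) (fun h => h1 ?_)
          · rw [← c.2 i j hij, ← hres']
            exact h.trans (hmono (by push_cast; linarith))
          · exact Finpartition.le_iff_rel.1 (hP (by omega)) i j h
  have hdisj : Pairwise (Function.onFun Disjoint fun c : C => rep c.1 +ᵥ W') := by
    intro c d hcd
    refine Set.disjoint_left.2 ?_
    rintro _ ⟨y, hy, rfl⟩ ⟨z, hz, h⟩
    refine hcd (Subtype.ext (funext fun i => ?_))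
    have hi : rep d.1 i + z i = rep c.1 i + y i := congrFun h i
    rw [← hs (c.1 i), ← hs (d.1 i), residue_eq_iff_abs]
    have e : (s (c.1 i) : K) - s (d.1 i) = z i + - y i := by
      change rep c.1 i - rep d.1 i = _
      linear_combination -hi
    rw [e]
    refine abs_add_le_zpow (hW'1 z hz i) ?_
    rw [abs_neg]
    exact hW'1 y hy i
  have hmeasW : MeasurableSet W' := (measurableSet_filtrationSet _).const_smul _
  have := Fintype.ofFinite C
  have hcard : (Fintype.card C : ℝ≥0) =
      ∏ t ∈ (P 0).parts, (residueCard K).descFactorial ((P 1).childCount t) := by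
    rw [← Nat.card_eq_fintype_card, Finpartition.card_maps_with_fibers (hP (Nat.zero_le 1))]
    push_cast
    rfl
  rw [hunion, measure_iUnion hdisj (fun c => hmeasW.const_vadd _)]
  simp only [measure_vadd, tsum_fintype, Finset.sum_const, Finset.card_univ, nsmul_eq_mul]
  have hscale := piHaar_unifUnit_zpow_smul K N 1 (filtrationSet K fun k => P (k + 1))
  rw [zpow_one] at hscale
  change _ * piHaar K N (unifUnit K • _) = _
  rw [hscale, ← mul_assoc, ENNReal.coe_mul, mul_comm ((_ : ℝ≥0) : ℝ≥0∞)]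
  congr 2
  · rw [← hcard]
    simp
  · congr 2
    ring

theorem piHaar_filtrationSet {P : ℕ → Finpartition (Finset.univ : Finset (Fin N))}
    (hP : Antitone P) {n : ℕ} (hn : P n = ⊥) :
    piHaar K N (filtrationSet K P) = ((∏ k ∈ Finset.range n, ((residueCard K : ℝ≥0) ^ (-(N : ℤ)) *
        ∏ t ∈ (P k).parts, (residueCard K).descFactorial ((P (k + 1)).childCount t)) : ℝ≥0) :
          ℝ≥0∞) := by
  induction n generalizing P with
  | zero =>
    have : filtrationSet K P = Set.pi Set.univ fun _ => (𝒪[K] : Set K) := by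
      ext y
      simp only [filtrationSet, Set.mem_ofPred_eq, Set.mem_pi, SetLike.mem_coe, mem_integers_iff_abs]
      refine ⟨fun h i _ => h.1 i, fun h => ⟨fun i => h i trivial, fun i j hij k => ?_⟩⟩
      rw [hn, Finpartition.rel_bot] at hij
      subst hij
      refine iff_of_true ?_ (Finpartition.Rel.refl _ _)
      rw [sub_self, abs_eq_zero_iff.2 rfl]
      positivity
    rw [this, Measure.pi_pi]
    simp [haar_integers]
  | succ n ih =>
    rw [piHaar_filtrationSet_succ hP, ih (P := fun k => P (k + 1)) (fun a b h => hP (by omega)) hn,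
      ← ENNReal.coe_mul, Finset.prod_range_succ', mul_comm]

end PField

/-- Turns the size of an initial segment of ℕ into a threshold; `idx`, `branchMeet` and `relCount`
become thresholds in this way. -/
theorem Finset.eq_range_card_of_isLowerSet (S : Finset ℕ) (h : ∀ a ∈ S, ∀ b ≤ a, b ∈ S) :
    S = Finset.range S.card := by
  obtain ⟨n, hn⟩ : ∃ n, S = Finset.range n := by
    have hex : ∃ n, n ∉ S := by
      by_contra! h
      exact Set.infinite_univ ((Set.Finite.subset S.finite_toSet) fun n _ => h n)
    classical
    refine ⟨Nat.find hex, Finset.ext fun a => ?_⟩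
    rw [Finset.mem_range]
    constructor
    · intro ha
      by_contra! hle
      exact Nat.find_spec hex (h a ha _ hle)
    · intro ha
      by_contra hS
      exact Nat.find_min hex ha hS
  rw [hn, Finset.card_range]

/-! ### Split sequences as splitting filtrations with repetition numbers -/

/-- An antitone sequence of partitions of `[N]` from `⊤` to `⊥` whose first step is proper. -/
@[ext]
structure SplitSequence (N : ℕ) where
  seq : ℕ → Finpartition (Finset.univ : Finset (Fin N))
  anti : Antitone seq
  zero : seq 0 = ⊤
  one : seq 1 ≠ ⊤
  eventually_bot : ∃ n, seq n = ⊥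

namespace SplittingFiltration

variable {N : ℕ} (σ : SplittingFiltration N)

/-- The `ℓ`-th partition as a function on the natural numbers. -/
def lev (ℓ : ℕ) : Finpartition (Finset.univ : Finset (Fin N)) :=
  σ.ptn ⟨min ℓ σ.length, Nat.lt_succ_of_le (min_le_right _ _)⟩

theorem part_eq (ℓ : ℕ) : σ.part ℓ = (σ.lev ℓ).parts := rfl

theorem lev_zero : σ.lev 0 = ⊤ := by
  rw [← σ.first, lev]
  congr 1

theorem lev_of_le {ℓ : ℕ} (h : σ.length ≤ ℓ) : σ.lev ℓ = ⊥ := by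
  rw [← σ.last, lev]
  congr 1
  ext
  simpa using h

theorem lev_anti : Antitone σ.lev := fun a b h => σ.strictAnti.antitone (by
  rw [Fin.mk_le_mk]; omega)

theorem lev_lt {a b : ℕ} (h : a < b) (hb : b ≤ σ.length) : σ.lev b < σ.lev a :=
  σ.strictAnti (by rw [Fin.mk_lt_mk]; omega)

theorem lev_inj {a b : ℕ} (ha : a ≤ σ.length) (hb : b ≤ σ.length) (h : σ.lev a = σ.lev b) :
    a = b := by
  rcases lt_trichotomy a b with h' | h' | h'
  · exact absurd h (σ.lev_lt h' hb).ne'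
  · exact h'
  · exact absurd h (σ.lev_lt h' ha).ne

theorem ext_lev {σ τ : SplittingFiltration N} (h : σ.length = τ.length)
    (h' : ∀ ℓ ≤ σ.length, σ.lev ℓ = τ.lev ℓ) : σ = τ := by
  obtain ⟨L, p, h1, h2, h3⟩ := σ
  obtain ⟨L', p', h1', h2', h3'⟩ := τ
  dsimp only at h
  subst h
  have : p = p' := by
    funext ℓ
    have := h' ℓ (Nat.lt_succ_iff.1 ℓ.2)
    simp only [lev] at this
    have e : (⟨min (ℓ : ℕ) L, Nat.lt_succ_of_le (min_le_right _ _)⟩ : Fin (L + 1)) = ℓ := by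
      ext; exact min_eq_left (Nat.lt_succ_iff.1 ℓ.2)
    rwa [e] at this
  subst this
  rfl

theorem length_pos (hN : 2 ≤ N) : 0 < σ.length := by
  by_contra h
  have h0 : σ.length = 0 := by omega
  have h1 := σ.lev_of_le h0.le
  rw [lev_zero] at h1
  have h2 : (⊤ : Finpartition (Finset.univ : Finset (Fin N))).Rel ⟨0, by omega⟩ ⟨1, by omega⟩ :=
    Finpartition.rel_top
  rw [h1, Finpartition.rel_bot] at h2
  simp at h2

/-- The number of steps for which the level `ℓ` is repeated. -/
def gap (ν : Finset.Ico 1 σ.length → ℕ) (ℓ : ℕ) : ℕ :=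
  -- The value 1 outside the repeatable levels keeps `pos` strictly increasing on all of ℕ.
  if h : ℓ ∈ Finset.Ico 1 σ.length then ν ⟨ℓ, h⟩ + 1 else 1

theorem gap_pos (ν : Finset.Ico 1 σ.length → ℕ) (ℓ : ℕ) : 0 < σ.gap ν ℓ := by
  unfold gap; split_ifs <;> omega

/-- The last step at which the level `ℓ` occurs. -/
def pos (ν : Finset.Ico 1 σ.length → ℕ) (ℓ : ℕ) : ℕ := ∑ j ∈ Finset.range ℓ, σ.gap ν (j + 1)

theorem pos_succ (ν : Finset.Ico 1 σ.length → ℕ) (ℓ : ℕ) :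
    σ.pos ν (ℓ + 1) = σ.pos ν ℓ + σ.gap ν (ℓ + 1) := Finset.sum_range_succ _ _

theorem pos_zero (ν : Finset.Ico 1 σ.length → ℕ) : σ.pos ν 0 = 0 := rfl

theorem pos_strictMono (ν : Finset.Ico 1 σ.length → ℕ) : StrictMono (σ.pos ν) :=
  strictMono_nat_of_lt_succ fun ℓ => by
    rw [pos_succ]
    have := σ.gap_pos ν (ℓ + 1)
    omega

/-- The level occurring at step `k`. -/
def idx (ν : Finset.Ico 1 σ.length → ℕ) (k : ℕ) : ℕ :=
  ((Finset.range σ.length).filter fun ℓ => σ.pos ν ℓ < k).card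

theorem idx_le (ν : Finset.Ico 1 σ.length → ℕ) (k : ℕ) : σ.idx ν k ≤ σ.length :=
  (Finset.card_filter_le _ _).trans (Finset.card_range _).le

/-- Since `pos` increases, the levels finished before step k form an initial segment, and `idx` is
its length. -/
theorem lt_idx_iff (ν : Finset.Ico 1 σ.length → ℕ) {ℓ k : ℕ} :
    ℓ < σ.idx ν k ↔ ℓ < σ.length ∧ σ.pos ν ℓ < k := by
  have h := Finset.eq_range_card_of_isLowerSet
    ((Finset.range σ.length).filter fun ℓ => σ.pos ν ℓ < k) (fun a ha b hb => by
      simp only [Finset.mem_filter, Finset.mem_range] at ha ⊢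
      exact ⟨by omega, ((σ.pos_strictMono ν).monotone hb).trans_lt ha.2⟩)
  have h' := Finset.ext_iff.1 h ℓ
  simp only [Finset.mem_filter, Finset.mem_range] at h'
  exact h'.symm

theorem idx_mono (ν : Finset.Ico 1 σ.length → ℕ) : Monotone (σ.idx ν) := fun a b h => by
  by_contra! hlt
  have := (σ.lt_idx_iff ν).1 hlt
  have h2 := (σ.lt_idx_iff ν (ℓ := σ.idx ν b) (k := b)).2 ⟨this.1, this.2.trans_le h⟩
  omega

theorem idx_eq_iff (ν : Finset.Ico 1 σ.length → ℕ) {ℓ k : ℕ} (hℓ : ℓ < σ.length) (h0 : 0 < ℓ) :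
    σ.idx ν k = ℓ ↔ σ.pos ν (ℓ - 1) < k ∧ k ≤ σ.pos ν ℓ := by
  have h1 := σ.lt_idx_iff ν (ℓ := ℓ - 1) (k := k)
  have h2 := σ.lt_idx_iff ν (ℓ := ℓ) (k := k)
  constructor
  · intro h
    exact ⟨(h1.1 (by omega)).2, by
      by_contra! hlt
      have := h2.2 ⟨hℓ, hlt⟩
      omega⟩
  · rintro ⟨h3, h4⟩
    have h5 := h1.2 ⟨by omega, h3⟩
    have h6 : ¬ ℓ < σ.idx ν k := fun h => by
      have := (h2.1 h).2
      omega
    omega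

theorem idx_zero (ν : Finset.Ico 1 σ.length → ℕ) : σ.idx ν 0 = 0 := by
  simp [idx]

theorem idx_pos (ν : Finset.Ico 1 σ.length → ℕ) {ℓ : ℕ} (h : ℓ < σ.length) :
    σ.idx ν (σ.pos ν ℓ) = ℓ := by
  rcases Nat.eq_zero_or_pos ℓ with h0 | h0
  · subst h0
    rw [pos_zero, idx_zero]
  · rw [σ.idx_eq_iff ν h h0]
    exact ⟨σ.pos_strictMono ν (by omega), le_rfl⟩

theorem idx_pos_add_one (ν : Finset.Ico 1 σ.length → ℕ) {ℓ : ℕ} (h : ℓ < σ.length) :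
    σ.idx ν (σ.pos ν ℓ + 1) = ℓ + 1 := by
  have h1 := (σ.lt_idx_iff ν (ℓ := ℓ) (k := σ.pos ν ℓ + 1)).2 ⟨h, by omega⟩
  have h2 : ¬ ℓ + 1 < σ.idx ν (σ.pos ν ℓ + 1) := fun h' => by
    have := (σ.lt_idx_iff ν).1 h'
    have := σ.pos_strictMono ν (Nat.lt_succ_self ℓ)
    have : σ.pos ν ℓ < σ.pos ν (ℓ + 1) := this
    omega
  omega

theorem idx_succ_ne_iff (ν : Finset.Ico 1 σ.length → ℕ) {k : ℕ} :
    σ.idx ν (k + 1) ≠ σ.idx ν k ↔ ∃ ℓ < σ.length, σ.pos ν ℓ = k := by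
  constructor
  · intro h
    have h1 : σ.idx ν k < σ.idx ν (k + 1) := lt_of_le_of_ne (σ.idx_mono ν (Nat.le_succ k)) h.symm
    have h2 := (σ.lt_idx_iff ν).1 h1
    refine ⟨_, h2.1, ?_⟩
    have h3 : ¬ σ.pos ν (σ.idx ν k) < k := fun h' =>
      lt_irrefl _ ((σ.lt_idx_iff ν).2 ⟨h2.1, h'⟩)
    omega
  · rintro ⟨ℓ, hℓ, rfl⟩
    rw [σ.idx_pos ν hℓ, σ.idx_pos_add_one ν hℓ]
    omega

/-- The index counts the jumps made so far. Jumps are visible in the sequence of partitions, so the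
sequence determines the index. -/
theorem idx_eq_count (ν : Finset.Ico 1 σ.length → ℕ) (p : ℕ → Prop) [DecidablePred p]
    (hp : ∀ k, p k ↔ σ.idx ν (k + 1) ≠ σ.idx ν k) (k : ℕ) : σ.idx ν k = Nat.count p k := by
  induction k with
  | zero => rw [idx_zero, Nat.count_zero]
  | succ k ih =>
    rw [Nat.count_succ, ← ih]
    split_ifs with h
    · rw [hp, idx_succ_ne_iff] at h
      obtain ⟨ℓ, hℓ, rfl⟩ := h
      rw [σ.idx_pos ν hℓ, σ.idx_pos_add_one ν hℓ]
    · rw [hp, not_not] at h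
      rw [h, add_zero]

/-- The sequence in which the level `ℓ` is repeated `gap ℓ` times. -/
def toSequence (hN : 2 ≤ N) (x : Σ σ : SplittingFiltration N, Finset.Ico 1 σ.length → ℕ) :
    SplitSequence N where
  seq k := x.1.lev (x.1.idx x.2 k)
  anti a b h := x.1.lev_anti (x.1.idx_mono x.2 h)
  zero := by rw [idx_zero, lev_zero]
  one := by
    have h := x.1.idx_pos_add_one x.2 (x.1.length_pos hN)
    rw [pos_zero, zero_add] at h
    rw [h, ← x.1.lev_zero]
    exact (x.1.lev_lt (by norm_num) (by have := x.1.length_pos hN; omega)).ne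
  eventually_bot := by
    refine ⟨x.1.pos x.2 (x.1.length - 1) + 1, x.1.lev_of_le ?_⟩
    have := x.1.length_pos hN
    rw [x.1.idx_pos_add_one x.2 (by omega)]
    omega

/-- The sequence determines `idx` through its jumps. Its values at each index are the levels, the
thresholds of `idx` are the numbers `pos`, and their differences are the repetition numbers. -/
theorem toSequence_injective (hN : 2 ≤ N) : Function.Injective (toSequence hN) := by
  classical
  rintro ⟨σ, ν⟩ ⟨τ, ξ⟩ h
  have hs : ∀ k, σ.lev (σ.idx ν k) = τ.lev (τ.idx ξ k) := fun k =>
    congrFun (congrArg SplitSequence.seq h) k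
  have hidx : ∀ k, σ.idx ν k = τ.idx ξ k := fun k => by
    have h1 := σ.idx_eq_count ν (fun k => σ.lev (σ.idx ν (k + 1)) ≠ σ.lev (σ.idx ν k))
      (fun k => ⟨fun h h' => h (by rw [h']), fun h h' => h (σ.lev_inj (σ.idx_le ν _) (σ.idx_le ν _) h')⟩) k
    have h2 := τ.idx_eq_count ξ (fun k => τ.lev (τ.idx ξ (k + 1)) ≠ τ.lev (τ.idx ξ k))
      (fun k => ⟨fun h h' => h (by rw [h']), fun h h' => h (τ.lev_inj (τ.idx_le ξ _) (τ.idx_le ξ _) h')⟩) k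
    rw [h1, h2]
    simp only [hs]
  have hsurj : ∀ (σ : SplittingFiltration N) (ν : Finset.Ico 1 σ.length → ℕ), ∀ ℓ ≤ σ.length,
      ∃ k, σ.idx ν k = ℓ := fun σ ν ℓ hℓ => by
    rcases Nat.eq_zero_or_pos ℓ with h0 | h0
    · exact ⟨0, by rw [idx_zero, h0]⟩
    · exact ⟨σ.pos ν (ℓ - 1) + 1, by rw [σ.idx_pos_add_one ν (by omega)]; omega⟩
  have hL : σ.length = τ.length := by
    obtain ⟨k, hk⟩ := hsurj σ ν _ le_rfl
    obtain ⟨l, hl⟩ := hsurj τ ξ _ le_rfl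
    have h1 := τ.idx_le ξ k
    have h2 := σ.idx_le ν l
    rw [← hidx, hk] at h1
    rw [hidx, hl] at h2
    omega
  have hστ : σ = τ := ext_lev hL fun ℓ hℓ => by
    obtain ⟨k, rfl⟩ := hsurj σ ν ℓ hℓ
    rw [hs, hidx]
  subst hστ
  have hpos : ∀ ℓ < σ.length, σ.pos ν ℓ = σ.pos ξ ℓ := fun ℓ hℓ => by
    have h1 : ∀ k, σ.pos ν ℓ < k ↔ σ.pos ξ ℓ < k := fun k => by
      have h1 := σ.lt_idx_iff ν (ℓ := ℓ) (k := k)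
      have h2 := σ.lt_idx_iff ξ (ℓ := ℓ) (k := k)
      rw [hidx, h2] at h1
      simpa [hℓ] using h1.symm
    have h2 := (h1 (σ.pos ξ ℓ + 1)).2 (by omega)
    have h3 := (h1 (σ.pos ν ℓ + 1)).1 (by omega)
    omega
  have : ν = ξ := by
    funext ℓ
    obtain ⟨ℓ, hℓ⟩ := ℓ
    have hℓ' := Finset.mem_Ico.1 hℓ
    obtain ⟨m, rfl⟩ : ∃ m, ℓ = m + 1 := ⟨ℓ - 1, by omega⟩
    have h1 := hpos (m + 1) hℓ'.2
    have h2 := hpos m (by omega)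
    rw [pos_succ, pos_succ, h2, gap, gap, dif_pos hℓ, dif_pos hℓ] at h1
    omega
  rw [this]

/-- Deleting repetitions from P leaves a strict chain indexed by the number of jumps already made;
the distances between consecutive jumps are the run lengths. -/
theorem toSequence_surjective (hN : 2 ≤ N) : Function.Surjective (toSequence hN) := by
  classical
  intro P
  obtain ⟨h, hh⟩ := P.eventually_bot
  have hbot : ∀ k, h ≤ k → P.seq k = ⊥ := fun k hk => le_bot_iff.1 (hh ▸ P.anti hk)
  let p : ℕ → Prop := fun k => P.seq (k + 1) ≠ P.seq k
  have hp_lt : ∀ k, p k → k < h := fun k hk => by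
    by_contra! hle
    exact hk (by rw [hbot k hle, hbot (k + 1) (by omega)])
  have hmono : Monotone (Nat.count p) := Nat.count_monotone p
  have heq : ∀ k l, Nat.count p k = Nat.count p (k + l) → P.seq (k + l) = P.seq k := fun k l => by
    induction l with
    | zero => simp
    | succ l ih =>
      intro hc
      have h1 : Nat.count p k ≤ Nat.count p (k + l) := hmono (by omega)
      rw [← add_assoc, Nat.count_succ] at hc
      split_ifs at hc with hpk
      · omega
      · rw [← ih hc, ← add_assoc]
        exact not_not.1 hpk
  have heq' : ∀ k l, Nat.count p k = Nat.count p l → P.seq k = P.seq l := fun k l hkl => by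
    rcases le_total k l with hle | hle
    · obtain ⟨d, rfl⟩ := Nat.exists_eq_add_of_le hle
      exact (heq k d hkl).symm
    · obtain ⟨d, rfl⟩ := Nat.exists_eq_add_of_le hle
      exact heq l d hkl.symm
  have hlt : ∀ k l, Nat.count p k < Nat.count p l → P.seq l < P.seq k := fun k l hkl => by
    have hle : k ≤ l := by
      by_contra! hlt
      exact absurd (hmono hlt.le) (by omega)
    refine lt_of_le_of_ne (P.anti hle) fun he => ?_
    have : ∀ j, k ≤ j → j ≤ l → Nat.count p j = Nat.count p k := fun j hj => by
      induction j, hj using Nat.le_induction with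
      | base => simp
      | succ j hj ih =>
        intro hjl
        rw [Nat.count_succ, ih (by omega), if_neg, add_zero]
        have h1 : P.seq j ≤ P.seq k := P.anti hj
        have h2 : P.seq l ≤ P.seq (j + 1) := P.anti hjl
        have h3 : P.seq (j + 1) ≤ P.seq j := P.anti (Nat.le_succ j)
        exact not_not.2 (le_antisymm h3 (h1.trans (he ▸ h2)))
    have := this l hle le_rfl
    omega
  let L := Nat.count p h
  have hcount_le : ∀ k, Nat.count p k ≤ L := fun k => by
    rcases le_total k h with hle | hle
    · exact hmono hle
    · by_contra! hc
      have := hlt h k hc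
      rw [hh] at this
      exact not_lt_bot this
  have hsurj : ∀ ℓ ≤ L, ∃ k, Nat.count p k = ℓ := fun ℓ hℓ => by
    have : ∀ n, ℓ ≤ Nat.count p n → ∃ k, Nat.count p k = ℓ := fun n => by
      induction n with
      | zero => exact fun h => ⟨0, by simp at h ⊢; omega⟩
      | succ n ih =>
        intro hn
        rcases Nat.lt_or_ge (Nat.count p n) ℓ with h1 | h1
        · refine ⟨n + 1, ?_⟩
          rw [Nat.count_succ] at hn ⊢
          split_ifs at hn ⊢ <;> omega
        · exact ih h1
    exact this h hℓ
  choose! r hr using hsurj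
  have hr' : ∀ ℓ : Fin (L + 1), Nat.count p (r ℓ) = ℓ := fun ℓ => hr ℓ (Nat.lt_succ_iff.1 ℓ.2)
  let σ : SplittingFiltration N :=
    { length := L
      ptn := fun ℓ => P.seq (r ℓ)
      strictAnti := fun a b hab => hlt _ _ (by rw [hr', hr']; exact hab)
      first := by
        rw [← P.zero]
        exact heq' _ _ (by rw [hr', Nat.count_zero]; rfl)
      last := by
        rw [← hh]
        exact heq' _ _ (by rw [hr']; rfl) }
  have hlev : ∀ k, σ.lev (Nat.count p k) = P.seq k := fun k => by
    refine heq' _ _ ?_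
    rw [hr']
    exact min_eq_left (hcount_le k)
  have hfin : (Set.ofPred p).Finite := (Finset.range h).finite_toSet.subset fun k hk =>
    Finset.mem_coe.2 (Finset.mem_range.2 (hp_lt k hk))
  have hcard : hfin.toFinset.card = L := by
    rw [show L = Nat.count p h from rfl, Nat.count_eq_card_filter_range]
    congr 1
    ext k
    simp only [Set.Finite.mem_toFinset, Finset.mem_filter, Finset.mem_range]
    exact ⟨fun hk => ⟨hp_lt k hk, hk⟩, fun hk => hk.2⟩
  have hnth : ∀ ℓ < L, p (Nat.nth p ℓ) ∧ Nat.count p (Nat.nth p ℓ) = ℓ := fun ℓ hℓ =>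
    ⟨Nat.nth_mem _ fun _ => hℓ.trans_eq hcard.symm, Nat.count_nth fun _ => hℓ.trans_eq hcard.symm⟩
  have hnth_lt : ∀ ℓ < L, ∀ k, Nat.nth p ℓ < k ↔ ℓ < Nat.count p k := fun ℓ hℓ k => by
    constructor
    · intro hk
      have h1 : Nat.count p (Nat.nth p ℓ + 1) ≤ Nat.count p k := hmono hk
      rw [Nat.count_succ, if_pos (hnth ℓ hℓ).1, (hnth ℓ hℓ).2] at h1
      omega
    · exact Nat.nth_lt_of_lt_count
  -- Level ℓ fills the steps from `Nat.nth p (ℓ - 1) + 1` to `Nat.nth p ℓ`; one of them is already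
  -- built into `gap` and is subtracted.
  let ν : Finset.Ico 1 σ.length → ℕ := fun ℓ => Nat.nth p ℓ - Nat.nth p (ℓ - 1) - 1
  have hp0 : p 0 := by
    change P.seq (0 + 1) ≠ P.seq 0
    rw [P.zero]
    exact P.one
  have hpos : ∀ ℓ < L, σ.pos ν ℓ = Nat.nth p ℓ := fun ℓ => by
    induction ℓ with
    | zero =>
      intro _
      rw [pos_zero, Nat.nth_zero_of_zero hp0]
    | succ ℓ ih =>
      intro hℓ
      have hlt' : Nat.nth p ℓ < Nat.nth p (ℓ + 1) := by
        rw [hnth_lt ℓ (by omega), (hnth (ℓ + 1) hℓ).2]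
        omega
      rw [pos_succ, ih (by omega), gap, dif_pos (Finset.mem_Ico.2 ⟨by omega, hℓ⟩)]
      simp only [ν, Nat.add_sub_cancel]
      omega
  have hidx : ∀ k, σ.idx ν k = Nat.count p k := fun k => by
    have : ((Finset.range σ.length).filter fun ℓ => σ.pos ν ℓ < k) =
        Finset.range (Nat.count p k) := by
      ext ℓ
      simp only [Finset.mem_filter, Finset.mem_range]
      constructor
      · rintro ⟨h1, h2⟩
        rwa [hpos ℓ h1, hnth_lt ℓ h1] at h2
      · intro h1
        have h2 : ℓ < L := h1.trans_le (hcount_le k)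
        exact ⟨h2, by rwa [hpos ℓ h2, hnth_lt ℓ h2]⟩
    rw [idx, this, Finset.card_range]
  refine ⟨⟨σ, ν⟩, SplitSequence.ext (funext fun k => ?_)⟩
  change σ.lev (σ.idx ν k) = _
  rw [hidx, hlev]

/-- Splitting filtrations with repetition numbers correspond to split sequences. -/
def sequenceEquiv (hN : 2 ≤ N) :
    (Σ σ : SplittingFiltration N, Finset.Ico 1 σ.length → ℕ) ≃ SplitSequence N :=
  Equiv.ofBijective (toSequence hN) ⟨toSequence_injective hN, toSequence_surjective hN⟩

theorem sequenceEquiv_seq (hN : 2 ≤ N) (x : Σ σ : SplittingFiltration N, Finset.Ico 1 σ.length → ℕ)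
    (k : ℕ) : (sequenceEquiv hN x).seq k = x.1.lev (x.1.idx x.2 k) := rfl

end SplittingFiltration

/-! ### Multiplicities, exponents and weights of split sequences -/

namespace Finpartition

variable {N : ℕ} {P Q R : Finpartition (Finset.univ : Finset (Fin N))} {t : Finset (Fin N)}

/-- A set cannot be cut and rejoined along a chain of refinements, so a branch occupies consecutive
levels. -/
theorem mem_parts_of_le_of_le (hRQ : R ≤ Q) (hQP : Q ≤ P) (hP : t ∈ P.parts) (hR : t ∈ R.parts) :
    t ∈ Q.parts := by
  obtain ⟨i, hi⟩ := P.nonempty_of_mem_parts hP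
  refine part_ext (i := i) fun j => ⟨fun hj => ?_, fun hj => ?_⟩
  · exact le_iff_rel.1 hRQ _ _ (rel_of_mem hR hi hj)
  · exact ((le_iff_rel.1 hQP _ _ hj).mem_iff hP).1 hi

theorem mem_parts_of_card_le_one (hQP : Q ≤ P) (hP : t ∈ P.parts) (ht : t.card ≤ 1) :
    t ∈ Q.parts := by
  refine mem_parts_of_le_of_le bot_le hQP hP ?_
  obtain ⟨i, hi⟩ := P.nonempty_of_mem_parts hP
  exact mem_bot_iff.2 ⟨i, Finset.mem_univ i, (Finset.eq_singleton_iff_unique_mem.2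
    ⟨hi, fun j hj => Finset.card_le_one.1 ht j hj i hi⟩).symm⟩

theorem childCount_eq_one (ht : t ∈ Q.parts) : Q.childCount t = 1 := by
  rw [childCount, Finset.card_eq_one]
  refine ⟨t, Finset.eq_singleton_iff_unique_mem.2
    ⟨Finset.mem_filter.2 ⟨ht, Finset.Subset.refl t⟩, fun u hu => ?_⟩⟩
  obtain ⟨hu, hut⟩ := Finset.mem_filter.1 hu
  obtain ⟨i, hi⟩ := Q.nonempty_of_mem_parts hu
  exact Q.eq_of_mem_parts hu ht hi (hut hi)

theorem one_le_childCount (hQP : Q ≤ P) (ht : t ∈ P.parts) : 1 ≤ Q.childCount t := by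
  obtain ⟨i, hi⟩ := P.nonempty_of_mem_parts ht
  refine Finset.card_pos.2 ⟨Q.part i, Finset.mem_filter.2 ⟨Q.part_mem_parts i, fun j hj => ?_⟩⟩
  exact ((le_iff_rel.1 hQP _ _ (rel_iff_mem_part.2 hj)).mem_iff ht).1 hi

/-- The product of the falling factorials of a refinement step from `P` to `Q`. -/
def splitFactor (q : ℕ) (P Q : Finpartition (Finset.univ : Finset (Fin N))) : ℕ :=
  ∏ t ∈ P.parts, (q - 1).descFactorial (Q.childCount t - 1)

theorem splitFactor_self (q : ℕ) (P : Finpartition (Finset.univ : Finset (Fin N))) :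
    splitFactor q P P = 1 :=
  Finset.prod_eq_one fun t ht => by rw [childCount_eq_one ht, Nat.sub_self, Nat.descFactorial_zero]

/-- The sum of the branch exponents of all parts. -/
def exponent (P : Finpartition (Finset.univ : Finset (Fin N))) (s : Pairs N → ℂ) : ℂ :=
  ∑ t ∈ P.parts, SplittingFiltration.branchExponent t s

theorem branchExponent_of_card_eq_one (ht : t.card = 1) (s : Pairs N → ℂ) :
    SplittingFiltration.branchExponent t s = 0 := by
  rw [SplittingFiltration.branchExponent, ht, Finset.sum_eq_zero, Nat.cast_one, sub_self, add_zero]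
  intro p hp
  obtain ⟨-, h1, h2⟩ := Finset.mem_filter.1 hp
  exact absurd (Finset.card_le_one.1 ht.le _ h1 _ h2) p.2.ne

theorem exponent_eq_sum_filter (P : Finpartition (Finset.univ : Finset (Fin N)))
    (s : Pairs N → ℂ) : P.exponent s =
      ∑ t ∈ P.parts.filter fun t => 1 < t.card, SplittingFiltration.branchExponent t s := by
  rw [exponent, Finset.sum_filter_of_ne]
  intro t ht hne
  by_contra hle
  refine hne (branchExponent_of_card_eq_one ?_ s)
  have := (P.nonempty_of_mem_parts ht).card_pos
  omega

/-- The terms #t - 1 add up to N minus the number of parts, and a pair lies in a common part exactly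
when it is related. In this form the exponent matches the measure of a cell, which involves the
numbers of parts. -/
theorem exponent_eq (P : Finpartition (Finset.univ : Finset (Fin N))) (s : Pairs N → ℂ)
    [DecidableRel P.Rel] : P.exponent s =
      ((N : ℂ) - P.parts.card) + ∑ p : Pairs N with P.Rel p.1.1 p.1.2, s p := by
  have h1 : (N : ℂ) = ∑ t ∈ P.parts, (t.card : ℂ) := by
    rw [← Nat.cast_sum, P.sum_card_parts]
    simp
  have h2 : ∑ p : Pairs N with P.Rel p.1.1 p.1.2, s p =
      ∑ t ∈ P.parts, ∑ p : Pairs N with p.1.1 ∈ t ∧ p.1.2 ∈ t, s p := by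
    rw [← Finset.sum_biUnion]
    · congr 1
      ext p
      simp [rel_iff_exists]
    · intro t ht u hu htu
      refine Finset.disjoint_left.2 fun p hp hp' => htu ?_
      exact P.eq_of_mem_parts ht hu (Finset.mem_filter.1 hp).2.1 (Finset.mem_filter.1 hp').2.1
  rw [exponent, h1, h2]
  simp only [SplittingFiltration.branchExponent, Finset.sum_add_distrib, Finset.sum_sub_distrib]
  simp

end Finpartition

namespace SplitSequence

open Finpartition

variable {N : ℕ}

/-- The first step at which the partition into singletons is reached. -/
def height (P : SplitSequence N) : ℕ := by
  classical exact Nat.find P.eventually_bot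

theorem seq_height (P : SplitSequence N) : P.seq P.height = ⊥ := by
  classical exact Nat.find_spec P.eventually_bot

theorem seq_eq_bot_iff (P : SplitSequence N) {k : ℕ} : P.seq k = ⊥ ↔ P.height ≤ k := by
  classical
  constructor
  · exact fun h => Nat.find_min' _ h
  · exact fun h => le_bot_iff.1 (P.seq_height ▸ P.anti h)

/-- The product of the falling factorials of all refinement steps. -/
def multiplicity (P : SplitSequence N) (q : ℕ) : ℕ :=
  ∏ k ∈ Finset.range P.height, splitFactor q (P.seq k) (P.seq (k + 1))

/-- The contribution of a split sequence to the integral. -/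
def weight (P : SplitSequence N) (q : ℕ) (b : ℂ) (s : Pairs N → ℂ) : ℂ :=
  (P.multiplicity q : ℂ) / (q : ℂ) ^ (N - 1) *
    ∏ l ∈ Finset.Ico 1 P.height, (q : ℂ) ^ (-(b + (P.seq l).exponent s))

end SplitSequence

namespace SplittingFiltration

open Finpartition

variable {N : ℕ} (σ : SplittingFiltration N)

theorem mem_branches {t : Finset (Fin N)} :
    t ∈ σ.branches ↔ (∃ ℓ < σ.length, t ∈ (σ.lev ℓ).parts) ∧ 1 < t.card := by
  simp [branches, part_eq]

theorem branches_inter_part {ℓ : ℕ} (h : ℓ < σ.length) :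
    σ.branches ∩ σ.part ℓ = (σ.lev ℓ).parts.filter fun t => 1 < t.card := by
  ext t
  rw [Finset.mem_inter, mem_branches, Finset.mem_filter, part_eq]
  exact ⟨fun ⟨⟨_, h1⟩, h2⟩ => ⟨h2, h1⟩, fun ⟨h1, h2⟩ => ⟨⟨⟨ℓ, h, h1⟩, h2⟩, h1⟩⟩

theorem levelExponent_eq {ℓ : ℕ} (h : ℓ < σ.length) (s : Pairs N → ℂ) :
    σ.levelExponent ℓ s = (σ.lev ℓ).exponent s := by
  rw [levelExponent, branches_inter_part σ h, exponent_eq_sum_filter]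

theorem le_depth {t : Finset (Fin N)} {ℓ : ℕ} (hℓ : ℓ < σ.length) (ht : t ∈ (σ.lev ℓ).parts) :
    ℓ ≤ σ.depth t :=
  Finset.le_sup (f := id) (Finset.mem_filter.2 ⟨Finset.mem_range.2 hℓ, ht⟩)

theorem depth_spec {t : Finset (Fin N)} (ht : t ∈ σ.branches) :
    σ.depth t < σ.length ∧ t ∈ (σ.lev (σ.depth t)).parts := by
  obtain ⟨⟨ℓ, hℓ, h⟩, -⟩ := σ.mem_branches.1 ht
  have := Finset.exists_mem_eq_sup
    ((Finset.range σ.length).filter fun ℓ => t ∈ σ.part ℓ)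
    ⟨ℓ, Finset.mem_filter.2 ⟨Finset.mem_range.2 hℓ, h⟩⟩ id
  obtain ⟨m, hm, he⟩ := this
  have hm' := Finset.mem_filter.1 hm
  have : σ.depth t = m := he
  rw [this]
  exact ⟨Finset.mem_range.1 hm'.1, hm'.2⟩

theorem degree_eq (t : Finset (Fin N)) :
    σ.degree t = (σ.lev (σ.depth t + 1)).childCount t := rfl

/-- A part that survives to the next level contributes (q-1)_0 = 1. So a branch contributes only at
its depth, and the product over branches becomes a product over steps. -/
theorem multiplicity_eq (q : ℕ) :
    σ.multiplicity q = ∏ ℓ ∈ Finset.range σ.length, splitFactor q (σ.lev ℓ) (σ.lev (ℓ + 1)) := by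
  classical
  have h1 : ∀ ℓ ∈ Finset.range σ.length, splitFactor q (σ.lev ℓ) (σ.lev (ℓ + 1)) =
      ∏ t ∈ (σ.lev ℓ).parts.filter fun t => 1 < t.card,
        (q - 1).descFactorial ((σ.lev (ℓ + 1)).childCount t - 1) := fun ℓ _ => by
    rw [splitFactor, Finset.prod_filter_of_ne]
    intro t ht hne
    by_contra hle
    refine hne ?_
    rw [childCount_eq_one (mem_parts_of_card_le_one (σ.lev_anti (Nat.le_succ ℓ)) ht (by omega)),
      Nat.sub_self, Nat.descFactorial_zero]
  rw [Finset.prod_congr rfl h1, Finset.prod_comm' (t' := σ.branches)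
    (s' := fun t => (Finset.range σ.length).filter fun ℓ => t ∈ (σ.lev ℓ).parts)]
  · refine Finset.prod_congr rfl fun t ht => ?_
    obtain ⟨hd, hm⟩ := σ.depth_spec ht
    rw [Finset.prod_eq_single (σ.depth t)]
    · rfl
    · intro ℓ hℓ hne
      obtain ⟨hℓ1, hℓ2⟩ := Finset.mem_filter.1 hℓ
      have hle := σ.le_depth (Finset.mem_range.1 hℓ1) hℓ2
      rw [childCount_eq_one, Nat.sub_self, Nat.descFactorial_zero]
      exact mem_parts_of_le_of_le (σ.lev_anti (by omega)) (σ.lev_anti (Nat.le_succ ℓ)) hℓ2 hm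
    · intro h
      exact absurd (Finset.mem_filter.2 ⟨Finset.mem_range.2 hd, hm⟩) h
  · intro ℓ t
    simp only [Finset.mem_range, Finset.mem_filter, mem_branches]
    exact ⟨fun ⟨h1, h2, h3⟩ => ⟨⟨h1, h2⟩, ⟨ℓ, h1, h2⟩, h3⟩, fun ⟨⟨h1, h2⟩, _, h3⟩ => ⟨h1, h2, h3⟩⟩

variable (hN : 2 ≤ N) (ν : Finset.Ico 1 σ.length → ℕ)

theorem height_sequenceEquiv :
    (sequenceEquiv hN ⟨σ, ν⟩).height = σ.pos ν (σ.length - 1) + 1 := by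
  have hL := σ.length_pos hN
  have key : ∀ k, (sequenceEquiv hN ⟨σ, ν⟩).height ≤ k ↔ σ.pos ν (σ.length - 1) + 1 ≤ k := fun k => by
    rw [← SplitSequence.seq_eq_bot_iff, sequenceEquiv_seq]
    change σ.lev (σ.idx ν k) = ⊥ ↔ _
    have h1 := σ.lt_idx_iff ν (ℓ := σ.length - 1) (k := k)
    have h2 := σ.idx_le ν k
    rw [← σ.lev_of_le le_rfl, Nat.succ_le_iff]
    constructor
    · intro h
      have := σ.lev_inj h2 le_rfl h
      exact (h1.1 (by omega)).2
    · intro h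
      have := h1.2 ⟨by omega, h⟩
      rw [show σ.idx ν k = σ.length by omega]
  exact le_antisymm ((key _).2 le_rfl) ((key _).1 le_rfl)

/-- Steps 1 to height - 1 fall into runs, one of length ν ℓ + 1 for each level 1 ≤ ℓ < L. -/
theorem prod_Ico_sequenceEquiv {M : Type*} [CommMonoid M]
    (f : Finpartition (Finset.univ : Finset (Fin N)) → M) :
    ∏ l ∈ Finset.Ico 1 (sequenceEquiv hN ⟨σ, ν⟩).height, f ((sequenceEquiv hN ⟨σ, ν⟩).seq l) =
      ∏ ℓ : Finset.Ico 1 σ.length, f (σ.lev ℓ) ^ (ν ℓ + 1) := by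
  have hL := σ.length_pos hN
  have key : ∀ m < σ.length, ∏ l ∈ Finset.Ico 1 (σ.pos ν m + 1), f (σ.lev (σ.idx ν l)) =
      ∏ ℓ ∈ Finset.Ico 1 (m + 1), f (σ.lev ℓ) ^ σ.gap ν ℓ := fun m => by
    induction m with
    | zero => simp [pos_zero]
    | succ m ih =>
      intro hm
      rw [Finset.prod_Ico_succ_top (a := 1) (b := m + 1) (by omega), ← ih (by omega),
        ← Finset.prod_Ico_consecutive _ (m := 1) (n := σ.pos ν m + 1) (k := σ.pos ν (m + 1) + 1)
          (by omega) (by rw [pos_succ]; omega)]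
      congr 1
      rw [Finset.prod_eq_pow_card (b := f (σ.lev (m + 1))), Nat.card_Ico, pos_succ]
      · congr 1
        omega
      · intro l hl
        rw [Finset.mem_Ico] at hl
        rw [(σ.idx_eq_iff ν hm (Nat.succ_pos m)).2 ⟨by simpa using hl.1, by omega⟩]
  have h := key (σ.length - 1) (by omega)
  rw [height_sequenceEquiv]
  simp only [sequenceEquiv_seq]
  rw [h, Nat.sub_add_cancel hL, ← Finset.prod_coe_sort]
  refine Finset.prod_congr rfl fun ℓ _ => ?_
  rw [gap, dif_pos ℓ.2]

/-- A repeated step has factor 1, so only the jumps count. -/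
theorem multiplicity_sequenceEquiv (q : ℕ) :
    (sequenceEquiv hN ⟨σ, ν⟩).multiplicity q = σ.multiplicity q := by
  classical
  have hL := σ.length_pos hN
  rw [SplitSequence.multiplicity, height_sequenceEquiv, multiplicity_eq]
  rw [← Finset.prod_subset (s₁ := (Finset.range σ.length).image (σ.pos ν)), Finset.prod_image]
  · refine Finset.prod_congr rfl fun ℓ hℓ => ?_
    have hℓ' := Finset.mem_range.1 hℓ
    simp only [sequenceEquiv_seq]
    rw [σ.idx_pos ν hℓ', σ.idx_pos_add_one ν hℓ']
  · exact fun a _ b _ h => (σ.pos_strictMono ν).injective h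
  · intro k hk
    obtain ⟨ℓ, hℓ, rfl⟩ := Finset.mem_image.1 hk
    have := (σ.pos_strictMono ν).monotone (show ℓ ≤ σ.length - 1 by
      have := Finset.mem_range.1 hℓ
      omega)
    exact Finset.mem_range.2 (Nat.lt_succ_of_le this)
  · intro k _ hk
    simp only [sequenceEquiv_seq]
    have : σ.idx ν (k + 1) = σ.idx ν k := by
      by_contra hne
      obtain ⟨ℓ, hℓ, rfl⟩ := (σ.idx_succ_ne_iff ν).1 hne
      exact hk (Finset.mem_image_of_mem _ (Finset.mem_range.2 hℓ))
    rw [this, splitFactor_self]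

theorem weight_sequenceEquiv (q : ℕ) (b : ℂ) (s : Pairs N → ℂ) :
    (sequenceEquiv hN ⟨σ, ν⟩).weight q b s = (σ.multiplicity q : ℂ) / (q : ℂ) ^ (N - 1) *
      ∏ ℓ : Finset.Ico 1 σ.length, ((q : ℂ) ^ (-(b + σ.levelExponent ℓ s))) ^ (ν ℓ + 1) := by
  rw [SplitSequence.weight, multiplicity_sequenceEquiv,
    σ.prod_Ico_sequenceEquiv hN ν fun P => (q : ℂ) ^ (-(b + P.exponent s))]
  congr 1
  refine Finset.prod_congr rfl fun ℓ _ => ?_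
  rw [σ.levelExponent_eq (Finset.mem_Ico.1 ℓ.2).2]

end SplittingFiltration

/-! ### Summation over repetition numbers: the level functions -/

theorem HasSum.of_eq {α : Type*} {f g : α → ℂ} {a b : ℂ} (h : HasSum f a) (hfg : ∀ i, g i = f i)
    (hab : b = a) : HasSum g b := by
  rw [hab, funext hfg]
  exact h

/-- Summable complex series are absolutely summable, so series in independent indices can be
multiplied one at a time. -/
theorem hasSum_prod_fin {n : ℕ} {f : Fin n → ℕ → ℂ} {a : Fin n → ℂ}
    (hf : ∀ i, HasSum (f i) (a i)) :
    HasSum (fun ν : Fin n → ℕ => ∏ i, f i (ν i)) (∏ i, a i) := by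
  induction n with
  | zero =>
    exact (hasSum_unique fun _ : Fin 0 → ℕ => (1 : ℂ)).of_eq (fun ν => Fin.prod_univ_zero _)
      (Fin.prod_univ_zero _)
  | succ n ih =>
    have h1 := ih fun i => hf (Fin.succ i)
    have h2 := hf 0
    have h4 : Summable fun x : ℕ × (Fin n → ℕ) => f 0 x.1 * ∏ i, f (Fin.succ i) (x.2 i) := by
      apply summable_mul_of_summable_norm h2.summable.norm h1.summable.norm
    have h3 := h2.mul h1 h4
    refine (Fin.consEquiv fun _ => ℕ).hasSum_iff.1
      (h3.of_eq (fun x => ?_) (Fin.prod_univ_succ a))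
    rw [Function.comp_apply, Fin.prod_univ_succ]
    simp [Fin.consEquiv]

theorem hasSum_prod_pi {ι : Type*} [Fintype ι] {f : ι → ℕ → ℂ} {a : ι → ℂ}
    (hf : ∀ i, HasSum (f i) (a i)) : HasSum (fun ν : ι → ℕ => ∏ i, f i (ν i)) (∏ i, a i) := by
  let e := (Fintype.equivFin ι).symm
  have h := hasSum_prod_fin fun i => hf (e i)
  refine (Equiv.arrowCongr e (Equiv.refl ℕ)).hasSum_iff.1 (h.of_eq (fun ν => ?_) ?_)
  · rw [Function.comp_apply, ← e.prod_comp]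
    simp
  · exact (e.prod_comp a).symm

theorem norm_natCast_cpow_neg_lt_one {q : ℕ} (hq : 2 ≤ q) {w : ℂ} (hw : 0 < w.re) :
    ‖(q : ℂ) ^ (-w)‖ < 1 := by
  rw [Complex.norm_natCast_cpow_of_pos (by omega), Complex.neg_re]
  exact Real.rpow_lt_one_of_one_lt_of_neg (by exact_mod_cast (by omega : 1 < q)) (by linarith)

/-- The exponent n + 1 expresses that each level occurs at least once, whence the form 1 / (q^w -
1). -/
theorem hasSum_cpow_neg_pow {q : ℕ} (hq : 2 ≤ q) {w : ℂ} (hw : 0 < w.re) :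
    HasSum (fun n : ℕ => ((q : ℂ) ^ (-w)) ^ (n + 1)) (1 / ((q : ℂ) ^ w - 1)) := by
  have h1 := norm_natCast_cpow_neg_lt_one hq hw
  have h := (hasSum_geometric_of_norm_lt_one h1).mul_left ((q : ℂ) ^ (-w))
  have hq0 : (q : ℂ) ≠ 0 := by exact_mod_cast (by omega : q ≠ 0)
  have hne : (q : ℂ) ^ w ≠ 0 := by simp [Complex.cpow_eq_zero_iff, hq0]
  have hne1 : 1 - (q : ℂ) ^ (-w) ≠ 0 := fun h0 => by
    rw [← sub_eq_zero.1 h0] at h1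
    simp at h1
  have hne2 : (q : ℂ) ^ w - 1 ≠ 0 := fun h0 => by
    refine hne1 ?_
    rw [Complex.cpow_neg, sub_eq_zero.1 h0]
    simp
  refine h.of_eq (fun n => pow_succ' _ _) ?_
  rw [Complex.cpow_neg] at hne1 ⊢
  field_simp

/-- Along the axis where only ν i varies, the family is a nonzero multiple of the geometric series
with ratio r i. -/
theorem lt_one_of_summable_prod_pow {ι : Type*} [Fintype ι] {r : ι → ℝ} (hr : ∀ i, 0 < r i)
    (h : Summable fun ν : ι → ℕ => ∏ i, r i ^ (ν i + 1)) (i : ι) : r i < 1 := by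
  classical
  have h1 := h.comp_injective (Pi.single_injective (M := fun _ : ι => ℕ) i)
  have h2 : ((fun ν : ι → ℕ => ∏ i, r i ^ (ν i + 1)) ∘ fun n : ℕ => Pi.single i n) =
      fun n : ℕ => (∏ j, r j) * r i ^ n := by
    funext n
    rw [Function.comp_apply]
    simp only [pow_succ]
    rw [Finset.prod_mul_distrib, mul_comm]
    congr 1
    rw [Finset.prod_eq_single i]
    · rw [Pi.single_eq_same]
    · intro j _ hj
      rw [Pi.single_eq_of_ne hj, pow_zero]
    · simp
  rw [h2, summable_mul_left_iff (Finset.prod_pos fun j _ => hr j).ne',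
    summable_geometric_iff_norm_lt_one, Real.norm_of_nonneg (hr i).le] at h1
  exact h1

namespace SplittingFiltration

variable {N : ℕ} (σ : SplittingFiltration N)

theorem hasSum_weight (hN : 2 ≤ N) {q : ℕ} (hq : 2 ≤ q) {b : ℂ} {s : Pairs N → ℂ}
    (hs : s ∈ σ.levelPolytope b) :
    HasSum (fun ν : Finset.Ico 1 σ.length → ℕ => (sequenceEquiv hN ⟨σ, ν⟩).weight q b s)
      (σ.levelFunction q b s) := by
  simp only [levelPolytope, Set.mem_iInter] at hs
  have h := (hasSum_prod_pi fun ℓ : Finset.Ico 1 σ.length =>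
    hasSum_cpow_neg_pow hq (hs ℓ.1 ℓ.2)).mul_left ((σ.multiplicity q : ℂ) / (q : ℂ) ^ (N - 1))
  rw [levelFunction, ← Finset.prod_coe_sort]
  exact h.of_eq (fun ν => σ.weight_sequenceEquiv hN ν q b s) rfl

theorem weight_sequenceEquiv_eq_zero (hN : 2 ≤ N) {q : ℕ} (h : σ.multiplicity q = 0) (b : ℂ)
    (s : Pairs N → ℂ) (ν : Finset.Ico 1 σ.length → ℕ) :
    (sequenceEquiv hN ⟨σ, ν⟩).weight q b s = 0 := by
  rw [weight_sequenceEquiv, h]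
  simp

theorem mem_levelPolytope_of_summable (hN : 2 ≤ N) {q : ℕ} (hq : 2 ≤ q) {b : ℂ} {s : Pairs N → ℂ}
    (hσ : 0 < σ.multiplicity q)
    (h : Summable fun ν : Finset.Ico 1 σ.length → ℕ => ‖(sequenceEquiv hN ⟨σ, ν⟩).weight q b s‖) :
    s ∈ σ.levelPolytope b := by
  have hq0 : (0 : ℝ) < q := by exact_mod_cast (by omega : 0 < q)
  simp only [weight_sequenceEquiv, norm_mul, norm_prod, norm_pow] at h
  rw [summable_mul_left_iff] at h
  · simp only [levelPolytope, Set.mem_iInter]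
    intro ℓ hℓ
    have h1 := lt_one_of_summable_prod_pow (fun i => norm_pos_iff.2 (by
      rw [Ne, Complex.cpow_eq_zero_iff]
      exact fun h => (by omega : q ≠ 0) (by exact_mod_cast h.1))) h ⟨ℓ, hℓ⟩
    rw [Complex.norm_natCast_cpow_of_pos (by omega), Complex.neg_re] at h1
    by_contra hneg
    have hneg' : (b + σ.levelExponent ℓ s).re ≤ 0 := not_lt.1 hneg
    exact absurd h1 (not_lt.2 (Real.one_le_rpow (by exact_mod_cast (by omega : 1 ≤ q))
      (by linarith)))
  · rw [norm_ne_zero_iff]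
    have : (σ.multiplicity q : ℂ) ≠ 0 := by exact_mod_cast hσ.ne'
    have : (q : ℂ) ≠ 0 := by exact_mod_cast (by omega : q ≠ 0)
    positivity

end SplittingFiltration

/-- The sequence weights have the sum `levelSum` on the intersection of the level polytopes. -/
theorem SplitSequence.hasSum_weight {N : ℕ} (hN : 2 ≤ N) {q : ℕ} (hq : 2 ≤ q) {b : ℂ}
    {s : Pairs N → ℂ} (hs : ∀ σ : SplittingFiltration N, 0 < σ.multiplicity q →
      s ∈ σ.levelPolytope b) :
    HasSum (fun P : SplitSequence N => P.weight q b s) (levelSum N q b s) := by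
  have hfib : ∀ σ : SplittingFiltration N,
      HasSum (fun ν : Finset.Ico 1 σ.length → ℕ =>
        (SplittingFiltration.sequenceEquiv hN ⟨σ, ν⟩).weight q b s)
      (if 0 < σ.multiplicity q then σ.levelFunction q b s else 0) := fun σ => by
    split_ifs with h
    · exact σ.hasSum_weight hN hq (hs σ h)
    · simp only [σ.weight_sequenceEquiv_eq_zero hN (Nat.eq_zero_of_not_pos h)]
      exact hasSum_zero
  rw [← (SplittingFiltration.sequenceEquiv hN).hasSum_iff]
  -- There are finitely many σ, so summability of the norms on each fibre suffices.
  have hsum : Summable ((fun P : SplitSequence N => P.weight q b s) ∘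
      SplittingFiltration.sequenceEquiv hN) := by
    rw [← summable_norm_iff, summable_sigma_of_nonneg fun _ => norm_nonneg _]
    exact ⟨fun σ => (hfib σ).summable.norm, (hasSum_fintype _).summable⟩
  have h := hsum.hasSum.sigma hfib
  rw [levelSum, Finset.sum_filter, h.unique (hasSum_fintype _) |>.symm]
  exact hsum.hasSum

/-! ### Branch sets, and invariance of the multiplicity -/

/-- The properties of the branch set of a splitting filtration. -/
structure IsBranchTree {N : ℕ} (B : Finset (Finset (Fin N))) : Prop where
  laminar : ∀ t ∈ B, ∀ u ∈ B, ∀ i ∈ t, i ∈ u → t ⊆ u ∨ u ⊆ t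
  univ_mem : Finset.univ ∈ B
  one_lt_card : ∀ t ∈ B, 1 < t.card
  exists_pair : ∀ t ∈ B, ∃ i ∈ t, ∃ j ∈ t, i ≠ j ∧ ∀ u ∈ B, i ∈ u → j ∈ u → t ⊆ u

namespace SplittingFiltration

open Finpartition

variable {N : ℕ} (σ : SplittingFiltration N)

theorem subset_of_lev_le {t u : Finset (Fin N)} {k l : ℕ} (h : k ≤ l) (ht : t ∈ (σ.lev l).parts)
    (hu : u ∈ (σ.lev k).parts) {i : Fin N} (hi : i ∈ t) (hi' : i ∈ u) : t ⊆ u := fun _ hj =>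
  ((le_iff_rel.1 (σ.lev_anti h) _ _ (rel_of_mem ht hi hj)).mem_iff hu).1 hi'

theorem univ_mem_lev_zero (hN : 2 ≤ N) : Finset.univ ∈ (σ.lev 0).parts := by
  rw [lev_zero]
  exact part_ext (i := ⟨0, by omega⟩) fun j => ⟨fun _ => rel_top, fun _ => Finset.mem_univ j⟩

theorem univ_notMem_lev {ℓ : ℕ} (hN : 2 ≤ N) (hℓ : 0 < ℓ) : Finset.univ ∉ (σ.lev ℓ).parts := by
  intro h
  have h1 : σ.lev ℓ = ⊤ := ext_rel fun i j =>
    ⟨fun _ => rel_top, fun _ => rel_of_mem h (Finset.mem_univ i) (Finset.mem_univ j)⟩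
  rcases le_total ℓ σ.length with h2 | h2
  · rw [← σ.lev_zero] at h1
    have := σ.lev_inj h2 (Nat.zero_le _) h1
    omega
  · rw [σ.lev_of_le h2, ← σ.lev_of_le le_rfl, ← σ.lev_zero] at h1
    have h3 := σ.lev_inj le_rfl (Nat.zero_le _) h1
    have h4 := σ.length_pos hN
    omega

theorem isBranchTree_branches (hN : 2 ≤ N) : IsBranchTree σ.branches where
  laminar := by
    intro t ht u hu i hi hi'
    obtain ⟨⟨k, -, hk⟩, -⟩ := σ.mem_branches.1 ht
    obtain ⟨⟨l, -, hl⟩, -⟩ := σ.mem_branches.1 hu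
    rcases le_total k l with h | h
    · exact Or.inr (σ.subset_of_lev_le h hl hk hi' hi)
    · exact Or.inl (σ.subset_of_lev_le h hk hl hi hi')
  univ_mem := σ.mem_branches.2 ⟨⟨0, σ.length_pos hN, σ.univ_mem_lev_zero hN⟩, by simp; omega⟩
  one_lt_card t ht := (σ.mem_branches.1 ht).2
  -- Take two points of t separated right after the depth of t. A branch containing both lies on a
  -- level no deeper than that, so it contains t.
  exists_pair := by
    intro t ht
    obtain ⟨hd, hm⟩ := σ.depth_spec ht
    have hcard := (σ.mem_branches.1 ht).2
    have hnot : t ∉ (σ.lev (σ.depth t + 1)).parts := fun h => by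
      rcases Nat.lt_or_ge (σ.depth t + 1) σ.length with h1 | h1
      · have := σ.le_depth h1 h
        omega
      · rw [σ.lev_of_le h1, mem_bot_iff] at h
        obtain ⟨a, -, rfl⟩ := h
        simp at hcard
    obtain ⟨i, hi⟩ := (σ.lev (σ.depth t)).nonempty_of_mem_parts hm
    have hex : ∃ j ∈ t, ¬ (σ.lev (σ.depth t + 1)).Rel i j := by
      by_contra! hall
      refine hnot (part_ext (i := i) fun j => ⟨hall j, fun hj => ?_⟩)
      exact ((le_iff_rel.1 (σ.lev_anti (Nat.le_succ _)) _ _ hj).mem_iff hm).1 hi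
    obtain ⟨j, hj, hij⟩ := hex
    refine ⟨i, hi, j, hj, fun h => hij (h ▸ Rel.refl _ _), fun u hu hiu hju => ?_⟩
    obtain ⟨⟨l, hl, hul⟩, -⟩ := σ.mem_branches.1 hu
    refine σ.subset_of_lev_le (k := l) ?_ hm hul hi hiu
    by_contra! hlt
    exact hij (le_iff_rel.1 (σ.lev_anti hlt) _ _ (rel_of_mem hul hiu hju))

/-- The parts of the next level inside t are the classes of points that are equal or share a branch
strictly inside t. The degree thus depends on the branch set alone, and the multiplicity is constant
on equivalence classes. -/
theorem degree_eq_card_image [DecidableEq (Finset (Fin N))] {t : Finset (Fin N)}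
    (ht : t ∈ σ.branches) : σ.degree t = (t.image fun i => t.filter fun j =>
      j = i ∨ ∃ u ∈ σ.branches, u ⊂ t ∧ i ∈ u ∧ j ∈ u).card := by
  classical
  rw [degree_eq, childCount]
  obtain ⟨hd, hm⟩ := σ.depth_spec ht
  have hcard := (σ.mem_branches.1 ht).2
  have hle := σ.lev_anti (Nat.le_succ (σ.depth t))
  have hcls : ∀ i ∈ t, (t.filter fun j => j = i ∨ ∃ u ∈ σ.branches, u ⊂ t ∧ i ∈ u ∧ j ∈ u) =
      (σ.lev (σ.depth t + 1)).part i := by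
    intro i hi
    ext j
    rw [Finset.mem_filter, ← rel_iff_mem_part]
    constructor
    · rintro ⟨hj, rfl | ⟨u, hu, hut, hiu, hju⟩⟩
      · exact Rel.refl _ _
      · obtain ⟨⟨l, hl, hul⟩, -⟩ := σ.mem_branches.1 hu
        refine le_iff_rel.1 (σ.lev_anti ?_) _ _ (rel_of_mem hul hiu hju)
        by_contra! hlt
        exact hut.2 (σ.subset_of_lev_le (by omega) hm hul hi hiu)
    · intro hij
      have hj : j ∈ t := ((le_iff_rel.1 hle _ _ hij).mem_iff hm).1 hi
      refine ⟨hj, ?_⟩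
      by_cases hji : j = i
      · exact Or.inl hji
      refine Or.inr ⟨(σ.lev (σ.depth t + 1)).part i, ?_, ?_, self_mem_part _ i,
        rel_iff_mem_part.1 hij⟩
      · have h1 : 1 < ((σ.lev (σ.depth t + 1)).part i).card :=
          Finset.one_lt_card.2 ⟨j, rel_iff_mem_part.1 hij, i, self_mem_part _ i, hji⟩
        refine σ.mem_branches.2 ⟨⟨_, ?_, part_mem_parts _ i⟩, h1⟩
        by_contra! hge
        rw [σ.lev_of_le hge, rel_bot] at hij
        exact hji hij.symm
      · refine ⟨σ.subset_of_lev_le (Nat.le_succ _) (part_mem_parts _ i) hm (self_mem_part _ i) hi,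
          fun hsub => ?_⟩
        have heq : t = (σ.lev (σ.depth t + 1)).part i := Finset.Subset.antisymm hsub
          (σ.subset_of_lev_le (Nat.le_succ _) (part_mem_parts _ i) hm (self_mem_part _ i) hi)
        have h2 := part_mem_parts (σ.lev (σ.depth t + 1)) i
        rw [← heq] at h2
        rcases Nat.lt_or_ge (σ.depth t + 1) σ.length with h3 | h3
        · have := σ.le_depth h3 h2
          omega
        · rw [σ.lev_of_le h3, rel_bot] at hij
          exact hji hij.symm
  congr 1
  ext u
  rw [Finset.mem_filter, Finset.mem_image]
  constructor
  · rintro ⟨hu, hut⟩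
    obtain ⟨i, hi⟩ := (σ.lev (σ.depth t + 1)).nonempty_of_mem_parts hu
    exact ⟨i, hut hi, by rw [hcls i (hut hi), Finpartition.part_eq_of_mem _ hu hi]⟩
  · rintro ⟨i, hi, rfl⟩
    rw [hcls i hi]
    exact ⟨part_mem_parts _ i,
      σ.subset_of_lev_le (Nat.le_succ _) (part_mem_parts _ i) hm (self_mem_part _ i) hi⟩

theorem Equivalent.multiplicity_eq {σ τ : SplittingFiltration N} (h : σ.Equivalent τ) (q : ℕ) :
    σ.multiplicity q = τ.multiplicity q := by
  have h : σ.branches = τ.branches := h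
  rw [multiplicity, multiplicity, h]
  refine Finset.prod_congr rfl fun t ht => ?_
  rw [τ.degree_eq_card_image ht, σ.degree_eq_card_image (h ▸ ht), h]

end SplittingFiltration

/-! ### Split sequences from branch sets with multiplicities -/

namespace SplitSequence

open Finpartition

variable {N : ℕ}

/-- The parts with more than one element. -/
def branches (P : SplitSequence N) : Finset (Finset (Fin N)) := by
  classical exact Finset.univ.filter fun t => (∃ k, t ∈ (P.seq k).parts) ∧ 1 < t.card

theorem mem_branches {P : SplitSequence N} {t : Finset (Fin N)} :
    t ∈ P.branches ↔ (∃ k, t ∈ (P.seq k).parts) ∧ 1 < t.card := by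
  simp [branches]

theorem branches_sequenceEquiv (hN : 2 ≤ N) (σ : SplittingFiltration N)
    (ν : Finset.Ico 1 σ.length → ℕ) :
    (SplittingFiltration.sequenceEquiv hN ⟨σ, ν⟩).branches = σ.branches := by
  ext t
  rw [mem_branches, SplittingFiltration.mem_branches]
  refine and_congr_left fun hcard => ⟨?_, ?_⟩
  · rintro ⟨k, hk⟩
    rw [SplittingFiltration.sequenceEquiv_seq] at hk
    refine ⟨_, lt_of_le_of_ne (σ.idx_le ν k) fun h => ?_, hk⟩
    change t ∈ (σ.lev (σ.idx ν k)).parts at hk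
    rw [σ.lev_of_le h.ge, mem_bot_iff] at hk
    obtain ⟨a, -, rfl⟩ := hk
    simp at hcard
  · rintro ⟨ℓ, hℓ, ht⟩
    refine ⟨σ.pos ν ℓ, ?_⟩
    rw [SplittingFiltration.sequenceEquiv_seq]
    change t ∈ (σ.lev (σ.idx ν _)).parts
    rwa [σ.idx_pos ν hℓ]

/-- The number of steps after the first at which `t` is a part. -/
def branchCount (P : SplitSequence N) (t : Finset (Fin N)) : ℕ :=
  ((Finset.range (P.height - 1)).filter fun l => t ∈ (P.seq (l + 1)).parts).card

/-- The sum of a function over the proper branches containing two given points. -/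
def branchMeet (B : Finset (Finset (Fin N))) (n : Finset (Fin N) → ℕ) (i j : Fin N) : ℕ :=
  ∑ t ∈ (B.erase Finset.univ).filter fun t => i ∈ t ∧ j ∈ t, n t

theorem univ_notMem_seq (P : SplitSequence N) (l : ℕ) : Finset.univ ∉ (P.seq (l + 1)).parts :=
  fun h => P.one <| top_le_iff.1 <| le_trans (b := P.seq (l + 1)) (le_iff_rel.2 fun i j _ =>
    rel_of_mem h (Finset.mem_univ i) (Finset.mem_univ j)) (P.anti (by omega))

/-- At each positive step that keeps i and j together exactly one proper branch contains both.
Counted by branch, these steps number `branchMeet`; as they form an initial segment, this is a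
threshold. -/
theorem rel_seq_succ_iff (P : SplitSequence N) {i j : Fin N} (hij : i ≠ j) (l : ℕ) :
    (P.seq (l + 1)).Rel i j ↔ l < branchMeet P.branches P.branchCount i j := by
  classical
  let S := (Finset.range (P.height - 1)).filter fun l => (P.seq (l + 1)).Rel i j
  have hS : S = Finset.range S.card := Finset.eq_range_card_of_isLowerSet S fun a ha b hb => by
    simp only [S, Finset.mem_filter, Finset.mem_range] at ha ⊢
    exact ⟨by omega, le_iff_rel.1 (P.anti (by omega)) _ _ ha.2⟩
  have hcard : S.card = branchMeet P.branches P.branchCount i j := by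
    rw [branchMeet]
    simp only [branchCount]
    rw [← Finset.card_biUnion]
    · congr 1
      ext l
      simp only [S, Finset.mem_biUnion, Finset.mem_filter, Finset.mem_erase]
      constructor
      · rintro ⟨hl, hr⟩
        refine ⟨(P.seq (l + 1)).part i, ⟨⟨fun h => ?_, ?_⟩, self_mem_part _ i,
          rel_iff_mem_part.1 hr⟩, hl, part_mem_parts _ i⟩
        · have h1 := part_mem_parts (P.seq (l + 1)) i
          rw [h] at h1
          exact P.univ_notMem_seq l h1
        · exact mem_branches.2 ⟨⟨_, part_mem_parts _ i⟩,
            Finset.one_lt_card.2 ⟨i, self_mem_part _ i, j, rel_iff_mem_part.1 hr, hij⟩⟩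
      · rintro ⟨t, ⟨-, hi, hj⟩, hl, ht⟩
        exact ⟨hl, rel_of_mem ht hi hj⟩
    · intro t ht u hu htu
      refine Finset.disjoint_left.2 fun l hl hl' => htu ?_
      exact (P.seq (l + 1)).eq_of_mem_parts (Finset.mem_filter.1 hl).2 (Finset.mem_filter.1 hl').2
        (Finset.mem_filter.1 ht).2.1 (Finset.mem_filter.1 hu).2.1
  rw [← hcard, ← Finset.mem_range, ← hS, Finset.mem_filter, Finset.mem_range]
  refine ⟨fun h => ⟨?_, h⟩, fun h => h.2⟩
  by_contra! hle
  rw [P.seq_eq_bot_iff.2 (by omega), rel_bot] at h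
  exact hij h

theorem ext_branchCount {P Q : SplitSequence N} (h : P.branches = Q.branches)
    (h' : ∀ t ∈ P.branches.erase Finset.univ, P.branchCount t = Q.branchCount t) : P = Q := by
  refine SplitSequence.ext (funext fun k => ?_)
  rcases k with _ | l
  · rw [P.zero, Q.zero]
  · refine ext_rel fun i j => ?_
    by_cases hij : i = j
    · subst hij
      exact iff_of_true (Rel.refl _ _) (Rel.refl _ _)
    · rw [P.rel_seq_succ_iff hij, Q.rel_seq_succ_iff hij, ← h, branchMeet, branchMeet,
        Finset.sum_congr rfl fun t ht => h' t (Finset.mem_filter.1 ht).1]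

end SplitSequence

namespace IsBranchTree

open Finpartition SplitSequence

variable {N : ℕ} {B : Finset (Finset (Fin N))} (hB : IsBranchTree B) (n : Finset (Fin N) → ℕ)

theorem branchMeet_comm (i j : Fin N) : branchMeet B n i j = branchMeet B n j i := by
  simp only [branchMeet, and_comm]

theorem branchMeet_mono {i j k l : Fin N} (h : ∀ t ∈ B, i ∈ t → j ∈ t → k ∈ t ∧ l ∈ t) :
    branchMeet B n i j ≤ branchMeet B n k l := by
  refine Finset.sum_le_sum_of_subset fun t ht => ?_
  obtain ⟨h1, h2, h3⟩ := Finset.mem_filter.1 ht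
  exact Finset.mem_filter.2 ⟨h1, h t (Finset.mem_of_mem_erase h1) h2 h3⟩

-- The ultrametric inequality behind the construction. If some branch contains i and j but not k,
-- laminarity puts it inside every branch through j and k, which then contains i; otherwise every
-- branch through i and j contains k.
include hB in
theorem le_branchMeet_trans {i j k : Fin N} {l : ℕ} (h1 : l ≤ branchMeet B n i j)
    (h2 : l ≤ branchMeet B n j k) : l ≤ branchMeet B n i k := by
  by_cases hsub : ∀ t ∈ B, i ∈ t → j ∈ t → k ∈ t
  · exact h1.trans (branchMeet_mono n fun t ht hi hj => ⟨hi, hsub t ht hi hj⟩)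
  · push Not at hsub
    obtain ⟨t, ht, hi, hj, hk⟩ := hsub
    refine h2.trans (branchMeet_mono n fun u hu hj' hk' => ⟨?_, hk'⟩)
    rcases hB.laminar t ht u hu j hj hj' with h | h
    · exact h hi
    · exact absurd (h hk') hk

open Classical in
/-- The split sequence with prescribed branch set and multiplicities. -/
def toSequence : SplitSequence N where
  seq l := Finpartition.ofSetoid
    -- Points stay together for as many steps as their common proper branches supply. The case i = j
    -- is separate because `branchMeet B n i i` is finite.
    { r := fun i j => i = j ∨ l ≤ branchMeet B n i j
      iseqv :=
        { refl := fun i => Or.inl rfl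
          symm := fun {i j} h => h.imp Eq.symm fun h => by rwa [branchMeet_comm]
          trans := fun {i j k} h1 h2 => by
            rcases h1 with rfl | h1
            · exact h2
            · rcases h2 with rfl | h2
              · exact Or.inr h1
              · exact Or.inr (hB.le_branchMeet_trans n h1 h2) } }
  anti a b hab := by
    refine le_iff_rel.2 fun i j h => ?_
    rw [rel_iff_mem_part, mem_part_ofSetoid_iff_rel] at h ⊢
    exact h.imp id fun h => hab.trans h
  zero := by
    refine ext_rel fun i j => ⟨fun _ => rel_top, fun _ => ?_⟩
    rw [rel_iff_mem_part, mem_part_ofSetoid_iff_rel]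
    exact Or.inr (Nat.zero_le _)
  one := by
    intro h
    obtain ⟨i, -, j, -, hij, hmin⟩ := hB.exists_pair _ hB.univ_mem
    have h1 := h ▸ (rel_top (i := i) (j := j))
    rw [rel_iff_mem_part, mem_part_ofSetoid_iff_rel] at h1
    rcases h1 with h1 | h1
    · exact hij h1
    · have : branchMeet B n i j = 0 := by
        rw [branchMeet, Finset.filter_false_of_mem, Finset.sum_empty]
        rintro t ht ⟨hi, hj⟩
        exact Finset.ne_of_mem_erase ht
          (Finset.univ_subset_iff.1 (hmin t (Finset.mem_of_mem_erase ht) hi hj))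
      omega
  eventually_bot := by
    refine ⟨(∑ t ∈ B.erase Finset.univ, n t) + 1, ext_rel fun i j => ?_⟩
    rw [rel_bot, rel_iff_mem_part, mem_part_ofSetoid_iff_rel]
    refine ⟨fun h => h.resolve_right fun h => ?_, Or.inl⟩
    have : branchMeet B n i j ≤ ∑ t ∈ B.erase Finset.univ, n t :=
      Finset.sum_le_sum_of_subset (Finset.filter_subset _ _)
    omega

theorem rel_toSequence {l : ℕ} {i j : Fin N} :
    ((hB.toSequence n).seq l).Rel i j ↔ i = j ∨ l ≤ branchMeet B n i j := by
  classical
  rw [rel_iff_mem_part]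
  exact mem_part_ofSetoid_iff_rel

/-- The sum of a function over the proper branches containing `t`. -/
def branchSumAbove (B : Finset (Finset (Fin N))) (n : Finset (Fin N) → ℕ) (t : Finset (Fin N)) : ℕ :=
  ∑ u ∈ (B.erase Finset.univ).filter fun u => t ⊆ u, n u

theorem branchSumAbove_eq {t : Finset (Fin N)} (ht : t ∈ B.erase Finset.univ) :
    branchSumAbove B n t = (∑ u ∈ (B.erase Finset.univ).filter fun u => t ⊂ u, n u) + n t := by
  classical
  rw [branchSumAbove, ← Finset.sum_filter_add_sum_filter_not _ (fun u => t ⊂ u),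
    Finset.filter_filter, Finset.filter_filter]
  congr 1
  · refine Finset.sum_congr (Finset.filter_congr fun u _ => ?_) fun _ _ => rfl
    exact ⟨fun h => h.2, fun h => ⟨h.1, h⟩⟩
  · rw [Finset.sum_eq_single_of_mem t]
    · exact Finset.mem_filter.2 ⟨ht, Finset.Subset.refl t, fun h => h.2 (Finset.Subset.refl t)⟩
    · intro u hu hne
      obtain ⟨-, h1, h2⟩ := Finset.mem_filter.1 hu
      exact absurd (Finset.Subset.antisymm (by
        by_contra h3
        exact h2 ⟨h1, h3⟩) h1) hne

-- The sum over proper branches containing t is the last step at which t is undivided; the sum over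
-- the strictly larger ones is the last step at which t is joined to a point outside. The n t steps
-- between are those where t is a part.
include hB in
theorem mem_parts_toSequence_iff {t : Finset (Fin N)} (ht : t ∈ B.erase Finset.univ) {l : ℕ} : t ∈ ((hB.toSequence n).seq l).parts ↔
      branchSumAbove B n t < l + n t ∧ l ≤ branchSumAbove B n t := by
  classical
  have htB := Finset.mem_of_mem_erase ht
  have hsum := branchSumAbove_eq n ht
  constructor
  · intro hmem
    constructor
    · by_contra! hle
      have hne : (B.filter fun u => t ⊂ u).Nonempty := ⟨Finset.univ, Finset.mem_filter.2
        ⟨hB.univ_mem, Finset.ssubset_univ_iff.2 (Finset.ne_of_mem_erase ht)⟩⟩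
      -- The parent of t: by laminarity it lies in every branch strictly containing t, so a point c
      -- of p outside t stays with t as long as those branches last.
      obtain ⟨p, hp, hmin⟩ := Finset.exists_min_image _ Finset.card hne
      obtain ⟨hpB, htp⟩ := Finset.mem_filter.1 hp
      obtain ⟨c, hcp, hct⟩ := Finset.exists_of_ssubset htp
      obtain ⟨i, hi⟩ := Finset.card_pos.1 (Nat.zero_lt_of_lt (hB.one_lt_card t htB))
      have h1 : ∑ u ∈ (B.erase Finset.univ).filter fun u => t ⊂ u, n u ≤ branchMeet B n i c := by
        refine Finset.sum_le_sum_of_subset fun u hu => ?_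
        obtain ⟨huB, htu⟩ := Finset.mem_filter.1 hu
        refine Finset.mem_filter.2 ⟨huB, htu.1 hi, ?_⟩
        have huB' := Finset.mem_of_mem_erase huB
        rcases hB.laminar u huB' p hpB i (htu.1 hi) (htp.1 hi) with h | h
        · have h2 := hmin u (Finset.mem_filter.2 ⟨huB', htu⟩)
          rw [Finset.eq_of_subset_of_card_le h h2]
          exact hcp
        · exact h hcp
      have h2 : ((hB.toSequence n).seq l).Rel i c :=
        (hB.rel_toSequence n).2 (Or.inr (by omega))
      exact hct ((h2.mem_iff hmem).1 hi)
    · obtain ⟨i, hi, j, hj, hij, hmin⟩ := hB.exists_pair t htB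
      have h1 := ((hB.rel_toSequence n).1 (rel_of_mem hmem hi hj)).resolve_left hij
      refine h1.trans (Finset.sum_le_sum_of_subset fun u hu => ?_)
      obtain ⟨huB, h2, h3⟩ := Finset.mem_filter.1 hu
      exact Finset.mem_filter.2 ⟨huB, hmin u (Finset.mem_of_mem_erase huB) h2 h3⟩
  · rintro ⟨h1, h2⟩
    obtain ⟨i, hi⟩ := Finset.card_pos.1 (Nat.zero_lt_of_lt (hB.one_lt_card t htB))
    refine part_ext (i := i) fun j => ?_
    rw [hB.rel_toSequence n]
    constructor
    · intro hj
      refine Or.inr (h2.trans (Finset.sum_le_sum_of_subset fun u hu => ?_))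
      obtain ⟨huB, htu⟩ := Finset.mem_filter.1 hu
      exact Finset.mem_filter.2 ⟨huB, htu hi, htu hj⟩
    · rintro (rfl | h3)
      · exact hi
      · by_contra hj
        have h4 : branchMeet B n i j ≤ ∑ u ∈ (B.erase Finset.univ).filter fun u => t ⊂ u, n u := by
          refine Finset.sum_le_sum_of_subset fun u hu => ?_
          obtain ⟨huB, hiu, hju⟩ := Finset.mem_filter.1 hu
          refine Finset.mem_filter.2 ⟨huB, ?_⟩
          rcases hB.laminar t htB u (Finset.mem_of_mem_erase huB) i hi hiu with h | h
          · exact ⟨h, fun h' => hj (h' hju)⟩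
          · exact absurd (h hju) hj
        omega

variable (hn : ∀ t, 0 < n t)

-- At a positive step let T be a part with several elements, i in T, and j a point of T with least
-- `branchMeet` to i. The smallest branch p through i and j equals T: a point of T outside p would
-- meet i less, since n p > 0, and a point of p meets i at least as much as j does.
include hn in
theorem branches_toSequence : (hB.toSequence n).branches = B := by
  classical
  ext T
  rw [SplitSequence.mem_branches]
  constructor
  · rintro ⟨⟨l, hT⟩, hcard⟩
    rcases Nat.eq_zero_or_pos l with hl | hl
    · rw [hl, SplitSequence.zero] at hT
      rw [Finset.mem_singleton.1 (Finpartition.parts_top_subset _ hT)]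
      exact hB.univ_mem
    · obtain ⟨i, hi, j', hj', hij'⟩ := Finset.one_lt_card.1 hcard
      obtain ⟨j, hj, hjmin⟩ := Finset.exists_min_image (T.erase i) (branchMeet B n i)
        ⟨j', Finset.mem_erase.2 ⟨hij'.symm, hj'⟩⟩
      obtain ⟨hji, hjT⟩ := Finset.mem_erase.1 hj
      have hlj := ((hB.rel_toSequence n).1 (rel_of_mem hT hi hjT)).resolve_left hji.symm
      obtain ⟨p, hp, hpmin⟩ := Finset.exists_min_image (B.filter fun u => i ∈ u ∧ j ∈ u) Finset.card
        ⟨Finset.univ, Finset.mem_filter.2 ⟨hB.univ_mem, Finset.mem_univ i, Finset.mem_univ j⟩⟩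
      obtain ⟨hpB, hip, hjp⟩ := Finset.mem_filter.1 hp
      have hsub : ∀ u ∈ B, i ∈ u → j ∈ u → p ⊆ u := fun u hu hiu hju => by
        rcases hB.laminar u hu p hpB i hiu hip with h | h
        · rw [Finset.eq_of_subset_of_card_le h (hpmin u (Finset.mem_filter.2 ⟨hu, hiu, hju⟩))]
        · exact h
      have hTp : T = p := by
        ext k
        by_cases hki : k = i
        · subst hki
          exact iff_of_true hi hip
        constructor
        · intro hk
          by_contra hkp
          have hlt : branchMeet B n i k < branchMeet B n i j := by
            refine Finset.sum_lt_sum_of_subset (i := p) (fun u hu => ?_) ?_ ?_ (hn p)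
              fun _ _ _ => Nat.zero_le _
            · obtain ⟨huB, hiu, hku⟩ := Finset.mem_filter.1 hu
              refine Finset.mem_filter.2 ⟨huB, hiu, ?_⟩
              rcases hB.laminar u (Finset.mem_of_mem_erase huB) p hpB i hiu hip with h | h
              · exact absurd (h hku) hkp
              · exact h hjp
            · exact Finset.mem_filter.2 ⟨Finset.mem_erase.2 ⟨fun h => hkp (h ▸ Finset.mem_univ k),
                hpB⟩, hip, hjp⟩
            · exact fun h => hkp (Finset.mem_filter.1 h).2.2
          have := hjmin k (Finset.mem_erase.2 ⟨hki, hk⟩)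
          omega
        · intro hk
          have h1 : branchMeet B n i j ≤ branchMeet B n i k :=
            branchMeet_mono n fun u hu hiu hju => ⟨hiu, hsub u hu hiu hju hk⟩
          have h2 : ((hB.toSequence n).seq l).Rel i k :=
            (hB.rel_toSequence n).2 (Or.inr (hlj.trans h1))
          exact (h2.mem_iff hT).1 hi
      rw [hTp]
      exact hpB
  · intro hT
    refine ⟨?_, hB.one_lt_card T hT⟩
    by_cases hTu : T = Finset.univ
    · refine ⟨0, ?_⟩
      obtain ⟨i, hi⟩ := Finset.card_pos.1 (Nat.zero_lt_of_lt (hB.one_lt_card T hT))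
      rw [SplitSequence.zero, hTu]
      exact part_ext (i := i) fun j => ⟨fun _ => rel_top, fun _ => Finset.mem_univ j⟩
    · have hT' := Finset.mem_erase.2 ⟨hTu, hT⟩
      have h1 := branchSumAbove_eq n hT'
      have h2 := hn T
      exact ⟨branchSumAbove B n T, (hB.mem_parts_toSequence_iff n hT').2 ⟨by omega, le_rfl⟩⟩

include hn in
theorem branchCount_toSequence {t : Finset (Fin N)} (ht : t ∈ B.erase Finset.univ) :
    (hB.toSequence n).branchCount t = n t := by
  classical
  have h1 := branchSumAbove_eq n ht
  have h2 := hn t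
  have hheight : branchSumAbove B n t < (hB.toSequence n).height := by
    by_contra! hle
    have h3 := (hB.mem_parts_toSequence_iff n ht (l := branchSumAbove B n t)).2
      ⟨by omega, le_rfl⟩
    rw [SplitSequence.seq_eq_bot_iff _ |>.2 hle, mem_bot_iff] at h3
    obtain ⟨a, -, rfl⟩ := h3
    have := hB.one_lt_card _ (Finset.mem_of_mem_erase ht)
    simp at this
  -- The count runs over steps l + 1, so the interval of steps is shifted down by one.
  have : ((Finset.range ((hB.toSequence n).height - 1)).filter fun l =>
      t ∈ ((hB.toSequence n).seq (l + 1)).parts) =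
      Finset.Ico (branchSumAbove B n t - n t) (branchSumAbove B n t) := by
    ext l
    rw [Finset.mem_filter, hB.mem_parts_toSequence_iff n ht, Finset.mem_range,
      Finset.mem_Ico]
    omega
  rw [SplitSequence.branchCount, this, Nat.card_Ico]
  omega

end IsBranchTree

/-! ### The case b = 0: summation over a class of equal branch sets -/

theorem Complex.cpow_finset_sum {ι : Type*} {x : ℂ} (hx : x ≠ 0) (t : Finset ι) (f : ι → ℂ) :
    x ^ (∑ i ∈ t, f i) = ∏ i ∈ t, x ^ f i := by
  classical
  induction t using Finset.induction_on with
  | empty => simp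
  | insert i t hi ih => rw [Finset.sum_insert hi, Finset.prod_insert hi, Complex.cpow_add _ _ hx, ih]

namespace SplitSequence

open Finpartition

variable {N : ℕ}

theorem branchCount_pos {P : SplitSequence N} {t : Finset (Fin N)}
    (ht : t ∈ P.branches.erase Finset.univ) : 0 < P.branchCount t := by
  obtain ⟨hne, ht⟩ := Finset.mem_erase.1 ht
  obtain ⟨⟨k, hk⟩, hcard⟩ := mem_branches.1 ht
  rcases k with _ | l
  · rw [P.zero] at hk
    exact absurd (Finset.mem_singleton.1 (parts_top_subset _ hk)) hne
  · refine Finset.card_pos.2 ⟨l, Finset.mem_filter.2 ⟨Finset.mem_range.2 ?_, hk⟩⟩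
    by_contra! hle
    rw [P.seq_eq_bot_iff.2 (by omega), mem_bot_iff] at hk
    obtain ⟨a, -, rfl⟩ := hk
    simp at hcard

open Classical in
/-- Split sequences with a given branch set correspond to arbitrary branch multiplicities. -/
def branchEquiv {B : Finset (Finset (Fin N))} (hB : IsBranchTree B) :
    {P : SplitSequence N // P.branches = B} ≃ (↥(B.erase Finset.univ) → ℕ) where
  toFun P t := P.1.branchCount t - 1
  -- A proper branch occurs at least once, so m records the extra occurrences; the value 1 elsewhere
  -- only serves positivity.
  invFun m := ⟨hB.toSequence fun t => if h : t ∈ B.erase Finset.univ then m ⟨t, h⟩ + 1 else 1,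
    hB.branches_toSequence _ fun t => by split_ifs <;> omega⟩
  left_inv P := by
    obtain ⟨P, rfl⟩ := P
    refine Subtype.ext (ext_branchCount ?_ fun t ht => ?_)
    · exact hB.branches_toSequence _ fun t => by split_ifs <;> omega
    · rw [hB.branches_toSequence _ fun t => by split_ifs <;> omega] at ht
      rw [hB.branchCount_toSequence _ (fun t => by split_ifs <;> omega) ht, dif_pos ht]
      have := branchCount_pos ht
      change P.branchCount t - 1 + 1 = P.branchCount t
      omega
  right_inv m := by
    funext t
    dsimp only
    rw [hB.branchCount_toSequence _ (fun t => by split_ifs <;> omega) t.2, dif_pos t.2,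
      Nat.add_sub_cancel]

/-- With b = 0 each step contributes a product over its proper branches, so the whole product can be
regrouped by branch. A nonzero b would enter once per step and couple the branches. -/
theorem weight_zero_eq (P : SplitSequence N) {q : ℕ} (hq : 2 ≤ q) (s : Pairs N → ℂ) :
    P.weight q 0 s = (P.multiplicity q : ℂ) / (q : ℂ) ^ (N - 1) *
      ∏ t ∈ P.branches.erase Finset.univ,
        ((q : ℂ) ^ (-SplittingFiltration.branchExponent t s)) ^ P.branchCount t := by
  classical
  have hq0 : (q : ℂ) ≠ 0 := by exact_mod_cast (by omega : q ≠ 0)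
  rw [weight, Finset.prod_Ico_eq_prod_range]
  congr 1
  have h1 : ∀ l, (q : ℂ) ^ (-(0 + (P.seq (1 + l)).exponent s)) =
      ∏ t ∈ (P.branches.erase Finset.univ).filter fun t => t ∈ (P.seq (l + 1)).parts,
        (q : ℂ) ^ (-SplittingFiltration.branchExponent t s) := fun l => by
    rw [zero_add, exponent_eq_sum_filter, ← Finset.sum_neg_distrib, Complex.cpow_finset_sum hq0,
      add_comm 1 l]
    refine Finset.prod_congr ?_ fun _ _ => rfl
    ext t
    simp only [Finset.mem_filter, Finset.mem_erase, mem_branches]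
    exact ⟨fun ⟨h1, h2⟩ => ⟨⟨fun h => P.univ_notMem_seq l (h ▸ h1), ⟨_, h1⟩, h2⟩, h1⟩,
      fun ⟨⟨_, _, h2⟩, h1⟩ => ⟨h1, h2⟩⟩
  simp only [h1]
  rw [Finset.prod_comm' (t' := P.branches.erase Finset.univ)
    (s' := fun t => (Finset.range (P.height - 1)).filter fun l => t ∈ (P.seq (l + 1)).parts)]
  · simp only [Finset.prod_const]
    rfl
  · intro l t
    simp only [Finset.mem_filter]
    tauto

theorem multiplicity_eq_of_branches (hN : 2 ≤ N) {P : SplitSequence N}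
    {σ : SplittingFiltration N} (h : P.branches = σ.branches) (q : ℕ) :
    P.multiplicity q = σ.multiplicity q := by
  obtain ⟨⟨τ, ν⟩, rfl⟩ := (SplittingFiltration.sequenceEquiv hN).surjective P
  rw [branches_sequenceEquiv] at h
  rw [SplittingFiltration.multiplicity_sequenceEquiv]
  exact SplittingFiltration.Equivalent.multiplicity_eq h q

end SplitSequence

namespace SplittingFiltration

open Finpartition

variable {N : ℕ}

/-- For 1 ≤ ℓ < L the exponent E_ℓ is a nonempty sum of proper branch exponents; were it empty, the
level would be discrete too early. -/
theorem branchPolytope_subset_levelPolytope (hN : 2 ≤ N) {σ τ : SplittingFiltration N}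
    (h : σ.Equivalent τ) : τ.branchPolytope ⊆ σ.levelPolytope 0 := by
  intro s hs
  have h : σ.branches = τ.branches := h
  simp only [branchPolytope, levelPolytope, Set.mem_iInter, properBranches, ← h] at hs ⊢
  intro ℓ hℓ
  obtain ⟨h1, h2⟩ := Finset.mem_Ico.1 hℓ
  change 0 < (0 + σ.levelExponent ℓ s).re
  rw [zero_add, levelExponent, Complex.re_sum]
  refine Finset.sum_pos (fun t ht => ?_) ?_
  · obtain ⟨ht1, ht2⟩ := Finset.mem_inter.1 ht
    refine hs t (Finset.mem_erase.2 ⟨fun he => ?_, ht1⟩)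
    exact σ.univ_notMem_lev hN h1 (he ▸ ht2)
  · by_contra hne
    rw [Finset.not_nonempty_iff_eq_empty, σ.branches_inter_part h2] at hne
    have h3 : σ.lev ℓ = ⊥ := by
      refine ext_rel fun i j => ⟨fun hij => ?_, fun hij => ?_⟩
      · rw [rel_bot]
        by_contra hne'
        have : (σ.lev ℓ).part i ∈ (σ.lev ℓ).parts.filter fun t => 1 < t.card :=
          Finset.mem_filter.2 ⟨part_mem_parts _ i, Finset.one_lt_card.2
            ⟨i, self_mem_part _ i, j, rel_iff_mem_part.1 hij, hne'⟩⟩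
        rw [hne] at this
        simp at this
      · rw [rel_bot] at hij
        exact hij ▸ Rel.refl _ _
    rw [← σ.lev_of_le le_rfl] at h3
    have := σ.lev_inj h2.le le_rfl h3
    omega

/-- Both sides evaluate the sum of the weights of all sequences with the branch set of τ: by branch
multiplicities it is I, by filtrations and repetition numbers it is the sum of the J. -/
theorem sum_levelFunction_eq_branchFunction (hN : 2 ≤ N) {q : ℕ} (hq : 2 ≤ q)
    (τ : SplittingFiltration N) {s : Pairs N → ℂ} (hs : s ∈ τ.branchPolytope) :
    ∑ σ : SplittingFiltration N with σ.Equivalent τ, σ.levelFunction q 0 s =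
      τ.branchFunction q s := by
  classical
  have hB := τ.isBranchTree_branches hN
  have hs' := hs
  simp only [branchPolytope, Set.mem_iInter] at hs'
  have h1 := (hasSum_prod_pi fun t : ↥(τ.branches.erase Finset.univ) =>
    hasSum_cpow_neg_pow hq (hs' t.1 t.2)).mul_left ((τ.multiplicity q : ℂ) / (q : ℂ) ^ (N - 1))
  have h2 : HasSum (fun P : {P : SplitSequence N // P.branches = τ.branches} => P.1.weight q 0 s)
      (τ.branchFunction q s) := by
    refine (SplitSequence.branchEquiv hB).symm.hasSum_iff.1 (h1.of_eq (fun m => ?_) ?_)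
    · rw [Function.comp_apply]
      have hP := ((SplitSequence.branchEquiv hB).symm m).2
      rw [SplitSequence.weight_zero_eq _ hq, SplitSequence.multiplicity_eq_of_branches hN hP, hP,
        ← Finset.prod_coe_sort]
      congr 1
      refine Finset.prod_congr rfl fun t _ => ?_
      have h3 := congrFun ((SplitSequence.branchEquiv hB).apply_symm_apply m) t
      have h4 := SplitSequence.branchCount_pos
        (P := ((SplitSequence.branchEquiv hB).symm m).1) (t := t) (by rw [hP]; exact t.2)
      have h5 : ((SplitSequence.branchEquiv hB).symm m).1.branchCount t = m t + 1 := by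
        rw [← h3]
        change _ = _ - 1 + 1
        omega
      rw [h5]
    · rw [branchFunction, properBranches, ← Finset.prod_coe_sort]
  have h3 : HasSum (fun P : SplitSequence N => if P.branches = τ.branches then P.weight q 0 s else 0)
      (τ.branchFunction q s) := by
    have := (hasSum_subtype_iff_indicator (f := fun P : SplitSequence N => P.weight q 0 s)
      (s := {P | P.branches = τ.branches})).1 h2
    exact this.of_eq (fun P => by simp [Set.indicator_apply]) rfl
  have h4 := (sequenceEquiv hN).hasSum_iff.2 h3
  have hfib : ∀ σ : SplittingFiltration N,
      HasSum (fun ν : Finset.Ico 1 σ.length → ℕ =>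
        ((fun P : SplitSequence N => if P.branches = τ.branches then P.weight q 0 s else 0) ∘
          sequenceEquiv hN) ⟨σ, ν⟩)
      (if σ.Equivalent τ then σ.levelFunction q 0 s else 0) := fun σ => by
    simp only [Function.comp_apply, SplitSequence.branches_sequenceEquiv]
    by_cases h : σ.Equivalent τ
    · have h' : σ.branches = τ.branches := h
      rw [if_pos h]
      simp only [if_pos h']
      exact σ.hasSum_weight hN hq (branchPolytope_subset_levelPolytope hN h hs)
    · have h' : ¬ σ.branches = τ.branches := h
      rw [if_neg h]
      simp only [if_neg h']
      exact hasSum_zero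
  rw [(h4.sigma hfib).unique (hasSum_fintype _), Finset.sum_filter]

/-! ### Reduced representatives -/

theorem lev_idx_zero (σ : SplittingFiltration N) (k : ℕ) : σ.lev (σ.idx (fun _ => 0) k) = σ.lev k := by
  have hgap : ∀ ℓ, σ.gap (fun _ => 0) ℓ = 1 := fun ℓ => by unfold gap; split_ifs <;> rfl
  have hpos : ∀ ℓ, σ.pos (fun _ => 0) ℓ = ℓ := fun ℓ => by simp [pos, hgap]
  have h1 : ((Finset.range σ.length).filter fun ℓ => σ.pos (fun _ => 0) ℓ < k) =
      Finset.range (min σ.length k) := by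
    ext ℓ
    simp [hpos]
  rw [idx, h1, Finset.card_range]
  rcases le_total k σ.length with h | h
  · rw [min_eq_right h]
  · rw [min_eq_left h, σ.lev_of_le h, σ.lev_of_le le_rfl]

theorem IsReduced.branchCount_eq_one (hN : 2 ≤ N) {σ : SplittingFiltration N} (hσ : σ.IsReduced)
    {t : Finset (Fin N)} (ht : t ∈ σ.branches.erase Finset.univ) :
    (sequenceEquiv hN ⟨σ, fun _ => 0⟩).branchCount t = 1 := by
  have hpos : 0 < (sequenceEquiv hN ⟨σ, fun _ => 0⟩).branchCount t :=
    SplitSequence.branchCount_pos (by rwa [SplitSequence.branches_sequenceEquiv])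
  refine le_antisymm (Finset.card_le_one.2 fun a ha b hb => ?_) hpos
  obtain ⟨hne, htB⟩ := Finset.mem_erase.1 ht
  have hcard := (σ.mem_branches.1 htB).2
  have key : ∀ l, t ∈ ((sequenceEquiv hN ⟨σ, fun _ => 0⟩).seq (l + 1)).parts →
      l + 1 < σ.length ∧ t ∈ σ.part (l + 1) := fun l hl => by
    rw [sequenceEquiv_seq, lev_idx_zero] at hl
    refine ⟨?_, hl⟩
    by_contra! hle
    rw [σ.lev_of_le hle, mem_bot_iff] at hl
    obtain ⟨a, -, rfl⟩ := hl
    simp at hcard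
  have h1 := (hσ t htB).unique (key a (Finset.mem_filter.1 ha).2) (key b (Finset.mem_filter.1 hb).2)
  omega

/-- The unrepeated sequence of a reduced filtration has all proper branch counts 1, and branch set
and counts determine a sequence. -/
theorem IsReduced.eq_of_equivalent (hN : 2 ≤ N) {σ τ : SplittingFiltration N} (hσ : σ.IsReduced)
    (hτ : τ.IsReduced) (h : σ.Equivalent τ) : σ = τ := by
  have h : σ.branches = τ.branches := h
  have h1 : sequenceEquiv hN ⟨σ, fun _ => 0⟩ = sequenceEquiv hN ⟨τ, fun _ => 0⟩ := by
    refine SplitSequence.ext_branchCount ?_ fun t ht => ?_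
    · rw [SplitSequence.branches_sequenceEquiv, SplitSequence.branches_sequenceEquiv, h]
    · rw [SplitSequence.branches_sequenceEquiv] at ht
      rw [hσ.branchCount_eq_one hN ht, hτ.branchCount_eq_one hN (h ▸ ht)]
  exact congrArg Sigma.fst ((sequenceEquiv hN).injective h1)

/-- Take the filtration of the sequence in which every proper branch has multiplicity 1; a proper
branch on two of its levels would occur at two steps. -/
theorem exists_isReduced_equivalent (hN : 2 ≤ N) (σ : SplittingFiltration N) :
    ∃ τ : SplittingFiltration N, τ.IsReduced ∧ σ.Equivalent τ := by
  have hB := σ.isBranchTree_branches hN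
  have hbr := hB.branches_toSequence (fun _ => 1) fun _ => one_pos
  obtain ⟨⟨τ, ν⟩, hτ⟩ := (sequenceEquiv hN).surjective (hB.toSequence fun _ => 1)
  have hτσ : τ.branches = σ.branches := by
    rw [← hbr, ← hτ, SplitSequence.branches_sequenceEquiv]
  refine ⟨τ, fun t ht => ?_, hτσ.symm⟩
  by_cases htu : t = Finset.univ
  · subst htu
    refine ⟨0, ⟨τ.length_pos hN, τ.univ_mem_lev_zero hN⟩, fun ℓ hℓ => ?_⟩
    by_contra h0
    exact τ.univ_notMem_lev hN (Nat.pos_of_ne_zero h0) hℓ.2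
  · have hcount := hB.branchCount_toSequence (fun _ => 1) (fun _ => one_pos)
      (Finset.mem_erase.2 ⟨htu, hτσ ▸ ht⟩)
    rw [← hτ] at hcount
    have key : ∀ ℓ, ℓ < τ.length → t ∈ τ.part ℓ → 0 < ℓ ∧ τ.pos ν ℓ - 1 ∈
        (Finset.range ((sequenceEquiv hN ⟨τ, ν⟩).height - 1)).filter fun l =>
          t ∈ ((sequenceEquiv hN ⟨τ, ν⟩).seq (l + 1)).parts := fun ℓ hℓ htℓ => by
      have h0 : 0 < ℓ := by
        by_contra h0
        rw [Nat.eq_zero_of_not_pos h0, part_eq, lev_zero] at htℓ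
        exact htu (Finset.mem_singleton.1 (parts_top_subset _ htℓ))
      have h1 : τ.pos ν 0 < τ.pos ν ℓ := τ.pos_strictMono ν h0
      have h2 : τ.pos ν ℓ ≤ τ.pos ν (τ.length - 1) := (τ.pos_strictMono ν).monotone (by omega)
      rw [pos_zero] at h1
      refine ⟨h0, Finset.mem_filter.2 ⟨?_, ?_⟩⟩
      · rw [height_sequenceEquiv, Finset.mem_range]
        omega
      · rw [sequenceEquiv_seq, Nat.sub_add_cancel h1]
        change t ∈ (τ.lev (τ.idx ν _)).parts
        rwa [τ.idx_pos ν hℓ]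
    obtain ⟨⟨ℓ, hℓ, htℓ⟩, -⟩ := τ.mem_branches.1 ht
    refine ⟨ℓ, ⟨hℓ, htℓ⟩, fun m hm => ?_⟩
    have h1 := key ℓ hℓ htℓ
    have h2 := key m hm.1 hm.2
    have h3 := Finset.card_le_one.1 hcount.le _ h1.2 _ h2.2
    have h4 : τ.pos ν 0 < τ.pos ν ℓ := τ.pos_strictMono ν h1.1
    have h5 : τ.pos ν 0 < τ.pos ν m := τ.pos_strictMono ν h2.1
    exact (τ.pos_strictMono ν).injective (by omega)

end SplittingFiltration

theorem reducedPolytope_subset_omegaPolytope {N : ℕ} (hN : 2 ≤ N) (q : ℕ) (a : ℂ) :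
    reducedPolytope N q a ⊆ omegaPolytope N q a 0 := by
  rintro s ⟨hs1, hs2⟩
  refine ⟨hs1, ?_⟩
  simp only [Set.mem_iInter] at hs2 ⊢
  intro σ hσ
  obtain ⟨τ, hτ, hστ⟩ := σ.exists_isReduced_equivalent hN
  exact SplittingFiltration.branchPolytope_subset_levelPolytope hN hστ
    (hs2 τ ⟨hτ, hστ.multiplicity_eq q ▸ hσ⟩)

theorem levelSum_zero_eq_branchSum {N : ℕ} (hN : 2 ≤ N) {q : ℕ} (hq : 2 ≤ q) {a : ℂ}
    {s : Pairs N → ℂ} (hs : s ∈ reducedPolytope N q a) : levelSum N q 0 s = branchSum N q s := by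
  classical
  have hs2 := hs.2
  simp only [Set.mem_iInter] at hs2
  choose r hr1 hr2 using fun σ : SplittingFiltration N => σ.exists_isReduced_equivalent hN
  -- Group the filtrations by reduced representative; multiplicity is constant on a class, so a
  -- class is kept or dropped as a whole.
  rw [levelSum, branchSum, ← Finset.sum_fiberwise_of_maps_to (g := r)
    (t := Finset.univ.filter fun σ => σ.IsReduced ∧ 0 < σ.multiplicity q)]
  · refine Finset.sum_congr rfl fun τ hτ => ?_
    obtain ⟨-, hτ1, hτ2⟩ := Finset.mem_filter.1 hτ
    rw [← SplittingFiltration.sum_levelFunction_eq_branchFunction hN hq τ (hs2 τ ⟨hτ1, hτ2⟩)]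
    refine Finset.sum_congr ?_ fun _ _ => rfl
    ext σ
    simp only [Finset.mem_filter, Finset.mem_univ, true_and]
    constructor
    · rintro ⟨-, rfl⟩
      exact hr2 σ
    · intro h
      refine ⟨h.multiplicity_eq q ▸ hτ2, (hr1 σ).eq_of_equivalent hN hτ1 ?_⟩
      exact Eq.trans (Eq.symm (hr2 σ)) h
  · intro σ hσ
    have hσ' := (Finset.mem_filter.1 hσ).2
    exact Finset.mem_filter.2 ⟨Finset.mem_univ _, hr1 σ, (hr2 σ).multiplicity_eq q ▸ hσ'⟩

/-! ### Separation steps of pairs, and the weight as a power of q -/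

namespace SplitSequence

open Finpartition

variable {N : ℕ} (P : SplitSequence N)

/-- The number of steps after the first at which `i` and `j` are not separated. -/
def relCount (i j : Fin N) : ℕ := by
  classical exact ((Finset.range (P.height - 1)).filter fun l => (P.seq (l + 1)).Rel i j).card

theorem relCount_le (i j : Fin N) : P.relCount i j ≤ P.height - 1 := by
  classical exact (Finset.card_filter_le _ _).trans (Finset.card_range _).le

/-- Points once separated stay separated, so `relCount` is the last step at which i and j are
together. In a cell it is the number of factors q by which their distance falls below the largest
one. -/
theorem rel_seq_iff {i j : Fin N} (hij : i ≠ j) (l : ℕ) :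
    (P.seq l).Rel i j ↔ l ≤ P.relCount i j := by
  classical
  rcases l with _ | l
  · rw [P.zero]
    exact iff_of_true rel_top (Nat.zero_le _)
  have hS := Finset.eq_range_card_of_isLowerSet
    ((Finset.range (P.height - 1)).filter fun l => (P.seq (l + 1)).Rel i j) fun a ha b hb => by
      simp only [Finset.mem_filter, Finset.mem_range] at ha ⊢
      exact ⟨by omega, le_iff_rel.1 (P.anti (by omega)) _ _ ha.2⟩
  have h1 := Finset.ext_iff.1 hS l
  rw [Finset.mem_filter, Finset.mem_range, Finset.mem_range] at h1
  have h2 : (P.seq (l + 1)).Rel i j → l < P.height - 1 := fun h => by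
    by_contra! hle
    rw [P.seq_eq_bot_iff.2 (by omega), rel_bot] at h
    exact hij h
  rw [Nat.succ_le_iff, relCount]
  exact ⟨fun h => by convert! h1.1 ⟨h2 h, h⟩, fun h => (h1.2 (by convert! h)).2⟩

theorem height_pos (hN : 2 ≤ N) : 0 < P.height := by
  by_contra h
  have h1 := P.seq_eq_bot_iff.2 (Nat.le_of_not_lt h)
  have h2 : (P.seq 0).Rel ⟨0, by omega⟩ ⟨1, by omega⟩ := by
    rw [P.zero]
    exact rel_top
  rw [h1, rel_bot] at h2
  simp at h2

theorem exists_pair_of_ne (p : Fin N → Fin N → Prop) (hp : ∀ i j, p i j → p j i)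
    (h : ∃ i j, i ≠ j ∧ p i j) : ∃ x : Pairs N, p x.1.1 x.1.2 := by
  obtain ⟨i, j, hij, h⟩ := h
  rcases lt_or_gt_of_ne hij with h1 | h1
  · exact ⟨⟨(i, j), h1⟩, h⟩
  · exact ⟨⟨(j, i), h1⟩, hp _ _ h⟩

/-- The first step is proper, so some pair separates there; in a cell it realises the largest
distance. -/
theorem exists_relCount_eq_zero : ∃ p : Pairs N, P.relCount p.1.1 p.1.2 = 0 := by
  obtain ⟨p, hp⟩ := exists_pair_of_ne (fun i j => ¬ (P.seq 1).Rel i j)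
    (fun i j h h' => h h'.symm) (by
      by_contra! h
      refine P.one (ext_rel fun i j => ⟨fun _ => rel_top, fun _ => ?_⟩)
      by_cases hij : i = j
      · exact hij ▸ Rel.refl _ _
      · exact h i j hij)
  refine ⟨p, ?_⟩
  rw [P.rel_seq_iff p.2.ne] at hp
  omega

/-- One step before the sequence becomes discrete some pair is still together; in a cell it realises
the smallest distance. -/
theorem exists_relCount_eq_height (hN : 2 ≤ N) :
    ∃ p : Pairs N, P.relCount p.1.1 p.1.2 = P.height - 1 := by
  obtain ⟨p, hp⟩ := exists_pair_of_ne (fun i j => (P.seq (P.height - 1)).Rel i j)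
    (fun i j h => h.symm) (by
      by_contra! h
      have h1 : P.seq (P.height - 1) = ⊥ := ext_rel fun i j => by
        rw [rel_bot]
        refine ⟨fun hr => ?_, fun hr => hr ▸ Rel.refl _ _⟩
        by_contra hij
        exact h i j hij hr
      rw [P.seq_eq_bot_iff] at h1
      have := P.height_pos hN
      omega)
  refine ⟨p, le_antisymm (P.relCount_le _ _) ?_⟩
  rwa [P.rel_seq_iff p.2.ne] at hp

/-- Since (q)_c = q (q-1)_{c-1} for c ≥ 1, each part yields one factor q, and the remaining factors
form the multiplicity. -/
theorem prod_descFactorial_eq {q : ℕ} (hq : 2 ≤ q)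
    {P Q : Finpartition (Finset.univ : Finset (Fin N))} (h : Q ≤ P) :
    ∏ t ∈ P.parts, q.descFactorial (Q.childCount t) = q ^ P.parts.card * splitFactor q P Q := by
  rw [splitFactor, ← Finset.prod_const, ← Finset.prod_mul_distrib]
  refine Finset.prod_congr rfl fun t ht => ?_
  have h1 := one_le_childCount h ht
  obtain ⟨c, hc⟩ : ∃ c, Q.childCount t = c + 1 := ⟨Q.childCount t - 1, by omega⟩
  obtain ⟨r, rfl⟩ : ∃ r, q = r + 1 := ⟨q - 1, by omega⟩
  rw [hc, Nat.succ_descFactorial_succ]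
  simp

theorem card_parts_top (hN : 2 ≤ N) :
    (⊤ : Finpartition (Finset.univ : Finset (Fin N))).parts.card = 1 := by
  refine le_antisymm ?_ ?_
  · exact (Finset.card_le_card (parts_top_subset _)).trans (Finset.card_singleton _).le
  · exact Finset.card_pos.2 ⟨_, part_mem_parts _ ⟨0, by omega⟩⟩

theorem weight_eq (hN : 2 ≤ N) {q : ℕ} (hq : 2 ≤ q) (b : ℂ) (s : Pairs N → ℂ) :
    P.weight q b s = P.multiplicity q * (q : ℂ) ^ (-((N : ℂ) - 1) -
      ∑ l ∈ Finset.range (P.height - 1), ((N : ℂ) - (P.seq (l + 1)).parts.card) -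
      ((P.height : ℂ) - 1) * b - ∑ p : Pairs N, (P.relCount p.1.1 p.1.2 : ℂ) * s p) := by
  classical
  have hq0 : (q : ℂ) ≠ 0 := by exact_mod_cast (by omega : q ≠ 0)
  have hh := P.height_pos hN
  have h1 : ∑ l ∈ Finset.range (P.height - 1), (-(b + (P.seq (1 + l)).exponent s)) =
      - ∑ l ∈ Finset.range (P.height - 1), ((N : ℂ) - (P.seq (l + 1)).parts.card) -
      ((P.height : ℂ) - 1) * b - ∑ p : Pairs N, (P.relCount p.1.1 p.1.2 : ℂ) * s p := by
    have h2 : ∑ p : Pairs N, (P.relCount p.1.1 p.1.2 : ℂ) * s p =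
        ∑ l ∈ Finset.range (P.height - 1), ∑ p : Pairs N with (P.seq (l + 1)).Rel p.1.1 p.1.2, s p := by
      simp only [Finset.sum_filter]
      rw [Finset.sum_comm]
      refine Finset.sum_congr rfl fun p _ => ?_
      rw [← Finset.sum_filter, Finset.sum_const, nsmul_eq_mul, relCount]
    have h3 : ((P.height : ℂ) - 1) * b = ∑ l ∈ Finset.range (P.height - 1), b := by
      rw [Finset.sum_const, Finset.card_range, nsmul_eq_mul, Nat.cast_sub hh, Nat.cast_one]
    rw [h2, h3, ← Finset.sum_neg_distrib, ← Finset.sum_sub_distrib, ← Finset.sum_sub_distrib]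
    refine Finset.sum_congr rfl fun l _ => ?_
    rw [Finpartition.exponent_eq, add_comm 1 l]
    ring
  rw [weight, Finset.prod_Ico_eq_prod_range, ← Complex.cpow_finset_sum hq0, h1, div_mul_eq_mul_div,
    mul_div_assoc]
  congr 1
  rw [div_eq_iff (pow_ne_zero _ hq0), ← Complex.cpow_natCast, ← Complex.cpow_add _ _ hq0,
    Nat.cast_sub (by omega), Nat.cast_one]
  congr 1
  ring

end SplitSequence

/-! ### Cells and their measures -/

namespace PField

open Finpartition
open scoped NNReal ENNReal Pointwise

variable {K : Type*} [Field K] [ValuativeRel K] [TopologicalSpace K] [IsNonarchimedeanLocalField K]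
  [MeasurableSpace K] [BorelSpace K] {N : ℕ}

omit [MeasurableSpace K] [BorelSpace K] in
theorem residueCard_zpow_strictMono : StrictMono fun m : ℤ => (residueCard K : ℝ) ^ m :=
  zpow_right_strictMono₀ (by exact_mod_cast one_lt_residueCard (K := K))

theorem abs_lt_zpow_iff {x : K} {m : ℤ} :
    abs x < (residueCard K : ℝ) ^ m ↔ abs x ≤ (residueCard K : ℝ) ^ (m - 1) := by
  constructor
  · intro h
    by_cases hx : x = 0
    · rw [abs_eq_zero_iff.2 hx]
      positivity
    obtain ⟨n, hn⟩ := exists_abs_eq_zpow hx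
    rw [hn] at h ⊢
    have := residueCard_zpow_strictMono.lt_iff_lt.1 h
    exact residueCard_zpow_strictMono.monotone (by omega)
  · exact fun h => h.trans_lt (residueCard_zpow_strictMono (by omega))

theorem abs_eq_zpow_iff_le {x : K} {m : ℤ} : abs x = (residueCard K : ℝ) ^ m ↔
    abs x ≤ (residueCard K : ℝ) ^ m ∧ ¬ abs x ≤ (residueCard K : ℝ) ^ (m - 1) := by
  rw [← abs_lt_zpow_iff, not_lt, le_antisymm_iff]

theorem norm_le_iff (hN : 2 ≤ N) {x : Fin N → K} {r : ℝ} : norm x ≤ r ↔ ∀ i, abs (x i) ≤ r := by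
  have : Nonempty (Fin N) := ⟨⟨0, by omega⟩⟩
  exact ciSup_le_iff (Set.finite_range _).bddAbove

theorem norm_eq_zpow_iff (hN : 2 ≤ N) {x : Fin N → K} {m : ℤ} : norm x = (residueCard K : ℝ) ^ m ↔
    (∀ i, abs (x i) ≤ (residueCard K : ℝ) ^ m) ∧
      ¬ ∀ i, abs (x i) ≤ (residueCard K : ℝ) ^ (m - 1) := by
  have : Nonempty (Fin N) := ⟨⟨0, by omega⟩⟩
  rw [← norm_le_iff hN, ← norm_le_iff hN]
  obtain ⟨i, hi⟩ := exists_eq_ciSup_of_finite (f := fun i => abs (x i))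
  rw [norm, ← hi]
  exact abs_eq_zpow_iff_le

variable (K) in
/-- The vectors with `‖x‖ = q^m` whose distances `q^{m-k}, q^{m-k-1}, …` induce the partitions of
the split sequence `P`. -/
def cell (m : ℤ) (k : ℕ) (P : SplitSequence N) : Set (Fin N → K) :=
  {x | norm x = (residueCard K : ℝ) ^ m ∧ ∀ i j (l : ℕ),
    abs (x i - x j) ≤ (residueCard K : ℝ) ^ (m - k - l) ↔ (P.seq l).Rel i j}

variable (K) in
/-- The vectors with `‖x‖ ≤ q^m` whose distances `q^{m-k}, q^{m-k-1}, …` induce the partitions of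
the split sequence `P`. -/
def ballCell (m : ℤ) (k : ℕ) (P : SplitSequence N) : Set (Fin N → K) :=
  {x | (∀ i, abs (x i) ≤ (residueCard K : ℝ) ^ m) ∧ ∀ i j (l : ℕ),
    abs (x i - x j) ≤ (residueCard K : ℝ) ^ (m - k - l) ↔ (P.seq l).Rel i j}

/-- Scaling by π^m moves the ball to R^N. All points are together down to radius q^{-k}; the
truncated subtraction l - k encodes this by repeating P_0 = ⊤. -/
theorem ballCell_eq (m : ℤ) (k : ℕ) (P : SplitSequence N) :
    ballCell K m k P = unifUnit K ^ (-m) • filtrationSet K fun l => P.seq (l - k) := by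
  ext x
  have h0 : ∀ i, (unifUnit K ^ m • x) i = unif K ^ m * x i := fun i => by
    rw [Pi.smul_apply, Units.smul_def, smul_eq_mul, Units.val_zpow_eq_zpow_val]
    rfl
  rw [Set.mem_smul_set_iff_inv_smul_mem, zpow_neg, inv_inv]
  simp only [ballCell, filtrationSet, Set.mem_ofPred_eq, h0, ← mul_sub, abs_unif_zpow_mul_le,
    zero_add, Nat.zero_sub, P.zero]
  refine and_congr_right fun _ => forall_congr' fun i => forall_congr' fun j => ?_
  constructor
  · intro h _ l
    rcases le_total l k with hl | hl
    · rw [Nat.sub_eq_zero_of_le hl, P.zero]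
      refine iff_of_true (((h 0).2 (P.zero ▸ rel_top)).trans
        (residueCard_zpow_strictMono.monotone ?_)) rel_top
      omega
    · rw [← h (l - k)]
      have : m - k - ((l - k : ℕ) : ℤ) = -(l : ℤ) + m := by omega
      rw [this]
  · intro h l
    have h1 := h rel_top (l + k)
    rw [Nat.add_sub_cancel] at h1
    rw [← h1]
    have : m - k - (l : ℤ) = -((l + k : ℕ) : ℤ) + m := by omega
    rw [this]

/-- By the ultrametric inequality a smaller norm would bound all distances by q^{m-1}, so the
condition on the norm is automatic. -/
theorem cell_zero (hN : 2 ≤ N) (m : ℤ) (P : SplitSequence N) : cell K m 0 P = ballCell K m 0 P := by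
  ext x
  simp only [cell, ballCell, Set.mem_ofPred_eq, norm_eq_zpow_iff hN]
  refine and_congr_left fun h => and_iff_left fun h1 => ?_
  refine P.one (ext_rel fun i j => ⟨fun _ => rel_top, fun _ => ?_⟩)
  rw [← h]
  have : m - (0 : ℕ) - (1 : ℕ) = m - 1 := by omega
  rw [this, sub_eq_add_neg (x i)]
  exact abs_add_le_zpow (h1 i) (by rw [abs_neg]; exact h1 j)

theorem cell_succ (hN : 2 ≤ N) (m : ℤ) (k : ℕ) (P : SplitSequence N) :
    cell K m (k + 1) P = ballCell K m (k + 1) P \ ballCell K (m - 1) k P := by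
  ext x
  have : ∀ l : ℕ, m - 1 - (k : ℤ) - l = m - ((k + 1 : ℕ) : ℤ) - l := fun l => by omega
  simp only [cell, ballCell, Set.mem_sdiff, Set.mem_ofPred_eq, norm_eq_zpow_iff hN, this]
  tauto

theorem ballCell_subset (m : ℤ) (k : ℕ) (P : SplitSequence N) :
    ballCell K (m - 1) k P ⊆ ballCell K m (k + 1) P := by
  intro x hx
  have : ∀ l : ℕ, m - 1 - (k : ℤ) - l = m - ((k + 1 : ℕ) : ℤ) - l := fun l => by omega
  simp only [ballCell, Set.mem_ofPred_eq, this] at hx ⊢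
  exact ⟨fun i => (hx.1 i).trans (residueCard_zpow_strictMono.monotone (by omega)), hx.2⟩

theorem measurableSet_ballCell (m : ℤ) (k : ℕ) (P : SplitSequence N) :
    MeasurableSet (ballCell K m k P) := by
  rw [ballCell_eq]
  exact (measurableSet_filtrationSet _).const_smul _

theorem measurableSet_cell (hN : 2 ≤ N) (m : ℤ) (k : ℕ) (P : SplitSequence N) :
    MeasurableSet (cell K m k P) := by
  rcases k with _ | k
  · rw [cell_zero hN]
    exact measurableSet_ballCell _ _ _
  · rw [cell_succ hN]
    exact (measurableSet_ballCell _ _ _).diff (measurableSet_ballCell _ _ _)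

/-- Each initial step at which nothing splits forces all residues to agree: q choices out of q^N, a
factor q^{1-N}. -/
theorem piHaar_filtrationSet_shift (hN : 2 ≤ N) (k : ℕ) (P : SplitSequence N) :
    piHaar K N (filtrationSet K fun l => P.seq (l - k)) =
      (((residueCard K : ℝ≥0) ^ (k * (1 - N : ℤ)) * ((residueCard K : ℝ≥0) ^ (1 - N : ℤ) *
        ∏ l ∈ Finset.range (P.height - 1), (residueCard K : ℝ≥0) ^
          (((P.seq (l + 1)).parts.card : ℤ) - N)) * P.multiplicity (residueCard K) : ℝ≥0) :
            ℝ≥0∞) := by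
  have hq := two_le_residueCard (K := K)
  have hq0 : (residueCard K : ℝ≥0) ≠ 0 := (one_pos.trans one_lt_residueCard).ne'
  induction k with
  | zero =>
    simp only [Nat.sub_zero, Nat.cast_zero, zero_mul, zpow_zero, one_mul]
    rw [piHaar_filtrationSet P.anti P.seq_height]
    congr 1
    have h1 : ∀ k, (residueCard K : ℝ≥0) ^ (-(N : ℤ)) *
        ((∏ t ∈ (P.seq k).parts, (residueCard K).descFactorial ((P.seq (k + 1)).childCount t) : ℕ) :
          ℝ≥0) = (residueCard K : ℝ≥0) ^ (((P.seq k).parts.card : ℤ) - N) *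
          (splitFactor (residueCard K) (P.seq k) (P.seq (k + 1)) : ℝ≥0) := fun k => by
      rw [SplitSequence.prod_descFactorial_eq hq (P.anti (Nat.le_succ k)), sub_eq_add_neg,
        zpow_add₀ hq0, zpow_natCast]
      push_cast
      ring
    simp only [h1]
    rw [Finset.prod_mul_distrib, SplitSequence.multiplicity, Nat.cast_prod]
    congr 1
    obtain ⟨h, hh⟩ : ∃ h, P.height = h + 1 := ⟨P.height - 1, by
      have := P.height_pos hN
      omega⟩
    rw [hh, Finset.prod_range_succ', Nat.add_sub_cancel, mul_comm, P.zero,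
      SplitSequence.card_parts_top hN]
    rfl
  | succ k ih =>
    have hanti : Antitone fun l => P.seq (l - (k + 1)) := fun a b h => P.anti (by omega)
    rw [piHaar_filtrationSet_succ hanti]
    have h1 : (fun l => P.seq (l + 1 - (k + 1))) = fun l => P.seq (l - k) := by
      funext l
      congr 1
      omega
    rw [h1, ih, ← ENNReal.coe_mul]
    congr 1
    have h2 : P.seq (0 - (k + 1)) = ⊤ := by rw [Nat.zero_sub, P.zero]
    have h3 : P.seq (1 - (k + 1)) = ⊤ := by
      rw [Nat.sub_eq_zero_of_le (by omega), P.zero]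
    rw [h2, h3, SplitSequence.prod_descFactorial_eq hq le_rfl, splitFactor_self,
      SplitSequence.card_parts_top hN]
    have h4 : ((k + 1 : ℕ) : ℤ) * (1 - (N : ℤ)) = k * (1 - (N : ℤ)) + (1 + -(N : ℤ)) := by
      push_cast
      ring
    rw [h4, zpow_add₀ hq0, zpow_add₀ hq0 1, zpow_one]
    push_cast
    ring

/-- The density of the vectors with `‖x‖ = q^m` and largest distance `q^{m-k}` among the vectors
with `‖x‖ ≤ q^m` and largest distance `q^{m-k}`. -/
def rootDensity (q : ℕ) (k : ℕ) : ℝ := if k = 0 then 1 else 1 - (q : ℝ)⁻¹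

theorem piHaar_real_ballCell (hN : 2 ≤ N) (m : ℤ) (k : ℕ) (P : SplitSequence N) :
    (piHaar K N).real (ballCell K m k P) =
      (residueCard K : ℝ) ^ (m * N) * ((residueCard K : ℝ) ^ (k * (1 - N : ℤ)) *
        ((residueCard K : ℝ) ^ (1 - N : ℤ) * ∏ l ∈ Finset.range (P.height - 1),
          (residueCard K : ℝ) ^ (((P.seq (l + 1)).parts.card : ℤ) - N)) *
            P.multiplicity (residueCard K)) := by
  rw [measureReal_def, ballCell_eq, piHaar_unifUnit_zpow_smul, piHaar_filtrationSet_shift hN,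
    ← ENNReal.coe_mul, ENNReal.coe_toReal, neg_neg]
  push_cast
  rfl

theorem piHaar_ballCell_ne_top (hN : 2 ≤ N) (m : ℤ) (k : ℕ) (P : SplitSequence N) :
    piHaar K N (ballCell K m k P) ≠ ∞ := by
  rw [ballCell_eq, piHaar_unifUnit_zpow_smul, piHaar_filtrationSet_shift hN, ← ENNReal.coe_mul]
  exact ENNReal.coe_ne_top

theorem piHaar_cell_ne_top (hN : 2 ≤ N) (m : ℤ) (k : ℕ) (P : SplitSequence N) :
    piHaar K N (cell K m k P) ≠ ∞ := by
  refine ne_top_of_le_ne_top (piHaar_ballCell_ne_top hN m k P) (measure_mono ?_)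
  rcases k with _ | k
  · rw [cell_zero hN]
  · rw [cell_succ hN]
    exact Set.sdiff_subset

theorem piHaar_real_cell (hN : 2 ≤ N) (m : ℤ) (k : ℕ) (P : SplitSequence N) :
    (piHaar K N).real (cell K m k P) = rootDensity (residueCard K) k *
      ((residueCard K : ℝ) ^ (m * N) * ((residueCard K : ℝ) ^ (k * (1 - N : ℤ)) *
        ((residueCard K : ℝ) ^ (1 - N : ℤ) * ∏ l ∈ Finset.range (P.height - 1),
          (residueCard K : ℝ) ^ (((P.seq (l + 1)).parts.card : ℤ) - N)) *
            P.multiplicity (residueCard K))) := by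
  rcases k with _ | k
  · rw [cell_zero hN, piHaar_real_ballCell hN, rootDensity, if_pos rfl, one_mul]
  · rw [cell_succ hN, measureReal_sdiff (ballCell_subset m k P) (measurableSet_ballCell _ _ _)
      (piHaar_ballCell_ne_top hN _ _ _), piHaar_real_ballCell hN, piHaar_real_ballCell hN,
      rootDensity, if_neg (Nat.succ_ne_zero k)]
    have hq0 : (residueCard K : ℝ) ≠ 0 := by
      have := two_le_residueCard (K := K)
      exact_mod_cast (by omega : residueCard K ≠ 0)
    -- Passing to the smaller ball lowers m and k by one, which costs q^{-N} q^{N-1} = q^{-1}; hence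
    -- the density 1 - 1/q.
    have h1 : (residueCard K : ℝ) ^ ((m - 1) * N) * (residueCard K : ℝ) ^ (k * (1 - N : ℤ)) =
        (residueCard K : ℝ)⁻¹ * ((residueCard K : ℝ) ^ (m * N) *
          (residueCard K : ℝ) ^ (((k + 1 : ℕ) : ℤ) * (1 - N : ℤ))) := by
      rw [← zpow_neg_one, ← zpow_add₀ hq0, ← zpow_add₀ hq0, ← zpow_add₀ hq0]
      congr 1
      push_cast
      ring
    linear_combination (-((residueCard K : ℝ) ^ (1 - N : ℤ) *
      (∏ l ∈ Finset.range (P.height - 1),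
          (residueCard K : ℝ) ^ (((P.seq (l + 1)).parts.card : ℤ) - N)) *
            P.multiplicity (residueCard K))) * h1

end PField

/-! ### The integral as a sum over cells -/

theorem natCast_zpow_cpow {q : ℕ} (hq : 2 ≤ q) (n : ℤ) (w : ℂ) :
    (((q : ℝ) ^ n : ℝ) : ℂ) ^ w = (q : ℂ) ^ ((n : ℂ) * w) := by
  have hq0 : (0 : ℝ) < q := by exact_mod_cast (by omega : 0 < q)
  have h1 : (((q : ℝ) ^ n : ℝ) : ℂ) ≠ 0 := by
    rw [Ne, Complex.ofReal_eq_zero]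
    positivity
  have h2 : (q : ℂ) ≠ 0 := by exact_mod_cast (by omega : q ≠ 0)
  rw [Complex.cpow_def_of_ne_zero h1, Complex.cpow_def_of_ne_zero h2,
    ← Complex.ofReal_log (by positivity), Real.log_zpow, ← Complex.natCast_log]
  push_cast
  congr 1
  ring

namespace PField

open Finpartition
open scoped NNReal ENNReal Pointwise

variable {K : Type*} [Field K] [ValuativeRel K] [TopologicalSpace K] [IsNonarchimedeanLocalField K]
  [MeasurableSpace K] [BorelSpace K] {N : ℕ}

theorem dist_eq_of_mem_cell {m : ℤ} {k : ℕ} {P : SplitSequence N} {x : Fin N → K}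
    (hx : x ∈ cell K m k P) (p : Pairs N) :
    dist x p = (residueCard K : ℝ) ^ (m - k - P.relCount p.1.1 p.1.2) := by
  refine abs_eq_zpow_iff_le.2 ⟨?_, ?_⟩
  · exact (hx.2 _ _ _).2 ((P.rel_seq_iff p.2.ne _).2 le_rfl)
  · have h := hx.2 p.1.1 p.1.2 (P.relCount p.1.1 p.1.2 + 1)
    have e : m - k - ((P.relCount p.1.1 p.1.2 + 1 : ℕ) : ℤ) = m - k - P.relCount p.1.1 p.1.2 - 1 := by
      omega
    rw [e, P.rel_seq_iff p.2.ne] at h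
    rw [h]
    omega

theorem maxDist_eq_of_mem_cell {m : ℤ} {k : ℕ} {P : SplitSequence N} {x : Fin N → K}
    (hx : x ∈ cell K m k P) : maxDist x = (residueCard K : ℝ) ^ (m - k) := by
  obtain ⟨p, hp⟩ := P.exists_relCount_eq_zero
  have : Nonempty (Pairs N) := ⟨p⟩
  refine le_antisymm (ciSup_le fun p => ?_) ?_
  · rw [dist_eq_of_mem_cell hx]
    exact residueCard_zpow_strictMono.monotone (by omega)
  · refine le_trans (le_of_eq ?_) (le_ciSup (Set.finite_range (dist x)).bddAbove p)
    rw [dist_eq_of_mem_cell hx, hp, Nat.cast_zero, sub_zero]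

theorem minDist_eq_of_mem_cell (hN : 2 ≤ N) {m : ℤ} {k : ℕ} {P : SplitSequence N} {x : Fin N → K}
    (hx : x ∈ cell K m k P) : minDist x = (residueCard K : ℝ) ^ (m - k - (P.height - 1 : ℕ)) := by
  obtain ⟨p, hp⟩ := P.exists_relCount_eq_height hN
  have : Nonempty (Pairs N) := ⟨p⟩
  refine le_antisymm ?_ (le_ciInf fun p => ?_)
  · refine (ciInf_le (Set.finite_range (dist x)).bddBelow p).trans (le_of_eq ?_)
    rw [dist_eq_of_mem_cell hx, hp]
  · rw [dist_eq_of_mem_cell hx]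
    have := P.relCount_le p.1.1 p.1.2
    exact residueCard_zpow_strictMono.monotone (by omega)

/-- The value of the integrand on a cell. -/
def cellValue (q : ℕ) (ρ : ℝ → ℂ) (a b : ℂ) (s : Pairs N → ℂ) (m : ℤ) (k : ℕ)
    (P : SplitSequence N) : ℂ :=
  ρ ((q : ℝ) ^ m) * (q : ℂ) ^ (((m : ℂ) - k) * a + ((m : ℂ) - k - ((P.height : ℂ) - 1)) * b +
    ∑ p : Pairs N, ((m : ℂ) - k - P.relCount p.1.1 p.1.2) * s p)

theorem integrand_eq_of_mem_cell (hN : 2 ≤ N) (ρ : ℝ → ℂ) (a b : ℂ) (s : Pairs N → ℂ) {m : ℤ} {k : ℕ}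
    {P : SplitSequence N} {x : Fin N → K} (hx : x ∈ cell K m k P) :
    integrand ρ a b s x = cellValue (residueCard K) ρ a b s m k P := by
  have hq := two_le_residueCard (K := K)
  have hq0 : (residueCard K : ℂ) ≠ 0 := by exact_mod_cast (by omega : residueCard K ≠ 0)
  rw [integrand, maxDist_eq_of_mem_cell hx, minDist_eq_of_mem_cell hN hx, hx.1]
  simp only [dist_eq_of_mem_cell hx, natCast_zpow_cpow hq]
  rw [← Complex.cpow_finset_sum hq0, mul_assoc, mul_assoc, ← Complex.cpow_add _ _ hq0,
    ← Complex.cpow_add _ _ hq0, cellValue]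
  congr 2
  rw [Nat.cast_sub (P.height_pos hN)]
  push_cast
  ring

/-- The contribution of a cell to the integral. -/
def cellTerm (q : ℕ) (ρ : ℝ → ℂ) (a b : ℂ) (s : Pairs N → ℂ) (x : ℤ × ℕ × SplitSequence N) : ℂ :=
  rootTerm q ρ (N + a + b + ∑ p, s p) x.1 *
    ((rootDensity q x.2.1 : ℂ) * (q : ℂ) ^ (-((x.2.1 : ℂ) * (N + a + b + ∑ p, s p - 1))) *
      x.2.2.weight q b s)

/-- The measure supplies q^{mN - k(N-1)} and the integrand, at scale q^{m-k}, supplies the exponent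
(m-k)(a + b + Σ s). Together these give mz - k(z-1); what depends on P is its weight in the form of
`weight_eq`. -/
theorem piHaar_real_cell_mul_cellValue (hN : 2 ≤ N) (ρ : ℝ → ℂ) (a b : ℂ) (s : Pairs N → ℂ) (m : ℤ)
    (k : ℕ) (P : SplitSequence N) :
    ((piHaar K N).real (cell K m k P) : ℂ) * cellValue (residueCard K) ρ a b s m k P =
      cellTerm (residueCard K) ρ a b s (m, k, P) := by
  have hq := two_le_residueCard (K := K)
  have hq0 : (residueCard K : ℂ) ≠ 0 := by exact_mod_cast (by omega : residueCard K ≠ 0)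
  rw [piHaar_real_cell hN, cellTerm, cellValue, rootTerm, P.weight_eq hN hq]
  push_cast
  simp only [← Complex.cpow_intCast]
  rw [← Complex.cpow_finset_sum hq0]
  have h1 : ∀ A B C D E F G M X : ℂ, A + B + (C + D) + E = F + (G + X) →
      (rootDensity (residueCard K) k : ℂ) * ((residueCard K : ℂ) ^ A * ((residueCard K : ℂ) ^ B *
        ((residueCard K : ℂ) ^ C * (residueCard K : ℂ) ^ D) * M)) *
        (ρ ((residueCard K : ℝ) ^ m) * (residueCard K : ℂ) ^ E) =
      ρ ((residueCard K : ℝ) ^ m) * (residueCard K : ℂ) ^ F *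
        ((rootDensity (residueCard K) k : ℂ) * (residueCard K : ℂ) ^ G *
          (M * (residueCard K : ℂ) ^ X)) := by
    intro A B C D E F G M X h
    have h2 : (residueCard K : ℂ) ^ A * (residueCard K : ℂ) ^ B * ((residueCard K : ℂ) ^ C *
        (residueCard K : ℂ) ^ D) * (residueCard K : ℂ) ^ E = (residueCard K : ℂ) ^ F *
          ((residueCard K : ℂ) ^ G * (residueCard K : ℂ) ^ X) := by
      simp only [← Complex.cpow_add _ _ hq0, h]
    linear_combination (rootDensity (residueCard K) k : ℂ) * ρ ((residueCard K : ℝ) ^ m) * M * h2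
  refine h1 _ _ _ _ _ _ _ _ _ ?_
  simp only [sub_mul, Finset.sum_sub_distrib, ← Finset.mul_sum]
  push_cast
  simp only [Finset.sum_sub_distrib]
  ring

instance : Countable (ℤ × ℕ × SplitSequence N) := by
  by_cases hN : 2 ≤ N
  · have := (SplittingFiltration.sequenceEquiv hN).symm.injective.countable
    infer_instance
  · have : IsEmpty (SplitSequence N) := ⟨fun P => by
      obtain ⟨p, -⟩ := P.exists_relCount_eq_zero
      have h1 := p.1.1.2
      have h2 := p.1.2.2
      have h3 : (p.1.1 : ℕ) < p.1.2 := p.2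
      omega⟩
    infer_instance

theorem cell_disjoint : Pairwise (Function.onFun Disjoint
    fun x : ℤ × ℕ × SplitSequence N => cell K x.1 x.2.1 x.2.2) := by
  rintro ⟨m, k, P⟩ ⟨m', k', P'⟩ hne
  refine Set.disjoint_left.2 fun x hx hx' => hne ?_
  have hm : m = m' := residueCard_zpow_strictMono.injective (hx.1.symm.trans hx'.1)
  subst hm
  have hk : m - (k : ℤ) = m - k' := residueCard_zpow_strictMono.injective
    ((maxDist_eq_of_mem_cell hx).symm.trans (maxDist_eq_of_mem_cell hx'))
  have hk' : k = k' := by omega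
  subst hk'
  have : P = P' := SplitSequence.ext (funext fun l => ext_rel fun i j => by
    rw [← hx.2, ← hx'.2])
  rw [this]

/-- The norm fixes m, the largest distance q^{d p₀} fixes k = m - d p₀, and closeness within q^{d p₀
- l} fixes P_l. The ultrametric inequality gives k ≥ 0 and transitivity. -/
theorem exists_mem_cell (hN : 2 ≤ N) {x : Fin N → K} (hx : Function.Injective x) :
    ∃ y : ℤ × ℕ × SplitSequence N, x ∈ cell K y.1 y.2.1 y.2.2 := by
  classical
  have : Nonempty (Fin N) := ⟨⟨0, by omega⟩⟩
  have : Nonempty (Pairs N) := ⟨⟨(⟨0, by omega⟩, ⟨1, by omega⟩), by simp⟩⟩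
  have hd : ∀ p : Pairs N, ∃ n : ℤ, dist x p = (residueCard K : ℝ) ^ n := fun p =>
    exists_abs_eq_zpow (sub_ne_zero.2 fun h => p.2.ne (hx h))
  choose d hd using hd
  obtain ⟨p₀, hp₀⟩ := Finite.exists_max d
  obtain ⟨p₁, hp₁⟩ := Finite.exists_min d
  have hdist : ∀ (i j : Fin N) (n : ℤ), d p₀ ≤ n → abs (x i - x j) ≤ (residueCard K : ℝ) ^ n :=
    fun i j n hn => by
      have key : ∀ p : Pairs N, dist x p ≤ (residueCard K : ℝ) ^ n := fun p => by
        rw [hd]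
        exact residueCard_zpow_strictMono.monotone ((hp₀ p).trans hn)
      rcases lt_trichotomy i j with h | h | h
      · exact key ⟨(i, j), h⟩
      · rw [h, sub_self, abs_eq_zero_iff.2 rfl]
        positivity
      · rw [abs_sub_comm]
        exact key ⟨(j, i), h⟩
  obtain ⟨i₀, hi₀⟩ := exists_eq_ciSup_of_finite (f := fun i => abs (x i))
  have hi₀' : norm x = abs (x i₀) := hi₀.symm
  have hne : x i₀ ≠ 0 := by
    intro h
    have h1 : ∀ i, x i = 0 := fun i => by
      have h2 : abs (x i) ≤ norm x := le_ciSup (Set.finite_range fun i => abs (x i)).bddAbove i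
      rw [hi₀', h, abs_eq_zero_iff.2 rfl] at h2
      exact abs_eq_zero_iff.1 (le_antisymm h2 (abs_nonneg _))
    exact p₀.2.ne (hx ((h1 _).trans (h1 _).symm))
  obtain ⟨m, hm⟩ := exists_abs_eq_zpow hne
  have hnorm : norm x = (residueCard K : ℝ) ^ m := hi₀'.trans hm
  have hle : d p₀ ≤ m := by
    have h1 := (norm_le_iff hN).1 hnorm.le
    have h2 : dist x p₀ ≤ (residueCard K : ℝ) ^ m := by
      rw [dist, sub_eq_add_neg]
      exact abs_add_le_zpow (h1 _) (by rw [abs_neg]; exact h1 _)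
    rw [hd] at h2
    exact residueCard_zpow_strictMono.le_iff_le.1 h2
  let P : SplitSequence N :=
    { seq := fun l => Finpartition.ofSetoid
        { r := fun i j => abs (x i - x j) ≤ (residueCard K : ℝ) ^ (d p₀ - l)
          iseqv :=
            { refl := fun i => by
                rw [sub_self, abs_eq_zero_iff.2 rfl]
                positivity
              symm := fun {i j} h => by rwa [abs_sub_comm]
              trans := fun {i j k} h1 h2 => by
                rw [← sub_add_sub_cancel (x i) (x j) (x k)]
                exact abs_add_le_zpow h1 h2 } }
      anti := fun k l hkl => by
        refine le_iff_rel.2 fun i j h => ?_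
        rw [rel_iff_mem_part, mem_part_ofSetoid_iff_rel] at h ⊢
        exact h.trans (residueCard_zpow_strictMono.monotone (by omega))
      zero := by
        refine ext_rel fun i j => ⟨fun _ => rel_top, fun _ => ?_⟩
        rw [rel_iff_mem_part, mem_part_ofSetoid_iff_rel]
        exact hdist i j _ (by simp)
      one := fun h => by
        have h1 := h ▸ (rel_top (i := p₀.1.1) (j := p₀.1.2))
        rw [rel_iff_mem_part, mem_part_ofSetoid_iff_rel] at h1
        have h2 : dist x p₀ ≤ (residueCard K : ℝ) ^ (d p₀ - (1 : ℕ)) := h1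
        rw [hd] at h2
        have := residueCard_zpow_strictMono.le_iff_le.1 h2
        omega
      eventually_bot := by
        refine ⟨(d p₀ - d p₁ + 1).toNat, ext_rel fun i j => ?_⟩
        rw [rel_bot, rel_iff_mem_part, mem_part_ofSetoid_iff_rel]
        have key : ∀ p : Pairs N, ¬ dist x p ≤
            (residueCard K : ℝ) ^ (d p₀ - ((d p₀ - d p₁ + 1).toNat : ℤ)) := fun p h => by
          rw [hd] at h
          have h1 := residueCard_zpow_strictMono.le_iff_le.1 h
          have h2 := hp₁ p
          omega
        constructor
        · intro h
          change abs (x i - x j) ≤ _ at h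
          rcases lt_trichotomy i j with h1 | h1 | h1
          · exact absurd h (key ⟨(i, j), h1⟩)
          · exact h1
          · rw [abs_sub_comm] at h
            exact absurd h (key ⟨(j, i), h1⟩)
        · rintro rfl
          change abs (x i - x i) ≤ _
          rw [sub_self, abs_eq_zero_iff.2 rfl]
          positivity }
  refine ⟨(m, (m - d p₀).toNat, P), hnorm, fun i j l => ?_⟩
  have e : m - ((m - d p₀).toNat : ℤ) - l = d p₀ - l := by omega
  dsimp only
  rw [e, rel_iff_mem_part]
  refine Iff.symm ?_
  dsimp only [P]
  rw [mem_part_ofSetoid_iff_rel]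
  rfl

theorem ae_mem_iUnion_cell (hN : 2 ≤ N) : ∀ᵐ x ∂(piHaar K N),
    x ∈ ⋃ y : ℤ × ℕ × SplitSequence N, cell K y.1 y.2.1 y.2.2 := by
  have h : ∀ᵐ x ∂(piHaar K N), ∀ p : Pairs N, x p.1.1 ≠ x p.1.2 := by
    refine ae_all_iff.2 fun p => ?_
    rw [ae_iff]
    simpa using piHaar_diagonal_eq_zero K N p.2.ne
  filter_upwards [h] with x hx
  refine Set.mem_iUnion.2 (exists_mem_cell hN fun i j hij => ?_)
  rcases lt_trichotomy i j with h1 | h1 | h1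
  · exact absurd hij (hx ⟨(i, j), h1⟩)
  · exact h1
  · exact absurd hij.symm (hx ⟨(j, i), h1⟩)

theorem setIntegral_cell (hN : 2 ≤ N) (ρ : ℝ → ℂ) (a b : ℂ) (s : Pairs N → ℂ)
    (y : ℤ × ℕ × SplitSequence N) :
    ∫ x in cell K y.1 y.2.1 y.2.2, integrand ρ a b s x ∂(piHaar K N) =
      cellTerm (residueCard K) ρ a b s y := by
  rw [setIntegral_congr_fun (measurableSet_cell hN _ _ _)
    (fun x hx => integrand_eq_of_mem_cell hN ρ a b s hx), setIntegral_const, Complex.real_smul,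
    piHaar_real_cell_mul_cellValue hN]

theorem setIntegral_norm_cell (hN : 2 ≤ N) (ρ : ℝ → ℂ) (a b : ℂ) (s : Pairs N → ℂ)
    (y : ℤ × ℕ × SplitSequence N) :
    ∫ x in cell K y.1 y.2.1 y.2.2, ‖integrand ρ a b s x‖ ∂(piHaar K N) =
      ‖cellTerm (residueCard K) ρ a b s y‖ := by
  rw [setIntegral_congr_fun (g := fun _ => ‖cellValue (residueCard K) ρ a b s y.1 y.2.1 y.2.2‖)
    (measurableSet_cell hN _ _ _)
    (fun x hx => by simp only [integrand_eq_of_mem_cell hN ρ a b s hx]), setIntegral_const, smul_eq_mul,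
    ← piHaar_real_cell_mul_cellValue hN, norm_mul, Complex.norm_real,
    Real.norm_of_nonneg measureReal_nonneg]

/-- The integrand is constant on cells of finite measure that cover almost everything. No growth
condition enters, so the equivalence also serves the maximality of Ω. -/
theorem zConverges_iff (hN : 2 ≤ N) (ρ : ℝ → ℂ) (a b : ℂ) (s : Pairs N → ℂ) :
    ZConverges K ρ a b s ↔ Summable (cellTerm (residueCard K) ρ a b s) := by
  have hrestrict := Measure.restrict_eq_self_of_ae_mem (ae_mem_iUnion_cell (K := K) hN)
  have hon : ZConverges K ρ a b s ↔ IntegrableOn (fun x : Fin N → K => integrand ρ a b s x)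
      (⋃ y : ℤ × ℕ × SplitSequence N, cell K y.1 y.2.1 y.2.2) (piHaar K N) := by
    rw [IntegrableOn, hrestrict]
    rfl
  rw [hon, ← summable_norm_iff]
  constructor
  · intro h
    have h0 : IntegrableOn (fun x : Fin N → K => ‖integrand ρ a b s x‖)
      (⋃ y : ℤ × ℕ × SplitSequence N, cell K y.1 y.2.1 y.2.2) (piHaar K N) := h.norm
    have h1 := hasSum_integral_iUnion (f := fun x : Fin N → K => ‖integrand ρ a b s x‖)
      (s := fun y : ℤ × ℕ × SplitSequence N => cell K y.1 y.2.1 y.2.2) (μ := piHaar K N)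
      (fun y => measurableSet_cell hN y.1 y.2.1 y.2.2) cell_disjoint h0
    simp only [setIntegral_norm_cell hN] at h1
    exact h1.summable
  · intro h
    refine integrableOn_iUnion_of_summable_integral_norm (fun y => ?_) ?_
    · refine (integrableOn_const (piHaar_cell_ne_top hN y.1 y.2.1 y.2.2)
        (C := cellValue (residueCard K) ρ a b s y.1 y.2.1 y.2.2)).congr_fun (fun x hx => ?_)
        (measurableSet_cell hN _ _ _)
      exact (integrand_eq_of_mem_cell hN ρ a b s hx).symm
    · simp only [setIntegral_norm_cell hN]
      exact h

theorem hasSum_Z (hN : 2 ≤ N) {ρ : ℝ → ℂ} {a b : ℂ} {s : Pairs N → ℂ}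
    (h : ZConverges K ρ a b s) : HasSum (cellTerm (residueCard K) ρ a b s) (Z K ρ a b s) := by
  have hrestrict := Measure.restrict_eq_self_of_ae_mem (ae_mem_iUnion_cell (K := K) hN)
  have h1 := hasSum_integral_iUnion (f := fun x : Fin N → K => integrand ρ a b s x)
    (s := fun y : ℤ × ℕ × SplitSequence N => cell K y.1 y.2.1 y.2.2) (μ := piHaar K N)
    (fun y => measurableSet_cell hN y.1 y.2.1 y.2.2) cell_disjoint (by rw [IntegrableOn, hrestrict]; exact h)
  rw [hrestrict] at h1
  simp only [setIntegral_cell hN] at h1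
  exact h1

end PField

/-! ### The growth condition and the root function -/

theorem norm_le_rpow_of_log_div_lt {z : ℂ} {n : ℕ} (hn : 2 ≤ n) {c : ℝ}
    (h : ENNReal.log ‖z‖ₑ / ((Real.log n : ℝ) : EReal) < (c : EReal)) : ‖z‖ ≤ (n : ℝ) ^ c := by
  have hlog : 0 < Real.log n := Real.log_pos (by exact_mod_cast hn)
  have hn0 : (0 : ℝ) < n := by exact_mod_cast (by omega : 0 < n)
  rw [EReal.div_lt_iff (by exact_mod_cast hlog) (EReal.coe_ne_top _)] at h
  rcases eq_or_ne z 0 with rfl | hz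
  · rw [norm_zero]
    positivity
  · rw [← ofReal_norm, ENNReal.log_ofReal_of_pos (norm_pos_iff.2 hz)] at h
    have h1 : Real.log ‖z‖ < c * Real.log n := by exact_mod_cast h
    rw [Real.rpow_def_of_pos hn0, ← Real.log_le_iff_le_exp (norm_pos_iff.2 hz), mul_comm]
    exact h1.le

theorem summable_rpow_neg_natCast_mul {q : ℕ} (hq : 2 ≤ q) {c : ℝ} (hc : 0 < c) :
    Summable fun n : ℕ => (q : ℝ) ^ (-(c * n)) := by
  have hq1 : (1 : ℝ) < q := by exact_mod_cast hq
  have h : Summable fun n : ℕ => ((q : ℝ) ^ (-c)) ^ n :=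
    summable_geometric_of_lt_one (by positivity) (Real.rpow_lt_one_of_one_lt_of_neg hq1 (by linarith))
  refine h.congr fun n => ?_
  rw [← Real.rpow_natCast, ← Real.rpow_mul (by positivity), neg_mul]

theorem GrowthCondition.summable {ρ : ℝ → ℂ} (hρ : GrowthCondition ρ) {q : ℕ} (hq : 2 ≤ q) {t : ℝ}
    (ht : 1 < t) : Summable fun m : ℤ => ‖ρ ((q : ℝ) ^ m)‖ * (q : ℝ) ^ ((m : ℝ) * t) := by
  have hq0 : (0 : ℝ) < q := by exact_mod_cast (by omega : 0 < q)
  have htop : Tendsto (fun n : ℕ => q ^ n) atTop atTop := tendsto_pow_atTop_atTop_of_one_lt hq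
  refine Summable.of_nat_of_neg ?_ ?_
  -- Growth is needed only along powers of q. The exponent -(t + 1) leaves the bound q^{-n}.
  · have h1 := htop.eventually (eventually_lt_of_limsup_lt
      (show _ < ((-(t + 1) : ℝ) : EReal) from hρ.2 ▸ EReal.bot_lt_coe _))
    refine Summable.of_norm_bounded_eventually_nat (summable_rpow_neg_natCast_mul hq one_pos) ?_
    filter_upwards [h1, eventually_ge_atTop 1] with n hn hn1
    have h2 := norm_le_rpow_of_log_div_lt
      (hq.trans (Nat.le_self_pow (by omega) q)) hn
    push_cast at h2
    rw [zpow_natCast, Real.norm_of_nonneg (by positivity)]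
    calc _ ≤ ((q : ℝ) ^ n) ^ (-(t + 1)) * (q : ℝ) ^ ((n : ℝ) * t) := by
          rw [Int.cast_natCast]
          gcongr
      _ = _ := by
        rw [← Real.rpow_natCast, ← Real.rpow_mul hq0.le, ← Real.rpow_add hq0]
        congr 1
        ring
  -- The exponent (1 + t)/2 lies strictly between 1 and t and leaves the bound q^{-n(t-1)/2}.
  · have h1 := htop.eventually (eventually_lt_of_limsup_lt
      (show _ < (((1 + t) / 2 : ℝ) : EReal) from hρ.1.trans_lt
        (by exact_mod_cast (by linarith : (1 : ℝ) < (1 + t) / 2))))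
    refine Summable.of_norm_bounded_eventually_nat
      (summable_rpow_neg_natCast_mul hq (by linarith : 0 < (t - 1) / 2)) ?_
    filter_upwards [h1, eventually_ge_atTop 1] with n hn hn1
    have h2 := norm_le_rpow_of_log_div_lt
      (hq.trans (Nat.le_self_pow (by omega) q)) hn
    push_cast at h2
    rw [zpow_neg, zpow_natCast, Real.norm_of_nonneg (by positivity), ← one_div]
    calc _ ≤ ((q : ℝ) ^ n) ^ ((1 + t) / 2) * (q : ℝ) ^ (((-(n : ℤ) : ℤ) : ℝ) * t) := by
          gcongr
      _ = _ := by
        rw [← Real.rpow_natCast, ← Real.rpow_mul hq0.le, ← Real.rpow_add hq0]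
        congr 1
        push_cast
        ring

theorem norm_rootTerm {q : ℕ} (hq : 2 ≤ q) (ρ : ℝ → ℂ) (z : ℂ) (m : ℤ) :
    ‖rootTerm q ρ z m‖ = ‖ρ ((q : ℝ) ^ m)‖ * (q : ℝ) ^ ((m : ℝ) * z.re) := by
  rw [rootTerm, norm_mul, Complex.norm_natCast_cpow_of_pos (by omega)]
  simp

theorem summable_norm_rootTerm {ρ : ℝ → ℂ} (hρ : GrowthCondition ρ) {q : ℕ} (hq : 2 ≤ q) {z : ℂ}
    (hz : 1 < z.re) : Summable fun m => ‖rootTerm q ρ z m‖ := by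
  simp only [norm_rootTerm hq]
  exact hρ.summable hq hz

/-- On a compact set of exponents the series of the root function has a summable majorant. -/
theorem exists_summable_norm_rootTerm_le {ρ : ℝ → ℂ} (hρ : GrowthCondition ρ) {q : ℕ} (hq : 2 ≤ q)
    {X : Type*} [TopologicalSpace X] {C : Set X} (hC : IsCompact C) {z : X → ℂ}
    (hz : ContinuousOn z C) (h : ∀ s ∈ C, 1 < (z s).re) :
    ∃ u : ℤ → ℝ, Summable u ∧ ∀ m, ∀ s ∈ C, ‖rootTerm q ρ (z s) m‖ ≤ u m := by
  rcases C.eq_empty_or_nonempty with rfl | hne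
  · exact ⟨0, summable_zero, by simp⟩
  have hq1 : (1 : ℝ) ≤ q := by exact_mod_cast (by omega : 1 ≤ q)
  have hre : ContinuousOn (fun s => (z s).re) C := Complex.continuous_re.comp_continuousOn hz
  obtain ⟨s₀, hs₀, hmin⟩ := hC.exists_isMinOn hne hre
  obtain ⟨s₁, hs₁, hmax⟩ := hC.exists_isMaxOn hne hre
  -- For m ≥ 0 the power of q is largest where Re z is maximal, for m ≤ 0 where it is minimal; the
  -- sum of the two extreme series dominates both cases.
  refine ⟨_, (hρ.summable hq (h s₀ hs₀)).add (hρ.summable hq (h s₁ hs₁)), fun m s hs => ?_⟩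
  rw [norm_rootTerm hq, ← mul_add]
  refine mul_le_mul_of_nonneg_left ?_ (by positivity)
  have h0 : (z s₀).re ≤ (z s).re := hmin hs
  have h1 : (z s).re ≤ (z s₁).re := hmax hs
  rcases le_total 0 m with hm | hm
  · have hm' : (0 : ℝ) ≤ m := by exact_mod_cast hm
    have : (q : ℝ) ^ ((m : ℝ) * (z s).re) ≤ (q : ℝ) ^ ((m : ℝ) * (z s₁).re) :=
      Real.rpow_le_rpow_of_exponent_le hq1 (by gcongr)
    have : (0 : ℝ) ≤ (q : ℝ) ^ ((m : ℝ) * (z s₀).re) := by positivity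
    linarith
  · have hm' : (m : ℝ) ≤ 0 := by exact_mod_cast hm
    have : (q : ℝ) ^ ((m : ℝ) * (z s).re) ≤ (q : ℝ) ^ ((m : ℝ) * (z s₀).re) :=
      Real.rpow_le_rpow_of_exponent_le hq1 (mul_le_mul_of_nonpos_left h0 hm')
    have : (0 : ℝ) ≤ (q : ℝ) ^ ((m : ℝ) * (z s₁).re) := by positivity
    linarith

theorem one_sub_cpow_neg_ne_zero {q : ℕ} (hq : 2 ≤ q) {w : ℂ} (hw : 0 < w.re) :
    1 - (q : ℂ) ^ (-w) ≠ 0 := by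
  intro h
  have h1 := norm_natCast_cpow_neg_lt_one hq hw
  rw [← sub_eq_zero.1 h, norm_one] at h1
  exact lt_irrefl _ h1

/-- The density is 1 - 1/q for all k plus 1/q at k = 0. With w = q^{-(z-1)} the sum is (1 - 1/q)/(1
- w) + 1/q = (1 - w/q)/(1 - w), and w/q = q^{-z}. -/
theorem hasSum_rootDensity {q : ℕ} (hq : 2 ≤ q) {z : ℂ} (hz : 1 < z.re) :
    HasSum (fun k : ℕ => (PField.rootDensity q k : ℂ) * (q : ℂ) ^ (-((k : ℂ) * (z - 1))))
      (rootFactor q z) := by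
  have hq0 : (q : ℂ) ≠ 0 := by exact_mod_cast (by omega : q ≠ 0)
  have hw : 0 < (z - 1).re := by simpa using hz
  have h1 : HasSum (fun k : ℕ => (1 - (q : ℂ)⁻¹) * ((q : ℂ) ^ (-(z - 1))) ^ k)
      ((1 - (q : ℂ)⁻¹) * (1 - (q : ℂ) ^ (-(z - 1)))⁻¹) :=
    (hasSum_geometric_of_norm_lt_one (norm_natCast_cpow_neg_lt_one hq hw)).mul_left _
  have h2 := h1.add (hasSum_ite_eq (0 : ℕ) ((q : ℂ)⁻¹))
  refine HasSum.of_eq h2 (fun k => ?_) ?_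
  · rcases eq_or_ne k 0 with rfl | hk
    · simp [PField.rootDensity]
    · rw [PField.rootDensity, if_neg hk, if_neg hk, add_zero, ← Complex.cpow_nat_mul]
      push_cast
      rw [mul_neg]
  · have hd := one_sub_cpow_neg_ne_zero hq hw
    have e : (q : ℂ) ^ (-z) = (q : ℂ)⁻¹ * (q : ℂ) ^ (-(z - 1)) := by
      rw [← Complex.cpow_neg_one, ← Complex.cpow_add _ _ hq0]
      congr 1
      ring
    rw [rootFactor, e]
    field_simp
    ring

/-- If Re z ≤ 1, the terms with k ≥ 1 have norm at least 1 - 1/q ≥ 1/2 and do not tend to 0. -/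
theorem one_lt_re_of_summable_rootDensity {q : ℕ} (hq : 2 ≤ q) {z : ℂ}
    (h : Summable fun k : ℕ => (PField.rootDensity q k : ℂ) * (q : ℂ) ^ (-((k : ℂ) * (z - 1)))) :
    1 < z.re := by
  by_contra! hz
  have hq1 : (2 : ℝ) ≤ q := by exact_mod_cast hq
  have h1 := h.tendsto_atTop_zero.norm
  rw [norm_zero] at h1
  have h2 : ∀ᶠ k : ℕ in atTop, ‖(PField.rootDensity q k : ℂ) * (q : ℂ) ^ (-((k : ℂ) * (z - 1)))‖ < 1 / 2 :=
    h1.eventually_lt_const (by norm_num)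
  obtain ⟨k, hk, hk1⟩ := (h2.and (eventually_ge_atTop 1)).exists
  refine absurd hk (not_lt.2 ?_)
  have hinv : (q : ℝ)⁻¹ ≤ 2⁻¹ := inv_anti₀ (by norm_num) hq1
  rw [norm_mul, Complex.norm_real, Complex.norm_natCast_cpow_of_pos (by omega), PField.rootDensity,
    if_neg (by omega), Real.norm_of_nonneg (by linarith)]
  have h3 : (1 : ℝ) ≤ (q : ℝ) ^ (-((k : ℂ) * (z - 1))).re := by
    refine Real.one_le_rpow (by linarith) ?_
    simp only [Complex.neg_re, Complex.mul_re, Complex.natCast_re, Complex.natCast_im, zero_mul,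
      sub_zero, Complex.sub_re, Complex.one_re]
    have : (0 : ℝ) ≤ k := by positivity
    nlinarith
  nlinarith

/-! ### Openness, convexity and continuity on the polytopes -/

section Polytopes

variable {N : ℕ}

theorem one_lt_re_iff_mem_rootPolytope {a b : ℂ} {s : Pairs N → ℂ} :
    1 < ((N : ℂ) + a + b + ∑ p, s p).re ↔ s ∈ rootPolytope N a b := by
  simp only [rootPolytope, Set.mem_ofPred_eq, Complex.add_re, Complex.sub_re, Complex.one_re]
  constructor <;> intro h <;> linarith

/-- The set where the real part of an affine function is positive is open and convex. -/
theorem isOpen_and_convex_setOf_re_pos {ι : Type*} (c : ℂ) (f : (ι → ℂ) →L[ℝ] ℂ) :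
    IsOpen {s | 0 < (c + f s).re} ∧ Convex ℝ {s | 0 < (c + f s).re} := by
  refine ⟨isOpen_lt continuous_const (Complex.continuous_re.comp (by fun_prop)), ?_⟩
  have h : {s | 0 < (c + f s).re} = {s | -c.re < (Complex.reCLM ∘L f) s} := by
    ext s
    simp [neg_lt_iff_pos_add']
  rw [h]
  exact convex_halfSpace_gt (Complex.reCLM ∘L f).toLinearMap.isLinear _

/-- The sum of the coordinates in a finite set. -/
def sumCLM {ι : Type*} (A : Finset ι) : (ι → ℂ) →L[ℝ] ℂ :=
  ∑ p ∈ A, ContinuousLinearMap.proj p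

theorem sumCLM_apply {ι : Type*} (A : Finset ι) (s : ι → ℂ) : sumCLM A s = ∑ p ∈ A, s p := by
  simp [sumCLM]

theorem isOpen_and_convex_rootPolytope (a b : ℂ) :
    IsOpen (rootPolytope N a b) ∧ Convex ℝ (rootPolytope N a b) := by
  have h := isOpen_and_convex_setOf_re_pos ((N : ℂ) - 1 + a + b)
    (sumCLM (Finset.univ : Finset (Pairs N)))
  simp only [sumCLM_apply] at h
  exact h

namespace SplittingFiltration

variable (σ : SplittingFiltration N)

theorem isOpen_and_convex_branchPolytope :
    IsOpen σ.branchPolytope ∧ Convex ℝ σ.branchPolytope := by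
  have h : ∀ t : Finset (Fin N), IsOpen {s : Pairs N → ℂ | 0 < (branchExponent t s).re} ∧
      Convex ℝ {s : Pairs N → ℂ | 0 < (branchExponent t s).re} := fun t => by
    have h1 := isOpen_and_convex_setOf_re_pos ((t.card : ℂ) - 1)
      (sumCLM (Finset.univ.filter fun p : Pairs N => p.1.1 ∈ t ∧ p.1.2 ∈ t))
    simp only [sumCLM_apply] at h1
    exact h1
  exact ⟨isOpen_biInter_finset fun t _ => (h t).1, convex_iInter₂ fun t _ => (h t).2⟩

theorem isOpen_and_convex_levelPolytope (b : ℂ) :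
    IsOpen (σ.levelPolytope b) ∧ Convex ℝ (σ.levelPolytope b) := by
  have h : ∀ ℓ : ℕ, IsOpen {s : Pairs N → ℂ | 0 < (b + σ.levelExponent ℓ s).re} ∧
      Convex ℝ {s : Pairs N → ℂ | 0 < (b + σ.levelExponent ℓ s).re} := fun ℓ => by
    have h1 := isOpen_and_convex_setOf_re_pos
      (b + ∑ t ∈ σ.branches ∩ σ.part ℓ, ((t.card : ℂ) - 1))
      (∑ t ∈ σ.branches ∩ σ.part ℓ,
        sumCLM (Finset.univ.filter fun p : Pairs N => p.1.1 ∈ t ∧ p.1.2 ∈ t))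
    simp only [_root_.sum_apply, sumCLM_apply, add_assoc,
      ← Finset.sum_add_distrib] at h1
    exact h1
  exact ⟨isOpen_biInter_finset fun ℓ _ => (h ℓ).1, convex_iInter₂ fun ℓ _ => (h ℓ).2⟩

theorem continuous_levelExponent (ℓ : ℕ) : Continuous (σ.levelExponent ℓ) := by
  unfold levelExponent branchExponent
  fun_prop

end SplittingFiltration

theorem isOpen_and_convex_omegaPolytope (q : ℕ) (a b : ℂ) :
    IsOpen (omegaPolytope N q a b) ∧ Convex ℝ (omegaPolytope N q a b) :=
  ⟨(isOpen_and_convex_rootPolytope a b).1.inter (isOpen_iInter_of_finite fun σ =>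
      isOpen_iInter_of_finite fun _ => (σ.isOpen_and_convex_levelPolytope b).1),
    (isOpen_and_convex_rootPolytope a b).2.inter (convex_iInter₂ fun σ _ =>
      (σ.isOpen_and_convex_levelPolytope b).2)⟩

theorem isOpen_and_convex_reducedPolytope (q : ℕ) (a : ℂ) :
    IsOpen (reducedPolytope N q a) ∧ Convex ℝ (reducedPolytope N q a) :=
  ⟨(isOpen_and_convex_rootPolytope a 0).1.inter (isOpen_iInter_of_finite fun σ =>
      isOpen_iInter_of_finite fun _ => σ.isOpen_and_convex_branchPolytope.1),
    (isOpen_and_convex_rootPolytope a 0).2.inter (convex_iInter₂ fun σ _ =>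
      σ.isOpen_and_convex_branchPolytope.2)⟩

theorem mem_levelPolytope_of_mem_omegaPolytope {q : ℕ} {a b : ℂ} {s : Pairs N → ℂ}
    (hs : s ∈ omegaPolytope N q a b) (σ : SplittingFiltration N) (hσ : 0 < σ.multiplicity q) :
    s ∈ σ.levelPolytope b :=
  Set.mem_iInter₂.1 hs.2 σ hσ

theorem continuousOn_levelSum {q : ℕ} (hq : 2 ≤ q) (a b : ℂ) :
    ContinuousOn (levelSum N q b) (omegaPolytope N q a b) := by
  have hq0 : (q : ℂ) ≠ 0 := by exact_mod_cast (by omega : q ≠ 0)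
  refine continuousOn_finsetSum _ fun σ hσ => ContinuousOn.mul continuousOn_const ?_
  refine continuousOn_finsetProd _ fun ℓ hℓ => ContinuousOn.div continuousOn_const ?_ fun s hs h => ?_
  · have := (σ.continuous_levelExponent ℓ)
    exact (((continuous_const.add this).const_cpow (Or.inl hq0)).sub continuous_const).continuousOn
  · have h1 : 0 < (b + σ.levelExponent ℓ s).re := Set.mem_iInter₂.1
      (mem_levelPolytope_of_mem_omegaPolytope hs σ (Finset.mem_filter.1 hσ).2) ℓ hℓ
    refine one_sub_cpow_neg_ne_zero hq h1 ?_
    rw [Complex.cpow_neg, sub_eq_zero.1 h, inv_one, sub_self]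

theorem continuousOn_rootFactor {q : ℕ} (hq : 2 ≤ q) (a b : ℂ) :
    ContinuousOn (fun s : Pairs N → ℂ => rootFactor q (N + a + b + ∑ p, s p))
      (rootPolytope N a b) := by
  have hq0 : (q : ℂ) ≠ 0 := by exact_mod_cast (by omega : q ≠ 0)
  have hz : Continuous fun s : Pairs N → ℂ => ((N : ℂ) + a + b + ∑ p, s p) := by fun_prop
  refine ContinuousOn.div ?_ ?_ fun s hs => ?_
  · exact (continuous_const.sub (hz.neg.const_cpow (Or.inl hq0))).continuousOn
  · exact (continuous_const.sub ((hz.sub continuous_const).neg.const_cpow (Or.inl hq0))).continuousOn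
  · refine one_sub_cpow_neg_ne_zero hq ?_
    have := one_lt_re_iff_mem_rootPolytope.2 hs
    rw [Complex.sub_re, Complex.one_re]
    linarith

end Polytopes

/-! ### Region of convergence and evaluation of the integral -/

namespace PField

variable {K : Type*} [Field K] [ValuativeRel K] [TopologicalSpace K] [IsNonarchimedeanLocalField K]
  [MeasurableSpace K] [BorelSpace K] {N : ℕ}

theorem hasSum_cellTerm (hN : 2 ≤ N) {q : ℕ} (hq : 2 ≤ q) {ρ : ℝ → ℂ} (hρ : GrowthCondition ρ)
    {a b : ℂ} {s : Pairs N → ℂ} (hs : s ∈ omegaPolytope N q a b) :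
    HasSum (cellTerm q ρ a b s)
      (rootFunction q ρ (N + a + b + ∑ p, s p) * levelSum N q b s) := by
  have hz : 1 < ((N : ℂ) + a + b + ∑ p, s p).re := one_lt_re_iff_mem_rootPolytope.2 hs.1
  have h1 := summable_norm_rootTerm hρ hq hz
  have h2 := hasSum_rootDensity hq hz
  have h3 := SplitSequence.hasSum_weight hN hq (mem_levelPolytope_of_mem_omegaPolytope hs)
  have h4 := summable_mul_of_summable_norm h2.summable.norm h3.summable.norm
  have h5 := h2.mul h3 h4
  have h6 := summable_mul_of_summable_norm h1 h4.norm
  refine HasSum.of_eq (h1.of_norm.hasSum.mul h5 h6) (fun x => rfl) ?_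
  rw [rootFunction]
  ring

theorem zConverges_of_mem_omegaPolytope (hN : 2 ≤ N) {ρ : ℝ → ℂ} (hρ : GrowthCondition ρ)
    {a b : ℂ} {s : Pairs N → ℂ} (hs : s ∈ omegaPolytope N (residueCard K) a b) :
    ZConverges K ρ a b s :=
  (zConverges_iff hN ρ a b s).2 (hasSum_cellTerm hN two_le_residueCard hρ hs).summable

theorem Z_eq (hN : 2 ≤ N) {ρ : ℝ → ℂ} (hρ : GrowthCondition ρ)
    {a b : ℂ} {s : Pairs N → ℂ} (hs : s ∈ omegaPolytope N (residueCard K) a b) :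
    Z K ρ a b s = rootFunction (residueCard K) ρ (N + a + b + ∑ p, s p) *
      levelSum N (residueCard K) b s :=
  (hasSum_Z hN (zConverges_of_mem_omegaPolytope hN hρ hs)).unique
    (hasSum_cellTerm hN two_le_residueCard hρ hs)

-- Otherwise, by the factorisation with ρ = 1 and a = 0, all cells would be null and so would K^N.
-- Such a P isolates the series over k when the root condition is derived.
variable (K) in
theorem exists_weight_ne_zero (hN : 2 ≤ N) (b : ℂ) (s : Pairs N → ℂ) :
    ∃ P : SplitSequence N, P.weight (residueCard K) b s ≠ 0 := by
  have hq := two_le_residueCard (K := K)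
  have hq0 : (residueCard K : ℂ) ≠ 0 := by exact_mod_cast (by omega : residueCard K ≠ 0)
  by_contra! h
  have hcell : ∀ y : ℤ × ℕ × SplitSequence N, piHaar K N (cell K y.1 y.2.1 y.2.2) = 0 := by
    rintro ⟨m, k, P⟩
    have h1 := piHaar_real_cell_mul_cellValue (K := K) hN (fun _ => 1) 0 b s m k P
    rw [cellTerm, h, mul_zero, mul_zero, mul_eq_zero] at h1
    have h2 := h1.resolve_right (mul_ne_zero one_ne_zero (by simp [Complex.cpow_eq_zero_iff, hq0]))
    rw [Complex.ofReal_eq_zero, measureReal_eq_zero_iff (piHaar_cell_ne_top hN m k P)] at h2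
    exact h2
  have h1 : piHaar K N Set.univ = 0 := by
    rw [← measure_iUnion_null hcell]
    refine (measure_congr ?_)
    exact (eventuallyEq_univ.2 (ae_mem_iUnion_cell hN)).symm
  have h2 : piHaar K N (Set.pi Set.univ fun _ => (𝒪[K] : Set K)) = 1 := by
    rw [Measure.pi_pi]
    simp [haar_integers]
  rw [measure_mono_null (Set.subset_univ _) h1] at h2
  exact zero_ne_one h2

/-- Subfamilies of a summable family are summable. With m fixed so that ρ(q^m) ≠ 0, varying k at a P
of nonzero weight gives the root condition, and varying ν at k = 0 gives the level conditions of σ.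
-/
theorem mem_omegaPolytope_of_zConverges (hN : 2 ≤ N) {ρ : ℝ → ℂ} {a b : ℂ} {s : Pairs N → ℂ}
    {m : ℤ} (hm : ρ ((residueCard K : ℝ) ^ m) ≠ 0) (h : ZConverges K ρ a b s) :
    s ∈ omegaPolytope N (residueCard K) a b := by
  have hq := two_le_residueCard (K := K)
  have hq0 : (residueCard K : ℂ) ≠ 0 := by exact_mod_cast (by omega : residueCard K ≠ 0)
  have hsum := (zConverges_iff hN ρ a b s).1 h
  have hroot : rootTerm (residueCard K) ρ (N + a + b + ∑ p, s p) m ≠ 0 :=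
    mul_ne_zero hm (by simp [Complex.cpow_eq_zero_iff, hq0])
  refine ⟨?_, Set.mem_iInter₂.2 fun σ hσ => ?_⟩
  · obtain ⟨P, hP⟩ := exists_weight_ne_zero K hN b s
    have h1 := hsum.comp_injective (i := fun k : ℕ => (m, k, P)) fun k k' hk => by simpa using hk
    have h2 : Summable fun k : ℕ => rootTerm (residueCard K) ρ (N + a + b + ∑ p, s p) m *
        ((rootDensity (residueCard K) k : ℂ) *
          (residueCard K : ℂ) ^ (-((k : ℂ) * (N + a + b + ∑ p, s p - 1))) *
            P.weight (residueCard K) b s) := h1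
    rw [summable_mul_left_iff hroot, summable_mul_right_iff hP] at h2
    exact one_lt_re_iff_mem_rootPolytope.1 (one_lt_re_of_summable_rootDensity hq h2)
  · have h1 := hsum.comp_injective (i := fun ν : Finset.Ico 1 σ.length → ℕ =>
      (m, 0, SplittingFiltration.sequenceEquiv hN ⟨σ, ν⟩)) fun ν ν' hν => by simpa using hν
    have h2 : Summable fun ν : Finset.Ico 1 σ.length → ℕ =>
        rootTerm (residueCard K) ρ (N + a + b + ∑ p, s p) m *
        ((rootDensity (residueCard K) 0 : ℂ) *
          (residueCard K : ℂ) ^ (-(((0 : ℕ) : ℂ) * (N + a + b + ∑ p, s p - 1))) *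
            (SplittingFiltration.sequenceEquiv hN ⟨σ, ν⟩).weight (residueCard K) b s) := h1
    rw [summable_mul_left_iff hroot, summable_mul_left_iff (by simp [rootDensity])] at h2
    exact SplittingFiltration.mem_levelPolytope_of_summable σ hN hq hσ h2.norm

theorem summableUniformlyOn_norm_rootTerm {q : ℕ} (hq : 2 ≤ q) {ρ : ℝ → ℂ} (hρ : GrowthCondition ρ)
    {a b : ℂ} {C : Set (Pairs N → ℂ)} (hC : C ⊆ omegaPolytope N q a b) (hC' : IsCompact C) :
    SummableUniformlyOn
      (fun (m : ℤ) (s : Pairs N → ℂ) => ‖rootTerm q ρ (N + a + b + ∑ p, s p) m‖) C := by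
  obtain ⟨u, hu, hle⟩ := exists_summable_norm_rootTerm_le hρ hq hC'
    (z := fun s : Pairs N → ℂ => (N : ℂ) + a + b + ∑ p, s p)
    (by fun_prop) fun s hs => one_lt_re_iff_mem_rootPolytope.2 (hC hs).1
  exact (HasSumUniformlyOn.of_norm_le_summable hu fun m s hs => by
    rw [norm_norm]
    exact hle m s hs).summableUniformlyOn

/-- Weierstrass test: the root factor and the level sum are continuous, hence bounded on C, and the
root terms have a summable majorant. -/
theorem hasSumUniformlyOn_Z (hN : 2 ≤ N) {ρ : ℝ → ℂ} (hρ : GrowthCondition ρ)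
    {a b : ℂ} {C : Set (Pairs N → ℂ)} (hC : C ⊆ omegaPolytope N (residueCard K) a b)
    (hC' : IsCompact C) :
    HasSumUniformlyOn
      (fun (m : ℤ) (s : Pairs N → ℂ) => rootFactor (residueCard K) (N + a + b + ∑ p, s p) *
        rootTerm (residueCard K) ρ (N + a + b + ∑ p, s p) m * levelSum N (residueCard K) b s)
      (fun s => Z K ρ a b s) C := by
  have hq := two_le_residueCard (K := K)
  obtain ⟨u, hu, hle⟩ := exists_summable_norm_rootTerm_le hρ hq hC'
    (z := fun s : Pairs N → ℂ => (N : ℂ) + a + b + ∑ p, s p)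
    (by fun_prop) fun s hs => one_lt_re_iff_mem_rootPolytope.2 (hC hs).1
  obtain ⟨A, hA⟩ := hC'.exists_bound_of_continuousOn
    ((continuousOn_rootFactor hq a b).mono fun s hs => (hC hs).1)
  obtain ⟨B, hB⟩ := hC'.exists_bound_of_continuousOn ((continuousOn_levelSum hq a b).mono hC)
  have h := HasSumUniformlyOn.of_norm_le_summable (s := C)
    (f := fun (m : ℤ) (s : Pairs N → ℂ) => rootFactor (residueCard K) (N + a + b + ∑ p, s p) *
        rootTerm (residueCard K) ρ (N + a + b + ∑ p, s p) m * levelSum N (residueCard K) b s)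
    (hu.mul_left A |>.mul_right B) fun m s hs => by
      rw [norm_mul, norm_mul]
      have hA0 : 0 ≤ A := (_root_.norm_nonneg _).trans (hA s hs)
      have hu0 : 0 ≤ u m := (_root_.norm_nonneg _).trans (hle m s hs)
      exact mul_le_mul (mul_le_mul (hA s hs) (hle m s hs) (_root_.norm_nonneg _) hA0) (hB s hs)
        (_root_.norm_nonneg _) (mul_nonneg hA0 hu0)
  refine h.congr_right fun s hs => ?_
  dsimp only
  rw [Z_eq hN hρ (hC hs), rootFunction, tsum_mul_right, tsum_mul_left]

end PField

end

theorem mainTheorem1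
    (K : Type*) [Field K] [ValuativeRel K] [TopologicalSpace K] [IsNonarchimedeanLocalField K]
    [MeasurableSpace K] [BorelSpace K]
    (N : ℕ) (hN : 2 ≤ N) (q : ℕ) (hq : q = PField.residueCard K) (a b : ℂ)
    (ρ : ℝ → ℂ) (hρ : GrowthCondition ρ) :
    -- (a) the largest open region of absolute convergence
    (IsOpen (omegaPolytope N q a b) ∧ Convex ℝ (omegaPolytope N q a b) ∧
      (∀ s ∈ omegaPolytope N q a b, PField.ZConverges K ρ a b s) ∧
      ((∃ m : ℤ, ρ ((q : ℝ) ^ m) ≠ 0) →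
        IsGreatest {U : Set (Pairs N → ℂ) | IsOpen U ∧ ∀ s ∈ U, PField.ZConverges K ρ a b s}
          (omegaPolytope N q a b))) ∧
    -- (b) the formula with level functions
    (∀ C ⊆ omegaPolytope N q a b, IsCompact C →
      (∀ s ∈ C, PField.Z K ρ a b s =
        rootFunction q ρ (N + a + b + ∑ p, s p) * levelSum N q b s) ∧
      SummableUniformlyOn
        (fun (m : ℤ) (s : Pairs N → ℂ) => ‖rootTerm q ρ (N + a + b + ∑ p, s p) m‖) C ∧
      HasSumUniformlyOn
        (fun (m : ℤ) (s : Pairs N → ℂ) => rootFactor q (N + a + b + ∑ p, s p) *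
          rootTerm q ρ (N + a + b + ∑ p, s p) m * levelSum N q b s)
        (fun s => PField.Z K ρ a b s) C) ∧
    -- (c) summation of level functions over a reduction class
    (∀ σ' : SplittingFiltration N, σ'.IsReduced →
      (∀ σ : SplittingFiltration N, σ.Equivalent σ' → σ'.branchPolytope ⊆ σ.levelPolytope 0) ∧
      ∀ s ∈ σ'.branchPolytope,
        ∑ σ : SplittingFiltration N with σ.Equivalent σ', σ.levelFunction q 0 s =
          σ'.branchFunction q s) ∧
    -- (c) the formula with branch functions for `b = 0`
    (IsOpen (reducedPolytope N q a) ∧ Convex ℝ (reducedPolytope N q a) ∧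
      (∀ s ∈ reducedPolytope N q a, PField.ZConverges K ρ a 0 s) ∧
      ∀ C ⊆ reducedPolytope N q a, IsCompact C →
        (∀ s ∈ C, PField.Z K ρ a 0 s =
          rootFunction q ρ (N + a + ∑ p, s p) * branchSum N q s) ∧
        SummableUniformlyOn
          (fun (m : ℤ) (s : Pairs N → ℂ) => ‖rootTerm q ρ (N + a + ∑ p, s p) m‖) C ∧
        HasSumUniformlyOn
          (fun (m : ℤ) (s : Pairs N → ℂ) => rootFactor q (N + a + ∑ p, s p) *
            rootTerm q ρ (N + a + ∑ p, s p) m * branchSum N q s)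
          (fun s => PField.Z K ρ a 0 s) C) := by

  subst hq
  have hq := PField.two_le_residueCard (K := K)
  refine ⟨⟨(isOpen_and_convex_omegaPolytope _ a b).1, (isOpen_and_convex_omegaPolytope _ a b).2,
    fun s hs => PField.zConverges_of_mem_omegaPolytope hN hρ hs, fun ⟨m, hm⟩ => ⟨⟨
      (isOpen_and_convex_omegaPolytope _ a b).1,
      fun s hs => PField.zConverges_of_mem_omegaPolytope hN hρ hs⟩, fun U hU s hs =>
      PField.mem_omegaPolytope_of_zConverges hN hm (hU.2 s hs)⟩⟩,
    fun C hC hC' => ⟨fun s hs => PField.Z_eq hN hρ (hC hs),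
      PField.summableUniformlyOn_norm_rootTerm hq hρ hC hC',
      PField.hasSumUniformlyOn_Z hN hρ hC hC'⟩,
    fun σ' _ => ⟨fun σ hσ => SplittingFiltration.branchPolytope_subset_levelPolytope hN hσ,
      fun s hs => SplittingFiltration.sum_levelFunction_eq_branchFunction hN hq σ' hs⟩,
    (isOpen_and_convex_reducedPolytope _ a).1, (isOpen_and_convex_reducedPolytope _ a).2,
    fun s hs => PField.zConverges_of_mem_omegaPolytope hN hρ
      (reducedPolytope_subset_omegaPolytope hN _ a hs), fun C hC hC' => ?_⟩
  -- The reduced polytope lies in Ω for b = 0, where the previous results apply; the level sum is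
  -- then replaced pointwise by the branch sum.
  have hCo := hC.trans (reducedPolytope_subset_omegaPolytope hN (PField.residueCard K) a)
  have h1 := PField.summableUniformlyOn_norm_rootTerm hq hρ hCo hC'
  have h2 := PField.hasSumUniformlyOn_Z hN hρ hCo hC'
  simp only [add_zero] at h1 h2
  refine ⟨fun s hs => ?_, h1, h2.congr (Eventually.of_forall fun m s hs => ?_)⟩
  · rw [PField.Z_eq hN hρ (hCo hs), levelSum_zero_eq_branchSum hN hq (hC hs), add_zero]
  · refine Finset.sum_congr rfl fun m _ => ?_
    rw [levelSum_zero_eq_branchSum hN hq (hC hs)]
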